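/- For a permutation $\pi$ of $[n]=\{1,\dots,n\}$, $n\ge 1$, a down step is a position $i<n$ with $\pi(i+1)<\pi(i)$. Cutting the sequence $\pi(1),\dots,\pi(n)$ exactly after its down steps yields the ascending runs of $\pi$; let $\rho=\rho(\pi)$ be their number and $R=R(\pi)=\langle n_1,\dots,n_\rho\rangle$ the sequence of their lengths, so that $n_1+\cdots+n_\rho=n$. Put $H(R)=\sum_{j=1}^{\rho}\frac{n_j}{n}\lg\frac{n}{n_j}$, where $\lg=\log_2$. Theorem (Wavelet Tree on Runs). There is an encoding scheme on the word RAM with words of $\Theta(\log n)$ bits, that is, a map that assigns to each permutation $\pi$ of $[n]$, for every $n\ge 1$, a bit string $E(\pi)$, together with two fixed word-RAM programs (independent of $n$ and $\pi$), such that the following holds for some constant $C$ and some function $\varepsilon:\mathbb{N}\to\mathbb{R}$ with $\varepsilon(n)\to 0$ as $n\to\infty$, both independent of $\pi$, and for word length $c(\lfloor\lg n\rfloor+1)$ with a constant integer $c\ge 1$. For every $n\ge 1$ and every permutation $\pi$ of $[n]$: 1. $E(\pi)$ has at most $n(2+H(R))(1+\varepsilon(n))+C\rho\lg n$ bits. 2.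 With read-only access to $E(\pi)$, stored in consecutive machine words, the first program computes $\pi(i)$ and the second computes $\pi^{-1}(i)$ for every given $i\in[n]$, each in at most $C(1+\lg\rho)$ steps. 3. For each of the two programs, the average number of steps, for $i$ chosen uniformly at random in $[n]$, is at most $C(1+H(R))$. -/

import Mathlib

open Filter Topology

/-! ### Runs and entropy -/

/-- The lengths, from left to right, of the ascending runs of `π`: the one-line notation
`π(1), …, π(n)` is cut exactly at its down steps (an entry followed by a smaller one). -/
def runLengths {n : ℕ} (π : Equiv.Perm (Fin n)) : List ℕ :=
  ((List.ofFn π).splitBy (fun a b => decide (a < b))).map List.length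

/-- The number of ascending runs of `π`. -/
def numRuns {n : ℕ} (π : Equiv.Perm (Fin n)) : ℕ := (runLengths π).length

/-- The entropy `∑ (nᵢ / n) lg (n / nᵢ)` of a sequence of positive integers with sum `n`. -/
noncomputable def entropy (X : List ℕ) : ℝ :=
  (X.map fun m : ℕ => (m : ℝ) / (X.sum : ℝ) * Real.logb 2 ((X.sum : ℝ) / (m : ℝ))).sum

/-! ### The word RAM

Words of `w` bits are natural numbers below `2 ^ w`; every value that is written is reduced modulo
`2 ^ w`. The data structure is a read-only bit string, packed into words. -/

namespace WordRAM

/-- The binary operations on words. -/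
inductive Op where
  | add | sub | mul | div | mod | and | or | xor | shl | shr | lt | eq

/-- The result of an operation on `w`-bit words. Subtraction wraps around, `x / 0 = 0`,
`x mod 0 = x`, and a comparison returns `1` or `0`. -/
def Op.eval (w : ℕ) : Op → ℕ → ℕ → ℕ
  | .add, x, y => (x + y) % 2 ^ w
  | .sub, x, y => (x + (2 ^ w - y)) % 2 ^ w
  | .mul, x, y => (x * y) % 2 ^ w
  | .div, x, y => (x / y) % 2 ^ w
  | .mod, x, y => (x % y) % 2 ^ w
  | .and, x, y => (x &&& y) % 2 ^ w
  | .or, x, y => (x ||| y) % 2 ^ w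
  | .xor, x, y => (x ^^^ y) % 2 ^ w
  | .shl, x, y => (x <<< y) % 2 ^ w
  | .shr, x, y => (x >>> y) % 2 ^ w
  | .lt, x, y => (if x < y then 1 else 0) % 2 ^ w
  | .eq, x, y => (if x = y then 1 else 0) % 2 ^ w

/-- Programs. A program mentions finitely many registers and constants and does not depend on
the word length or on the input. -/
inductive Prog where
  /-- put the constant `k` into register `r` -/
  | const (r k : ℕ)
  /-- apply `o` to registers `a`, `b` and put the result into register `r` -/
  | binop (o : Op) (r a b : ℕ)
  /-- put into register `r` the word of the data structure whose address is in register `a` -/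
  | read (r a : ℕ)
  /-- put into register `r` the word of working memory whose address is in register `a` -/
  | load (r a : ℕ)
  /-- store register `r` in working memory at the address in register `a` -/
  | store (a r : ℕ)
  | seq (p q : Prog)
  /-- run `p` if register `r` is nonzero, and `q` otherwise -/
  | ite (r : ℕ) (p q : Prog)
  /-- repeat `p` as long as register `r` is nonzero -/
  | while (r : ℕ) (p : Prog)

/-- The registers and the working memory. -/
structure State where
  reg : ℕ → ℕ
  mem : ℕ → ℕ

/-- The state in which register `r` is set to `x`. -/
def State.setReg (s : State) (r x : ℕ) : State := { s with reg := Function.update s.reg r x }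

/-- The state in which cell `a` of the working memory is set to `x`. -/
def State.setMem (s : State) (a x : ℕ) : State := { s with mem := Function.update s.mem a x }

/-- The `k`-th `w`-bit word of the bit string `D`: its `j`-th bit (of weight `2 ^ j`) is bit
`k * w + j` of `D`, and bits beyond the end of `D` are zero. -/
def dataWord (w : ℕ) (D : List Bool) (k : ℕ) : ℕ :=
  Nat.ofBits fun j : Fin w => D.getD (k * w + j) false

/-- `Exec w D p s t s'`: on words of `w` bits and with read-only data `D`, the program `p`, started
in state `s`, halts in state `s'` after exactly `t` steps. Every elementary instruction and every
test of a register takes one step. -/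
inductive Exec (w : ℕ) (D : List Bool) : Prog → State → ℕ → State → Prop where
  | const (r k : ℕ) (s : State) :
      Exec w D (.const r k) s 1 (s.setReg r (k % 2 ^ w))
  | binop (o : Op) (r a b : ℕ) (s : State) :
      Exec w D (.binop o r a b) s 1 (s.setReg r (o.eval w (s.reg a) (s.reg b)))
  | read (r a : ℕ) (s : State) :
      Exec w D (.read r a) s 1 (s.setReg r (dataWord w D (s.reg a)))
  | load (r a : ℕ) (s : State) :
      Exec w D (.load r a) s 1 (s.setReg r (s.mem (s.reg a)))
  | store (a r : ℕ) (s : State) :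
      Exec w D (.store a r) s 1 (s.setMem (s.reg a) (s.reg r))
  | seq {p q : Prog} {s s₁ s₂ : State} {t₁ t₂ : ℕ}
      (hp : Exec w D p s t₁ s₁) (hq : Exec w D q s₁ t₂ s₂) :
      Exec w D (.seq p q) s (t₁ + t₂) s₂
  | ite_true {r : ℕ} {p q : Prog} {s s' : State} {t : ℕ}
      (hr : s.reg r ≠ 0) (hp : Exec w D p s t s') : Exec w D (.ite r p q) s (t + 1) s'
  | ite_false {r : ℕ} {p q : Prog} {s s' : State} {t : ℕ}
      (hr : s.reg r = 0) (hq : Exec w D q s t s') : Exec w D (.ite r p q) s (t + 1) s'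
  | while_true {r : ℕ} {p : Prog} {s s₁ s₂ : State} {t₁ t₂ : ℕ}
      (hr : s.reg r ≠ 0) (hp : Exec w D p s t₁ s₁) (hw : Exec w D (.while r p) s₁ t₂ s₂) :
      Exec w D (.while r p) s (t₁ + t₂ + 1) s₂
  | while_false {r : ℕ} {p : Prog} {s : State}
      (hr : s.reg r = 0) : Exec w D (.while r p) s 1 s

/-- The initial state: the argument `x` is in register `0`, everything else is zero. -/
def initState (x : ℕ) : State := ⟨Function.update (fun _ => 0) 0 x, fun _ => 0⟩

/-- With access to the bit string `D` in words of `w` bits, the program `p` computes from the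
argument `x` the value `y` (found in register `0` at the end), in exactly `t` steps. -/
def Computes (w : ℕ) (D : List Bool) (p : Prog) (x y t : ℕ) : Prop :=
  ∃ s : State, Exec w D p (initState x) t s ∧ s.reg 0 = y

/-- A word length of `Θ(log n)` bits, where `c` is a constant. -/
def wordLength (c n : ℕ) : ℕ := c * (Nat.log 2 n + 1)

end WordRAM

/-! List the values in increasing order and write down for each the run in which it occurs. As π
increases along each run, the occurrences of a run's label belong to its positions in order. So the
inverse image of a value is the start of its run plus the number of earlier occurrences of the label
(`count_take_runSeq`), and applying π is the reverse computation. A wavelet tree over this sequence,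
with the runs as leaves, does both: descending takes one rank per level (`runs_down`), climbing one
select per level (`runs_up`).

The shape of the tree yields entropy and worst case at once. A run of length m may have depth
min(⌈lg(n/m)⌉, ⌈lg ρ⌉) + 1, because the weight 2^(-depth) is at most the mean of m/n and 1/ρ, and
both of these sum to 1 over the runs; Kraft's inequality then provides the tree
(`exists_mergeTree`). The bit vectors of all nodes together have as many bits as the sum of the
depths over all elements, which is at most n(2 + H). The same sum bounds the average query, and the
term lg ρ bounds every query.

The bit vectors are concatenated into a single one of N bits, with one directory that answers rank
and select in constant time (`eval_rank`, `eval_sel`). If l is the number of digits of n and k that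
of l, the directory takes O(N/l + N/k) bits plus lookup tables for windows of about k^4 bits, which
are o(n). Pointers and run starts take O(ρ lg n) bits.

To apply π, the run of a position has to be found first. Positions are cut into buckets of width
⌊n/ρ⌋ + 1, and a bisection runs over the runs that meet the bucket. This takes at most lg ρ + 1
rounds. On average it takes O(1) rounds: a range of q + 1 candidate runs costs at most q rounds, and
these differences telescope (`sum_search_le`).

On the machine, everything outside the loops is compiled from expressions, so only eight registers
have to be tracked. Words of 200 l bits are long enough for every address and number, also for small
n. -/

namespace WordRAM

/-! ### Expressions and their compilation to word-RAM programs -/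

/-- Expressions over eight variable registers. -/
inductive Ex where
  | v (r : Fin 8)
  | c (k : ℕ)
  | op (o : Op) (a b : Ex)
  | rd (a : Ex)
  | ite (i a b : Ex)

/-- The value of an expression on `w`-bit words with data `D`. -/
def Ex.eval (w : ℕ) (D : List Bool) (env : Fin 8 → ℕ) : Ex → ℕ
  | .v r => env r % 2 ^ w
  | .c k => k % 2 ^ w
  | .op o a b => o.eval w (a.eval w D env) (b.eval w D env)
  | .rd a => dataWord w D (a.eval w D env)
  | .ite i a b => if i.eval w D env ≠ 0 then a.eval w D env else b.eval w D env

/-- The program that puts the value of an expression into register `d`, with scratch registers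
above `d`. -/
def Ex.code : Ex → ℕ → Prog
  | .v r, d => .binop .or d r r
  | .c k, d => .const d k
  | .op o a b, d => .seq (a.code d) (.seq (b.code (d + 1)) (.binop o d d (d + 1)))
  | .rd a, d => .seq (a.code d) (.read d d)
  | .ite i a b, d => .seq (i.code d) (.ite d (a.code d) (b.code d))

/-- An upper bound for the number of steps that the evaluation of an expression takes. -/
def Ex.size : Ex → ℕ
  | .v _ => 1
  | .c _ => 1
  | .op _ a b => a.size + b.size + 1
  | .rd a => a.size + 1
  | .ite i a b => i.size + a.size + b.size + 1

theorem Op.eval_lt (w : ℕ) (o : Op) (x y : ℕ) : o.eval w x y < 2 ^ w := by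
  cases o <;> exact Nat.mod_lt _ (by positivity)

theorem dataWord_lt (w : ℕ) (D : List Bool) (k : ℕ) : dataWord w D k < 2 ^ w :=
  Nat.ofBits_lt_two_pow _

theorem Ex.eval_lt (w : ℕ) (D : List Bool) (env : Fin 8 → ℕ) (e : Ex) :
    e.eval w D env < 2 ^ w := by
  induction e with
  | v r => exact Nat.mod_lt _ (by positivity)
  | c k => exact Nat.mod_lt _ (by positivity)
  | op o a b => exact Op.eval_lt _ _ _ _
  | rd a => exact dataWord_lt _ _ _
  | ite i a b _ ha hb => simp only [Ex.eval]; split_ifs <;> assumption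

/-- The code for destination `d` changes no register below `d`. Hence a first operand that waits in
`d` survives the evaluation of the second one at `d + 1`, and the variables in the registers below 8
are never disturbed. -/
theorem Ex.exec_code (w : ℕ) (D : List Bool) (env : Fin 8 → ℕ) (e : Ex) :
    ∀ (d : ℕ) (s : State), 8 ≤ d → (∀ r : Fin 8, s.reg r = env r) →
      ∃ t ≤ e.size, ∃ s', Exec w D (e.code d) s t s' ∧ s'.reg d = e.eval w D env ∧
        ∀ r < d, s'.reg r = s.reg r := by
  induction e with
  | v r =>
    intro d s hd hs
    refine ⟨1, le_rfl, _, .binop _ _ _ _ _, ?_, ?_⟩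
    · simp [State.setReg, Op.eval, Ex.eval, hs]
    · intro q hq
      simp [State.setReg, Function.update_of_ne hq.ne]
  | c k =>
    intro d s hd hs
    refine ⟨1, le_rfl, _, .const _ _ _, ?_, ?_⟩
    · simp [State.setReg, Ex.eval]
    · intro q hq
      simp [State.setReg, Function.update_of_ne hq.ne]
  | op o a b iha ihb =>
    intro d s hd hs
    obtain ⟨t₁, h₁, s₁, e₁, v₁, f₁⟩ := iha d s hd hs
    obtain ⟨t₂, h₂, s₂, e₂, v₂, f₂⟩ := ihb (d + 1) s₁ (by omega)
      (fun r => by rw [f₁ r (by omega), hs])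
    refine ⟨t₁ + (t₂ + 1), by simp only [Ex.size]; omega, _,
      .seq e₁ (.seq e₂ (.binop _ _ _ _ _)), ?_, ?_⟩
    · simp [State.setReg, Ex.eval, f₂ d (by omega), v₁, v₂]
    · intro q hq
      simp [State.setReg, Function.update_of_ne hq.ne, f₂ q (by omega), f₁ q hq]
  | rd a iha =>
    intro d s hd hs
    obtain ⟨t₁, h₁, s₁, e₁, v₁, f₁⟩ := iha d s hd hs
    refine ⟨t₁ + 1, by simp only [Ex.size]; omega, _, .seq e₁ (.read _ _ _), ?_, ?_⟩
    · simp [State.setReg, Ex.eval, v₁]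
    · intro q hq
      simp [State.setReg, Function.update_of_ne hq.ne, f₁ q hq]
  | ite i a b ihi iha ihb =>
    intro d s hd hs
    obtain ⟨t₁, h₁, s₁, e₁, v₁, f₁⟩ := ihi d s hd hs
    have hs₁ : ∀ r : Fin 8, s₁.reg r = env r := fun r => by rw [f₁ r (by omega), hs]
    by_cases hi : i.eval w D env = 0
    · obtain ⟨t₂, h₂, s₂, e₂, v₂, f₂⟩ := ihb d s₁ hd hs₁
      refine ⟨t₁ + (t₂ + 1), by simp only [Ex.size]; omega, s₂,
        .seq e₁ (.ite_false (by rw [v₁, hi]) e₂), ?_, ?_⟩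
      · simp [Ex.eval, hi, v₂]
      · intro q hq
        rw [f₂ q hq, f₁ q hq]
    · obtain ⟨t₂, h₂, s₂, e₂, v₂, f₂⟩ := iha d s₁ hd hs₁
      refine ⟨t₁ + (t₂ + 1), by simp only [Ex.size]; omega, s₂,
        .seq e₁ (.ite_true (by rwa [v₁]) e₂), ?_, ?_⟩
      · simp [Ex.eval, hi, v₂]
      · intro q hq
        rw [f₂ q hq, f₁ q hq]

/-- From every state whose variable registers are described by `env`, the program halts within
`K` steps in a state whose variable registers are described by `env'`. -/
def Runs (w : ℕ) (D : List Bool) (p : Prog) (K : ℕ) (env env' : Fin 8 → ℕ) : Prop :=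
  ∀ s : State, (∀ r : Fin 8, s.reg r = env r) →
    ∃ t ≤ K, ∃ s', Exec w D p s t s' ∧ ∀ r : Fin 8, s'.reg r = env' r

/-- Evaluate an expression and put its value into a variable register. -/
def assign (r : Fin 8) (e : Ex) : Prog := .seq (e.code 8) (.binop .or r 8 8)

variable {w : ℕ} {D : List Bool}

theorem Runs.assign (r : Fin 8) (e : Ex) (env : Fin 8 → ℕ) :
    Runs w D (assign r e) (e.size + 1) env (Function.update env r (e.eval w D env)) := by
  intro s hs
  obtain ⟨t₁, h₁, s₁, e₁, v₁, f₁⟩ := e.exec_code w D env 8 s le_rfl hs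
  refine ⟨t₁ + 1, by omega, _, .seq e₁ (.binop _ _ _ _ _), fun q => ?_⟩
  by_cases hq : q = r
  · subst hq
    simp [State.setReg, Op.eval, v₁, Nat.mod_eq_of_lt (e.eval_lt w D env)]
  · have : (q : ℕ) ≠ r := fun h => hq (Fin.ext h)
    simp [State.setReg, Function.update_of_ne hq, Function.update_of_ne this, f₁ q q.2, hs]

theorem Runs.mono {p : Prog} {K K' : ℕ} {env env' : Fin 8 → ℕ} (h : Runs w D p K env env')
    (hK : K ≤ K') : Runs w D p K' env env' := fun s hs =>
  let ⟨t, ht, r⟩ := h s hs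
  ⟨t, ht.trans hK, r⟩

theorem Runs.seq {p q : Prog} {K K' : ℕ} {env env₁ env₂ : Fin 8 → ℕ}
    (hp : Runs w D p K env env₁) (hq : Runs w D q K' env₁ env₂) :
    Runs w D (.seq p q) (K + K') env env₂ := by
  intro s hs
  obtain ⟨t₁, h₁, s₁, e₁, f₁⟩ := hp s hs
  obtain ⟨t₂, h₂, s₂, e₂, f₂⟩ := hq s₁ f₁
  exact ⟨t₁ + t₂, by omega, s₂, .seq e₁ e₂, f₂⟩

theorem Runs.while_false {r : Fin 8} {p : Prog} {env : Fin 8 → ℕ} (hr : env r = 0) :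
    Runs w D (.while r p) 1 env env := fun s hs =>
  ⟨1, le_rfl, s, .while_false (by rw [hs, hr]), hs⟩

theorem Runs.while_true {r : Fin 8} {p : Prog} {K K' : ℕ} {env env₁ env₂ : Fin 8 → ℕ}
    (hr : env r ≠ 0) (hp : Runs w D p K env env₁) (hw : Runs w D (.while r p) K' env₁ env₂) :
    Runs w D (.while r p) (K + K' + 1) env env₂ := by
  intro s hs
  obtain ⟨t₁, h₁, s₁, e₁, f₁⟩ := hp s hs
  obtain ⟨t₂, h₂, s₂, e₂, f₂⟩ := hw s₁ f₁
  exact ⟨t₁ + t₂ + 1, by omega, s₂, .while_true (by rwa [hs]) e₁ e₂, f₂⟩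

theorem Runs.computes {p : Prog} {K x : ℕ} {env : Fin 8 → ℕ}
    (h : Runs w D p K (Function.update (fun _ => 0) 0 x) env) :
    ∃ t ≤ K, Computes w D p x (env 0) t := by
  obtain ⟨t, ht, s, e, f⟩ := h (initState x) (fun r => by
    by_cases hr : r = 0
    · subst hr; simp [initState]
    · have : (r : ℕ) ≠ 0 := fun h => hr (Fin.ext h)
      simp [initState, Function.update_of_ne hr, Function.update_of_ne this])
  exact ⟨t, ht, s, e, f 0⟩

/-! Arithmetic without overflow -/

section arith
variable {env : Fin 8 → ℕ} {a b : Ex} {x y : ℕ}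

theorem Ex.eval_v {r : Fin 8} (h : env r < 2 ^ w) : (Ex.v r).eval w D env = env r :=
  Nat.mod_eq_of_lt h

theorem Ex.eval_c {k : ℕ} (h : k < 2 ^ w) : (Ex.c k).eval w D env = k := Nat.mod_eq_of_lt h

theorem Ex.eval_add (ha : a.eval w D env = x) (hb : b.eval w D env = y) (h : x + y < 2 ^ w) :
    (Ex.op .add a b).eval w D env = x + y := by
  simp only [Ex.eval, Op.eval, ha, hb, Nat.mod_eq_of_lt h]

theorem Ex.eval_mul (ha : a.eval w D env = x) (hb : b.eval w D env = y) (h : x * y < 2 ^ w) :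
    (Ex.op .mul a b).eval w D env = x * y := by
  simp only [Ex.eval, Op.eval, ha, hb, Nat.mod_eq_of_lt h]

theorem Ex.eval_sub (ha : a.eval w D env = x) (hb : b.eval w D env = y) (h : y ≤ x) :
    (Ex.op .sub a b).eval w D env = x - y := by
  have hx : x < 2 ^ w := ha ▸ a.eval_lt w D env
  simp only [Ex.eval, Op.eval, ha, hb]
  rw [show x + (2 ^ w - y) = (x - y) + 2 ^ w by omega, Nat.add_mod_right]
  exact Nat.mod_eq_of_lt (by omega)

theorem Ex.eval_div (ha : a.eval w D env = x) (hb : b.eval w D env = y) :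
    (Ex.op .div a b).eval w D env = x / y := by
  have hx : x < 2 ^ w := ha ▸ a.eval_lt w D env
  simp only [Ex.eval, Op.eval, ha, hb]
  exact Nat.mod_eq_of_lt ((Nat.div_le_self _ _).trans_lt hx)

theorem Ex.eval_mod (ha : a.eval w D env = x) (hb : b.eval w D env = y) :
    (Ex.op .mod a b).eval w D env = x % y := by
  have hx : x < 2 ^ w := ha ▸ a.eval_lt w D env
  simp only [Ex.eval, Op.eval, ha, hb]
  exact Nat.mod_eq_of_lt ((Nat.mod_le _ _).trans_lt hx)

theorem Ex.eval_shr (ha : a.eval w D env = x) (hb : b.eval w D env = y) :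
    (Ex.op .shr a b).eval w D env = x >>> y := by
  have hx : x < 2 ^ w := ha ▸ a.eval_lt w D env
  simp only [Ex.eval, Op.eval, ha, hb]
  exact Nat.mod_eq_of_lt (by rw [Nat.shiftRight_eq_div_pow]; exact (Nat.div_le_self _ _).trans_lt hx)

theorem Ex.eval_shl (ha : a.eval w D env = x) (hb : b.eval w D env = y) :
    (Ex.op .shl a b).eval w D env = (x <<< y) % 2 ^ w := by
  simp only [Ex.eval, Op.eval, ha, hb]

theorem Ex.eval_or (ha : a.eval w D env = x) (hb : b.eval w D env = y) :
    (Ex.op .or a b).eval w D env = x ||| y := by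
  have hx : x < 2 ^ w := ha ▸ a.eval_lt w D env
  have hy : y < 2 ^ w := hb ▸ b.eval_lt w D env
  simp only [Ex.eval, Op.eval, ha, hb]
  exact Nat.mod_eq_of_lt (Nat.or_lt_two_pow hx hy)

theorem Ex.eval_lt_op (hw : 0 < w) (ha : a.eval w D env = x) (hb : b.eval w D env = y) :
    (Ex.op .lt a b).eval w D env = if x < y then 1 else 0 := by
  have : 1 < 2 ^ w := Nat.one_lt_two_pow hw.ne'
  simp only [Ex.eval, Op.eval, ha, hb]
  apply Nat.mod_eq_of_lt
  split_ifs <;> omega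

theorem Ex.eval_rd (ha : a.eval w D env = x) :
    (Ex.rd a).eval w D env = dataWord w D x := by
  simp only [Ex.eval, ha]

theorem Ex.eval_ite {i : Ex} {P : Prop} [Decidable P]
    (hi : i.eval w D env = if P then 1 else 0) (ha : P → a.eval w D env = x)
    (hb : ¬ P → b.eval w D env = x) : (Ex.ite i a b).eval w D env = x := by
  simp only [Ex.eval, hi]
  by_cases h : P
  · simp [h, ha h]
  · simp [h, hb h]

end arith

/-! Reading bit fields -/

/-- The number whose binary digits are the `k` bits of `D` from position `q` on. -/
def field (D : List Bool) (q k : ℕ) : ℕ := Nat.ofBits fun j : Fin k => D.getD (q + j) false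

theorem field_lt (D : List Bool) (q k : ℕ) : field D q k < 2 ^ k := Nat.ofBits_lt_two_pow _

theorem testBit_field (D : List Bool) (q k j : ℕ) :
    (field D q k).testBit j = (decide (j < k) && D.getD (q + j) false) := by
  unfold field
  by_cases h : j < k
  · simp [Nat.testBit_ofBits_lt _ _ h, h]
  · simp [Nat.testBit_ofBits_ge _ _ (not_lt.1 h), h]

theorem dataWord_eq_field (w : ℕ) (D : List Bool) (k : ℕ) : dataWord w D k = field D (k * w) w :=
  rfl

/-- At most `w` consecutive bits meet at most two words. The end of the first word and the beginning
of the second are glued by shifts; if `q` is a multiple of `w`, the second one is shifted out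
completely. -/
theorem field_eq_of_words (D : List Bool) {w q k : ℕ} (hw : 0 < w) (hk : k ≤ w) :
    field D q k = ((dataWord w D (q / w) >>> (q % w)) |||
      ((dataWord w D (q / w + 1) <<< (w - q % w)) % 2 ^ w)) % (2 ^ k) := by
  apply Nat.eq_of_testBit_eq
  intro j
  have hq := Nat.div_add_mod q w
  have hm := Nat.mod_lt q hw
  rw [mul_comm] at hq
  simp only [dataWord_eq_field, testBit_field, Nat.testBit_mod_two_pow, Nat.testBit_or,
    Nat.testBit_shiftRight, Nat.testBit_shiftLeft]
  by_cases hj : j < k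
  · have hjw : j < w := by omega
    by_cases h2 : q % w + j < w
    · have h3 : ¬ (w - q % w ≤ j) := by omega
      have : q / w * w + (q % w + j) = q + j := by omega
      simp [hj, h2, h3, this]
    · have h3 : (w - q % w ≤ j) := by omega
      have : (q / w + 1) * w + (j - (w - q % w)) = q + j := by
        rw [add_mul]; omega
      have h4 : j - (w - q % w) < w := by omega
      simp [hj, hjw, h2, h3, h4, this]
  · simp [hj]

/-- The expression that reads the field of `k` bits at bit address `q`, the word length being the
value of `we`. -/
def Ex.bits (we q k : Ex) : Ex :=
  .op .mod
    (.op .or (.op .shr (.rd (.op .div q we)) (.op .mod q we))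
      (.op .shl (.rd (.op .add (.op .div q we) (.c 1))) (.op .sub we (.op .mod q we))))
    (.op .shl (.c 1) k)

theorem Ex.eval_bits {we q k : Ex} {env : Fin 8 → ℕ} {x y : ℕ} (hwe : we.eval w D env = w)
    (hq : q.eval w D env = x) (hk : k.eval w D env = y) (h : y < w) (hx : x + 1 < 2 ^ w) :
    (Ex.bits we q k).eval w D env = field D x y := by
  have hw : 0 < w := by omega
  have h1 : 1 < 2 ^ w := Nat.one_lt_two_pow hw.ne'
  rw [field_eq_of_words D hw h.le]
  have hy : 2 ^ y < 2 ^ w := Nat.pow_lt_pow_right (by norm_num) h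
  refine Ex.eval_mod (Ex.eval_or (Ex.eval_shr (Ex.eval_rd (Ex.eval_div hq hwe))
    (Ex.eval_mod hq hwe)) (Ex.eval_shl (Ex.eval_rd (Ex.eval_add (Ex.eval_div hq hwe)
    (Ex.eval_c h1) ?_)) (Ex.eval_sub hwe (Ex.eval_mod hq hwe) (Nat.mod_lt _ hw).le))) ?_
  -- The word after the one containing bit `x` is read as well, so its address must not wrap around.
  · have := Nat.div_le_self x w
    omega
  · rw [Ex.eval_shl (Ex.eval_c h1) hk, Nat.one_shiftLeft, Nat.mod_eq_of_lt hy]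

end WordRAM

/-! ### Bit layout of the data and the rank and select directories -/

namespace WordRAM

/-- A data structure made of `20` interleaved arrays of words, `8` interleaved arrays of fields of
`f` bits and a bit vector. The numbers `g` and `u` are the sampling parameters of the rank and
select directories of the bit vector. -/
structure Layout where
  w : ℕ
  f : ℕ
  g : ℕ
  u : ℕ
  words : ℕ
  fields : ℕ
  N : ℕ
  val : ℕ → ℕ → ℕ
  fval : ℕ → ℕ → ℕ
  B : ℕ → Bool

namespace Layout

/-- The bit address of the first field. -/
def baseF (L : Layout) : ℕ := 20 * L.words * L.w

/-- The bit address of the bit vector. -/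
def baseB (L : Layout) : ℕ := L.baseF + 8 * L.fields * L.f

/-- The bit at an address. -/
def bit (L : Layout) (x : ℕ) : Bool :=
  if x < L.baseF then (L.val (x / L.w % 20) (x / L.w / 20)).testBit (x % L.w)
  else if x < L.baseB then
    (L.fval ((x - L.baseF) / L.f % 8) ((x - L.baseF) / L.f / 8)).testBit ((x - L.baseF) % L.f)
  else L.B (x - L.baseB)

/-- The bit string of a layout. -/
def encode (L : Layout) : List Bool := (List.range (L.baseB + L.N)).map L.bit

theorem length_encode (L : Layout) : L.encode.length = L.baseB + L.N := by simp [encode]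

theorem getD_encode (L : Layout) {x : ℕ} (hx : x < L.baseB + L.N) :
    L.encode.getD x false = L.bit x := by
  simp [encode, List.getD_eq_getElem?_getD, List.getElem?_range hx]

theorem dataWord_encode (L : Layout) {a j : ℕ} (ha : a < 20) (hj : j < L.words) :
    dataWord L.w L.encode (j * 20 + a) = L.val a j % 2 ^ L.w := by
  apply Nat.eq_of_testBit_eq
  intro i
  rw [dataWord_eq_field, testBit_field, Nat.testBit_mod_two_pow]
  by_cases hi : i < L.w
  · have hlt : (j * 20 + a) * L.w + i < L.baseF := by
      unfold baseF
      have h1 : (j * 20 + a + 1) * L.w ≤ 20 * L.words * L.w := Nat.mul_le_mul_right _ (by omega)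
      rw [add_mul, one_mul] at h1
      omega
    have hw : 0 < L.w := by omega
    have hd : ((j * 20 + a) * L.w + i) / L.w = j * 20 + a := by
      rw [mul_comm, Nat.mul_add_div hw, Nat.div_eq_of_lt hi, add_zero]
    have hm : ((j * 20 + a) * L.w + i) % L.w = i := by
      rw [mul_comm, Nat.mul_add_mod, Nat.mod_eq_of_lt hi]
    have hB : L.baseF ≤ L.baseB := Nat.le_add_right _ _
    rw [getD_encode L (by omega), bit, if_pos hlt, hd, hm]
    rw [show (j * 20 + a) % 20 = a by omega, show (j * 20 + a) / 20 = j by omega]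
  · simp [hi]

theorem field_encode (L : Layout) {a j : ℕ} (ha : a < 8) (hj : j < L.fields) :
    field L.encode (L.baseF + (j * 8 + a) * L.f) L.f = L.fval a j % 2 ^ L.f := by
  apply Nat.eq_of_testBit_eq
  intro i
  rw [testBit_field, Nat.testBit_mod_two_pow]
  by_cases hi : i < L.f
  · have hlt : L.baseF + (j * 8 + a) * L.f + i < L.baseB := by
      unfold baseB
      have h1 : (j * 8 + a + 1) * L.f ≤ 8 * L.fields * L.f := Nat.mul_le_mul_right _ (by omega)
      rw [add_mul, one_mul] at h1
      omega
    have hf : 0 < L.f := by omega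
    have hs : L.baseF + (j * 8 + a) * L.f + i - L.baseF = (j * 8 + a) * L.f + i := by omega
    have hd : ((j * 8 + a) * L.f + i) / L.f = j * 8 + a := by
      rw [mul_comm, Nat.mul_add_div hf, Nat.div_eq_of_lt hi, add_zero]
    have hm : ((j * 8 + a) * L.f + i) % L.f = i := by
      rw [mul_comm, Nat.mul_add_mod, Nat.mod_eq_of_lt hi]
    rw [getD_encode L (by omega), bit, if_neg (by omega), if_pos hlt, hs, hd, hm]
    rw [show (j * 8 + a) % 8 = a by omega, show (j * 8 + a) / 8 = j by omega]
  · simp [hi]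

theorem testBit_field_encode (L : Layout) {y k j : ℕ} (hj : j < k) (hy : y + j < L.N) :
    (field L.encode (L.baseB + y) k).testBit j = L.B (y + j) := by
  have hB : L.baseF ≤ L.baseB := Nat.le_add_right _ _
  rw [testBit_field, getD_encode L (by omega), bit, if_neg (by omega), if_neg (by omega)]
  simp [hj, show L.baseB + y + j - L.baseB = y + j by omega]

/-- The number of bits that one table lookup handles. -/
def t (L : Layout) : ℕ := L.g * (L.g + 1)

/-- The positions that hold the bit `β`; all positions beyond the bit vector are included. -/
def P (L : Layout) (β : Bool) (i : ℕ) : Prop := L.N ≤ i ∨ L.B i = β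

instance (L : Layout) (β : Bool) : DecidablePred (L.P β) := fun _ => instDecidableOr

/-- The number of positions before `x` that hold the bit `β`. -/
def rank (L : Layout) (β : Bool) (x : ℕ) : ℕ := Nat.count (L.P β) x

/-- The position of the `k`-th bit `β`, counted from zero. -/
noncomputable def sel (L : Layout) (β : Bool) (k : ℕ) : ℕ := Nat.nth (L.P β) k

/-- The padding beyond the vector makes `sel` total and strictly monotone, so an incomplete last
group needs no special treatment. -/
theorem infinite_P (L : Layout) (β : Bool) : (Set.ofPred (L.P β)).Infinite :=
  (Set.Ici_infinite L.N).mono fun _ h => Or.inl h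

theorem sel_strictMono (L : Layout) (β : Bool) : StrictMono (L.sel β) :=
  Nat.nth_strictMono (L.infinite_P β)

theorem rank_sel (L : Layout) (β : Bool) (k : ℕ) : L.rank β (L.sel β k) = k :=
  Nat.count_nth_of_infinite (L.infinite_P β) k

theorem sel_rank (L : Layout) {β : Bool} {x : ℕ} (h : L.P β x) : L.sel β (L.rank β x) = x :=
  Nat.nth_count h

theorem P_sel (L : Layout) (β : Bool) (k : ℕ) : L.P β (L.sel β k) :=
  Nat.nth_mem_of_infinite (L.infinite_P β) k

theorem rank_le (L : Layout) (β : Bool) (x : ℕ) : L.rank β x ≤ x := Nat.count_le _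

theorem rank_mono (L : Layout) (β : Bool) : Monotone (L.rank β) := Nat.count_monotone _

/-- All padding positions count, so `k + 1` hits occur before `N + k + 1`. -/
theorem sel_le (L : Layout) (β : Bool) (k : ℕ) : L.sel β k ≤ L.N + k := by
  by_contra! h
  have h2 : L.rank β (L.N + (k + 1)) = L.rank β L.N + (k + 1) := by
    unfold rank
    rw [Nat.count_add]
    congr 1
    rw [Nat.count_iff_forall]
    exact fun i _ => Or.inl (Nat.le_add_right _ _)
  have h3 : L.rank β (L.N + k + 1) ≤ L.rank β (L.sel β k) := L.rank_mono β h
  rw [L.rank_sel] at h3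
  rw [← add_assoc] at h2
  omega

/-- The `k`-th bit `β` is in a group that spans at least `T` positions, in the division into groups
of `g`. -/
def Sparse (L : Layout) (β : Bool) (g T k : ℕ) : Prop :=
  T ≤ L.sel β ((k / g + 1) * g) - L.sel β (k / g * g)

/-- A sparse group spans at least `u * (g + 1)` positions, so after division by `u` its start is at
least `g + 1` below the start of any later group. The `g` slots that follow the start therefore
collide with no other sparse group. This lets explicit positions live in an array indexed by
position, about `N / u` entries long, without pointers to it. -/
theorem Sparse.injective (L : Layout) {β : Bool} {g u k k' : ℕ} (hg : 0 < g) (hu : 0 < u)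
    (hk : L.Sparse β g (u * (g + 1)) k) (hk' : L.Sparse β g (u * (g + 1)) k')
    (h : L.sel β (k / g * g) / u + k % g = L.sel β (k' / g * g) / u + k' % g) : k = k' := by
  have key : ∀ a b : ℕ, L.Sparse β g (u * (g + 1)) a → a / g < b / g →
      L.sel β (a / g * g) / u + a % g < L.sel β (b / g * g) / u + b % g := by
    intro a b ha hab
    have h1 : L.sel β ((a / g + 1) * g) ≤ L.sel β (b / g * g) :=
      (L.sel_strictMono β).monotone (Nat.mul_le_mul_right _ hab)
    have h2 : (L.sel β (a / g * g) + u * (g + 1)) / u ≤ L.sel β (b / g * g) / u := by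
      apply Nat.div_le_div_right
      have h3 : L.sel β (a / g * g) ≤ L.sel β ((a / g + 1) * g) :=
        (L.sel_strictMono β).monotone (Nat.mul_le_mul_right _ (Nat.le_succ _))
      unfold Sparse at ha
      omega
    rw [Nat.add_mul_div_left _ _ hu] at h2
    have := Nat.mod_lt a hg
    omega
  rcases lt_trichotomy (k / g) (k' / g) with h1 | h1 | h1
  · exact absurd h (key k k' hk h1).ne
  · rw [h1] at h
    rw [← Nat.div_add_mod k g, ← Nat.div_add_mod k' g, h1]
    omega
  · exact absurd h (key k' k hk' h1).ne'

open Classical in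
/-- The positions of the bits in sparse groups, in an array indexed by positions. -/
noncomputable def explicitPos (L : Layout) (β : Bool) (g u x : ℕ) : ℕ :=
  if h : ∃ k, L.Sparse β g (u * (g + 1)) k ∧ L.sel β (k / g * g) / u + k % g = x then
    L.sel β h.choose - L.sel β (h.choose / g * g) else 0

theorem explicitPos_eq (L : Layout) {β : Bool} {g u k : ℕ} (hg : 0 < g) (hu : 0 < u)
    (hk : L.Sparse β g (u * (g + 1)) k) :
    L.explicitPos β g u (L.sel β (k / g * g) / u + k % g) =
      L.sel β k - L.sel β (k / g * g) := by
  have h : ∃ k', L.Sparse β g (u * (g + 1)) k' ∧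
    L.sel β (k' / g * g) / u + k' % g = L.sel β (k / g * g) / u + k % g := ⟨k, hk, rfl⟩
  rw [explicitPos, dif_pos h]
  rw [Sparse.injective L hg hu h.choose_spec.1 hk h.choose_spec.2]

/-- The arrays contain the rank and select directories, and all numbers fit into words. -/
structure Good (L : Layout) : Prop where
  hg : 0 < L.g
  hu : 0 < L.u
  hw : 200 ≤ L.w
  hfw : L.f < L.w
  htw : L.t < L.w
  hf₁ : L.u * (L.g * L.u + 1) ≤ 2 ^ L.f
  hf₂ : L.t * L.u ≤ 2 ^ L.f
  hwords : 32 ≤ L.words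
  hwords₁ : L.N / L.u + L.g * L.u + 1 < L.words
  hwords₂ : 2 ^ L.t * L.t ≤ L.words
  hfields : L.N / L.g + L.g + 1 < L.fields
  hsize : L.baseB + 2 * L.N + 20 * L.words + 8 * L.fields + L.g * L.u + 20 < 2 ^ L.w
  h₀ : L.val 0 0 = L.w
  h₁ : L.val 0 1 = L.f
  h₂ : L.val 0 2 = L.baseF
  h₃ : L.val 0 3 = L.baseB
  h₄ : L.val 0 4 = L.t
  h₅ : L.val 0 5 = L.t * L.u
  h₆ : L.val 0 6 = L.g * L.u
  h₇ : L.val 0 7 = L.g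
  h₈ : L.val 0 8 = L.u
  h₉ : L.val 0 9 = L.u * (L.g * L.u + 1)
  rank₁ : ∀ j, L.val 10 j = L.rank true (j * (L.t * L.u))
  rank₂ : ∀ j, L.fval 0 j = L.rank true (j * L.t) - L.rank true (j / L.u * (L.t * L.u))
  sel₁ : ∀ β j, L.val (11 + β.toNat) j = L.sel β (j * (L.g * L.u))
  exp₁ : ∀ β j, L.val (13 + β.toNat) j = L.explicitPos β (L.g * L.u) L.u j
  sel₂ : ∀ β j, L.fval (1 + β.toNat) j = L.sel β (j * L.g) - L.sel β (j / L.u * (L.g * L.u))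
  exp₂ : ∀ β j, L.fval (3 + β.toNat) j = L.explicitPos β L.g L.g j
  table : ∀ x, L.val 15 x = Nat.count (fun i => x.testBit i = true) L.t
  seltable : ∀ β x, L.val (16 + β.toNat) x =
    Nat.nth (fun i => (x / L.t).testBit i = β) (x % L.t)

end Layout

/-! ### Rank in constant time -/

/-- The `h`-th parameter. -/
def Ex.hd (h : ℕ) : Ex := .rd (.c (h * 20))

/-- Entry `j` of the `a`-th array of words. -/
def Ex.wd (a : ℕ) (j : Ex) : Ex := .rd (.op .add (.op .mul j (.c 20)) (.c a))

/-- Entry `j` of the `a`-th array of fields. -/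
def Ex.fd (a : ℕ) (j : Ex) : Ex :=
  .bits (.hd 0) (.op .add (.hd 2) (.op .mul (.op .add (.op .mul j (.c 8)) (.c a)) (.hd 1))) (.hd 1)

/-- The `k` bits from position `q` of the bit vector. -/
def Ex.bb (q k : Ex) : Ex := .bits (.hd 0) (.op .add (.hd 3) q) k

/-- The number of ones before position `x` of the bit vector. -/
def Ex.rank (x : Ex) : Ex :=
  .op .add (.op .add (.wd 10 (.op .div x (.hd 5))) (.fd 0 (.op .div x (.hd 4))))
    (.wd 15 (.bb (.op .sub x (.op .mod x (.hd 4))) (.op .mod x (.hd 4))))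

theorem count_eq_of_forall_not {p : ℕ → Prop} [DecidablePred p] {m n : ℕ} (h : m ≤ n)
    (hp : ∀ b, m ≤ b → ¬ p b) : Nat.count p n = Nat.count p m := by
  obtain ⟨d, rfl⟩ := Nat.exists_eq_add_of_le h
  rw [Nat.count_add, Nat.count_iff_forall_not.2 fun b _ => hp _ (Nat.le_add_right _ _), add_zero]

namespace Layout.Good

variable {L : Layout} {env : Fin 8 → ℕ}

theorem lt_pow (h : L.Good) {k : ℕ} (hk : k < 400) : k < 2 ^ L.w := by
  have h1 : 2 ^ 200 ≤ 2 ^ L.w := Nat.pow_le_pow_right (by norm_num) h.hw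
  have h2 : 400 ≤ 2 ^ 200 := by norm_num
  omega

theorem eval_c (h : L.Good) {k : ℕ} (hk : k < 400) : (Ex.c k).eval L.w L.encode env = k :=
  Ex.eval_c (h.lt_pow hk)

theorem eval_hd (h : L.Good) {k x : ℕ} (hk : k < 20) (hx : L.val 0 k = x) (hxw : x < 2 ^ L.w) :
    (Ex.hd k).eval L.w L.encode env = x := by
  have := h.hwords
  rw [Ex.hd, Ex.eval_rd (h.eval_c (by omega))]
  have := L.dataWord_encode (a := 0) (j := k) (by norm_num) (by omega)
  rw [add_zero] at this
  rw [this, hx, Nat.mod_eq_of_lt hxw]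

theorem eval_wd (h : L.Good) {a j x : ℕ} {e : Ex} (he : e.eval L.w L.encode env = j) (ha : a < 20)
    (hj : j < L.words) (hx : L.val a j = x) (hxw : x < 2 ^ L.w) :
    (Ex.wd a e).eval L.w L.encode env = x := by
  have hs := h.hsize
  rw [Ex.wd, Ex.eval_rd (Ex.eval_add (Ex.eval_mul he (h.eval_c (by norm_num)) (by omega))
    (h.eval_c (by omega)) (by omega)), L.dataWord_encode ha hj, hx, Nat.mod_eq_of_lt hxw]

theorem eval_w (h : L.Good) : (Ex.hd 0).eval L.w L.encode env = L.w :=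
  h.eval_hd (by norm_num) h.h₀ Nat.lt_two_pow_self

theorem eval_f (h : L.Good) : (Ex.hd 1).eval L.w L.encode env = L.f :=
  h.eval_hd (by norm_num) h.h₁ (h.hfw.trans Nat.lt_two_pow_self)

theorem baseF_le (L : Layout) : L.baseF ≤ L.baseB := Nat.le_add_right _ _

theorem eval_baseF (h : L.Good) : (Ex.hd 2).eval L.w L.encode env = L.baseF :=
  h.eval_hd (by norm_num) h.h₂ (by have := h.hsize; have := baseF_le L; omega)

theorem eval_baseB (h : L.Good) : (Ex.hd 3).eval L.w L.encode env = L.baseB :=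
  h.eval_hd (by norm_num) h.h₃ (by have := h.hsize; omega)

theorem eval_t (h : L.Good) : (Ex.hd 4).eval L.w L.encode env = L.t :=
  h.eval_hd (by norm_num) h.h₄ (h.htw.trans Nat.lt_two_pow_self)

theorem eval_tu (h : L.Good) : (Ex.hd 5).eval L.w L.encode env = L.t * L.u :=
  h.eval_hd (by norm_num) h.h₅
    (h.hf₂.trans_lt (Nat.pow_lt_pow_right (by norm_num) h.hfw))

theorem eval_gu (h : L.Good) : (Ex.hd 6).eval L.w L.encode env = L.g * L.u :=
  h.eval_hd (by norm_num) h.h₆ (by have := h.hsize; omega)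

theorem g_le (h : L.Good) : L.g ≤ L.g * L.u := Nat.le_mul_of_pos_right _ h.hu

theorem u_le (h : L.Good) : L.u ≤ L.g * L.u := Nat.le_mul_of_pos_left _ h.hg

theorem g_le_t (_ : L.Good) : L.g ≤ L.t := Nat.le_mul_of_pos_right _ (Nat.succ_pos _)

theorem t_pos (h : L.Good) : 0 < L.t := h.hg.trans_le h.g_le_t

theorem eval_g (h : L.Good) : (Ex.hd 7).eval L.w L.encode env = L.g :=
  h.eval_hd (by norm_num) h.h₇ (by have := h.hsize; have := h.g_le; omega)

theorem eval_u (h : L.Good) : (Ex.hd 8).eval L.w L.encode env = L.u :=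
  h.eval_hd (by norm_num) h.h₈ (by have := h.hsize; have := h.u_le; omega)

theorem eval_thr (h : L.Good) :
    (Ex.hd 9).eval L.w L.encode env = L.u * (L.g * L.u + 1) :=
  h.eval_hd (by norm_num) h.h₉
    (h.hf₁.trans_lt (Nat.pow_lt_pow_right (by norm_num) h.hfw))

theorem eval_fd (h : L.Good) {a j x : ℕ} {e : Ex} (he : e.eval L.w L.encode env = j) (ha : a < 8)
    (hj : j < L.fields) (hx : L.fval a j = x) (hxf : x < 2 ^ L.f) :
    (Ex.fd a e).eval L.w L.encode env = x := by
  have hs := h.hsize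
  have h1 : (j * 8 + a + 1) * L.f ≤ 8 * L.fields * L.f := Nat.mul_le_mul_right _ (by omega)
  rw [add_mul, one_mul] at h1
  have h2 : L.baseB = L.baseF + 8 * L.fields * L.f := rfl
  rw [Ex.fd, Ex.eval_bits h.eval_w (Ex.eval_add h.eval_baseF (Ex.eval_mul (Ex.eval_add
    (Ex.eval_mul he (h.eval_c (by norm_num)) (by omega)) (h.eval_c (by omega)) (by omega)) h.eval_f
    (by omega)) (by omega)) h.eval_f h.hfw (by omega), L.field_encode ha hj, hx,
    Nat.mod_eq_of_lt hxf]

theorem eval_bb (h : L.Good) {q k : Ex} {x y : ℕ} (hq : q.eval L.w L.encode env = x)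
    (hk : k.eval L.w L.encode env = y) (hx : x ≤ L.N) (hy : y < L.w) :
    (Ex.bb q k).eval L.w L.encode env = field L.encode (L.baseB + x) y := by
  have hs := h.hsize
  exact Ex.eval_bits h.eval_w (Ex.eval_add h.eval_baseB hq (by omega)) hk hy (by omega)

/-- Three levels: an absolute count per superblock of `t * u` bits, a count relative to the
superblock per block of `t` bits, and a table lookup for the remaining `x % t` bits. -/
theorem eval_rank (h : L.Good) {e : Ex} {x : ℕ} (he : e.eval L.w L.encode env = x)
    (hx : x ≤ L.N) : (Ex.rank e).eval L.w L.encode env = L.rank true x := by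
  have hs := h.hsize
  have ht := h.t_pos
  have htu : 0 < L.t * L.u := Nat.mul_pos ht h.hu
  have hdu : x / (L.t * L.u) = x / L.t / L.u := (Nat.div_div_eq_div_mul _ _ _).symm
  set j := x / (L.t * L.u) with hj
  have hjx : j * (L.t * L.u) ≤ x := Nat.div_mul_le_self _ _
  have hr₁ : L.rank true (j * (L.t * L.u)) ≤ x := (L.rank_le _ _).trans hjx
  have hi := Nat.div_add_mod x L.t
  set i := x / L.t with hi'
  have hm := Nat.mod_lt x ht
  have hji : j * (L.t * L.u) ≤ i * L.t := by
    rw [hdu]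
    calc i / L.u * (L.t * L.u) = i / L.u * L.u * L.t := by ring
      _ ≤ i * L.t := Nat.mul_le_mul_right _ (Nat.div_mul_le_self _ _)
  have hri : L.rank true (j * (L.t * L.u)) ≤ L.rank true (i * L.t) := L.rank_mono _ hji
  have hix : i * L.t ≤ x := by rw [mul_comm]; omega
  -- The relative count is at most the distance inside one superblock, which is what the field width
  -- is made for.
  have hr₂ : L.rank true (i * L.t) - L.rank true (j * (L.t * L.u)) < 2 ^ L.f := by
    have h1 : L.rank true (i * L.t) ≤ L.rank true (j * (L.t * L.u)) + (i * L.t - j * (L.t * L.u)) := by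
      conv_lhs => rw [← Nat.add_sub_cancel' hji]
      unfold Layout.rank
      rw [Nat.count_add]
      exact Nat.add_le_add_left (Nat.count_le _) _
    have h2 : x < (j + 1) * (L.t * L.u) := by
      rw [mul_comm]; exact Nat.lt_mul_div_succ x htu
    rw [add_mul, one_mul] at h2
    have := h.hf₂
    omega
  have hword : L.N / L.u < L.words := by have := h.hwords₁; omega
  have hjw : j < L.words := by
    refine lt_of_le_of_lt ?_ hword
    calc x / (L.t * L.u) ≤ x / L.u := Nat.div_le_div_left (Nat.le_mul_of_pos_left _ ht) h.hu
      _ ≤ L.N / L.u := Nat.div_le_div_right hx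
  have hif : i < L.fields := by
    have : x / L.t ≤ L.N / L.g := (Nat.div_le_div_left h.g_le_t h.hg).trans (Nat.div_le_div_right hx)
    have := h.hfields
    omega
  have hxi : x - x % L.t = i * L.t := by rw [mul_comm]; omega
  have hX : field L.encode (L.baseB + i * L.t) (x % L.t) < L.words := by
    refine (field_lt _ _ _).trans_le ((Nat.pow_le_pow_right (by norm_num) hm.le).trans ?_)
    exact (Nat.le_mul_of_pos_right _ ht).trans h.hwords₂
  have hcount : Nat.count (fun b => (field L.encode (L.baseB + i * L.t) (x % L.t)).testBit b = true)
      L.t = Nat.count (fun b => L.P true (i * L.t + b)) (x % L.t) := by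
    -- The table counts over all `t` bits of a window; the bits above the `x % t` that were read are
    -- zero.
    rw [count_eq_of_forall_not hm.le (fun b hb => by rw [testBit_field]; simp [not_lt.2 hb])]
    rw [Nat.count_eq_card_filter_range, Nat.count_eq_card_filter_range]
    congr 1
    apply Finset.filter_congr
    intro b hb
    rw [Finset.mem_range] at hb
    rw [L.testBit_field_encode hb (by omega)]
    simp only [Layout.P]
    constructor
    · exact Or.inr
    · rintro (h' | h')
      · omega
      · exact h'
  have hsum : L.rank true x = L.rank true (i * L.t) +
      Nat.count (fun b => L.P true (i * L.t + b)) (x % L.t) := by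
    conv_lhs => rw [show x = i * L.t + x % L.t by omega]
    unfold Layout.rank
    rw [Nat.count_add]
  have hle := L.rank_le true x
  have hc : Nat.count (fun b => L.P true (i * L.t + b)) (x % L.t) ≤ x := by omega
  rw [hsum, ← Nat.add_sub_cancel' hri]
  refine Ex.eval_add (Ex.eval_add (h.eval_wd (Ex.eval_div he h.eval_tu) (by norm_num) hjw
    (h.rank₁ _) (by omega)) (h.eval_fd (Ex.eval_div he h.eval_t) (by norm_num) hif
    (by rw [h.rank₂, ← hi', ← hdu]) hr₂) (by omega)) ?_ (by omega)
  refine h.eval_wd (h.eval_bb (x := i * L.t) ?_ (Ex.eval_mod he h.eval_t) (by omega)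
    (hm.trans h.htw)) (by norm_num) hX ?_ (by omega)
  · rw [← hxi]
    exact Ex.eval_sub he (Ex.eval_mod he h.eval_t) (Nat.mod_le _ _)
  · rw [h.table, hcount]

end Layout.Good

end WordRAM

/-! ### Select in constant time -/

namespace WordRAM

/-- The position of the first bit `β` in subgroup `j`. -/
def Ex.subgroup (β : Bool) (j : Ex) : Ex :=
  .op .add (.wd (11 + β.toNat) (.op .div j (.hd 8))) (.fd (1 + β.toNat) j)

/-- The position of the `k`-th bit `β` of the bit vector. -/
def Ex.sel (β : Bool) (k : Ex) : Ex :=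
  .ite (.op .lt (.op .sub (.wd (11 + β.toNat) (.op .add (.op .div k (.hd 6)) (.c 1)))
      (.wd (11 + β.toNat) (.op .div k (.hd 6)))) (.hd 9))
    (.ite (.op .lt (.op .sub (.subgroup β (.op .add (.op .div k (.hd 7)) (.c 1)))
        (.subgroup β (.op .div k (.hd 7)))) (.hd 4))
      (.op .add (.subgroup β (.op .div k (.hd 7)))
        (.wd (16 + β.toNat) (.op .add
          (.op .mul (.bb (.subgroup β (.op .div k (.hd 7))) (.hd 4)) (.hd 4))
          (.op .mod k (.hd 7)))))
      (.op .add (.subgroup β (.op .div k (.hd 7)))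
        (.fd (3 + β.toNat) (.op .add
          (.op .div (.subgroup β (.op .div k (.hd 7))) (.hd 7)) (.op .mod k (.hd 7))))))
    (.op .add (.wd (11 + β.toNat) (.op .div k (.hd 6)))
      (.wd (13 + β.toNat) (.op .add
        (.op .div (.wd (11 + β.toNat) (.op .div k (.hd 6))) (.hd 8)) (.op .mod k (.hd 6)))))

namespace Layout.Good

variable {L : Layout} {env : Fin 8 → ℕ}

theorem toNat_le (β : Bool) : β.toNat ≤ 1 := by cases β <;> simp

theorem eval_subgroup (h : L.Good) {β : Bool} {e : Ex} {j : ℕ}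
    (he : e.eval L.w L.encode env = j) (hj : j ≤ L.N / L.g + 1)
    (hpos : L.sel β (j * L.g) ≤ 2 * L.N + L.g * L.u)
    (hgap : L.sel β (j * L.g) - L.sel β (j / L.u * (L.g * L.u)) < 2 ^ L.f)
    (hju : j / L.u < L.words) :
    (Ex.subgroup β e).eval L.w L.encode env = L.sel β (j * L.g) := by
  have hb := toNat_le β
  have hs := h.hsize
  have hg := h.hg
  have hle : L.sel β (j / L.u * (L.g * L.u)) ≤ L.sel β (j * L.g) := by
    apply (L.sel_strictMono β).monotone
    calc j / L.u * (L.g * L.u) = j / L.u * L.u * L.g := by ring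
      _ ≤ j * L.g := Nat.mul_le_mul_right _ (Nat.div_mul_le_self _ _)
  rw [← Nat.add_sub_cancel' hle]
  exact Ex.eval_add (h.eval_wd (Ex.eval_div he h.eval_u) (by omega) hju (h.sel₁ _ _) (by omega))
    (h.eval_fd he (by omega) (by have := h.hfields; omega) (h.sel₂ _ _) hgap) (by omega)

/-- The same dichotomy is used twice. A group of `g * u` bits `β` that spans many positions has them
stored explicitly in words; in a shorter group every offset fits into a field. It is divided into
subgroups of `g`, with explicit offsets in fields if the span reaches `t = g * (g + 1)`. Otherwise
the bit sought lies in a window of `t` bits, which the table resolves. -/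
theorem eval_sel (h : L.Good) {β : Bool} {e : Ex} {k : ℕ}
    (he : e.eval L.w L.encode env = k) (hk : L.sel β k < L.N) :
    (Ex.sel β e).eval L.w L.encode env = L.sel β k := by
  have hb := toNat_le β
  have hs := h.hsize
  have hg := h.hg
  have hu := h.hu
  have hw := h.hw
  have hmono := (L.sel_strictMono β).monotone
  have hgu : 0 < L.g * L.u := Nat.mul_pos hg hu
  have hkN : k < L.N := ((L.sel_strictMono β).le_apply).trans_lt hk
  have hwords := h.hwords₁
  have hfields := h.hfields
  have h1 := h.eval_c (env := env) (k := 1) (by norm_num)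
  have hguu : L.N / (L.g * L.u) ≤ L.N / L.u := Nat.div_le_div_left h.u_le hu
  have hq : k / (L.g * L.u) ≤ L.N / (L.g * L.u) := Nat.div_le_div_right hkN.le
  have hqle : k / (L.g * L.u) * (L.g * L.u) ≤ k := Nat.div_mul_le_self _ _
  have hdm := Nat.div_add_mod k (L.g * L.u)
  have hmod := Nat.mod_lt k hgu
  set q := k / (L.g * L.u) with hqdef
  have hA : L.sel β (q * (L.g * L.u)) ≤ L.sel β k := hmono hqle
  have hA' : L.sel β ((q + 1) * (L.g * L.u)) ≤ 2 * L.N + L.g * L.u := by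
    refine (L.sel_le _ _).trans ?_
    rw [add_mul]
    omega
  have hAA : L.sel β (q * (L.g * L.u)) ≤ L.sel β ((q + 1) * (L.g * L.u)) :=
    hmono (Nat.mul_le_mul_right _ (Nat.le_succ _))
  have eA : ∀ env, e.eval L.w L.encode env = k → (Ex.wd (11 + β.toNat)
      (.op .div e (.hd 6))).eval L.w L.encode env = L.sel β (q * (L.g * L.u)) := fun env he =>
    h.eval_wd (Ex.eval_div he h.eval_gu) (by omega) (by omega) (h.sel₁ _ _) (by omega)
  have eA' : (Ex.wd (11 + β.toNat) (.op .add (.op .div e (.hd 6)) (.c 1))).eval L.w L.encode env =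
      L.sel β ((q + 1) * (L.g * L.u)) :=
    h.eval_wd (Ex.eval_add (Ex.eval_div he h.eval_gu) h1 (by omega)) (by omega) (by omega)
      (h.sel₁ _ _) (by omega)
  refine Ex.eval_ite (Ex.eval_lt_op (by omega) (Ex.eval_sub eA' (eA env he) hAA) h.eval_thr) ?_ ?_
  · intro hdense
    -- positions inside a dense group
    have hj : k / L.g ≤ L.N / L.g := Nat.div_le_div_right hkN.le
    have hju : k / L.g / L.u = q := Nat.div_div_eq_div_mul _ _ _
    have hjm := Nat.div_add_mod k L.g
    have hmg := Nat.mod_lt k hg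
    set j := k / L.g with hjdef
    have hjk : j * L.g ≤ k := by rw [mul_comm]; omega
    have hkj : k < (j + 1) * L.g := by rw [add_mul, one_mul, mul_comm]; omega
    have hqj : q * (L.g * L.u) ≤ j * L.g := by
      calc q * (L.g * L.u) = q * L.u * L.g := by ring
        _ ≤ j * L.g := Nat.mul_le_mul_right _ (by rw [← hju]; exact Nat.div_mul_le_self _ _)
    have hjq : (j + 1) * L.g ≤ (q + 1) * (L.g * L.u) := by
      calc (j + 1) * L.g ≤ ((q + 1) * L.u) * L.g := Nat.mul_le_mul_right _ (by
            rw [← hju, mul_comm]; exact Nat.lt_mul_div_succ j hu)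
        _ = (q + 1) * (L.g * L.u) := by ring
    have hf := h.hf₁
    have s1 := hmono hqj
    have s2 := hmono hjk
    have s3 := L.sel_strictMono β hkj
    have s4 := hmono hjq
    have eB : (Ex.subgroup β (.op .div e (.hd 7))).eval L.w L.encode env = L.sel β (j * L.g) := by
      refine h.eval_subgroup (Ex.eval_div he h.eval_g) (by omega) (by omega) ?_ (by omega)
      rw [hju]
      omega
    have eB' : (Ex.subgroup β (.op .add (.op .div e (.hd 7)) (.c 1))).eval L.w L.encode env =
        L.sel β ((j + 1) * L.g) := by
      have hjk' := Nat.div_le_self k L.g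
      refine h.eval_subgroup (Ex.eval_add (Ex.eval_div he h.eval_g) h1 (by omega)) (by omega)
        (by omega) ?_ ?_
      -- The next subgroup may already open the next group. Its offset is then measured from that
      -- group and vanishes, so it fits as well.
      · rcases Nat.lt_or_ge ((j + 1) / L.u) (q + 1) with hlt | hge
        · have : (j + 1) / L.u = q :=
            le_antisymm (by omega) (by rw [← hju]; exact Nat.div_le_div_right (Nat.le_succ _))
          rw [this]
          omega
        · have h3 : (j + 1) * L.g ≤ (j + 1) / L.u * (L.g * L.u) :=
            hjq.trans (Nat.mul_le_mul_right _ hge)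
          have := hmono h3
          have h4 : 0 < 2 ^ L.f := by positivity
          omega
      · have : (j + 1) / L.u ≤ q + 1 := by
          rw [← hju]
          calc (j + 1) / L.u ≤ (j + L.u) / L.u := Nat.div_le_div_right (by omega)
            _ = j / L.u + 1 := Nat.add_div_right _ hu
        omega
    have ht := h.t_pos
    have hgt := h.g_le_t
    refine Ex.eval_ite (Ex.eval_lt_op (by omega) (Ex.eval_sub eB' eB (s2.trans s3.le)) h.eval_t)
      ?_ ?_
    · intro hdense₂
      set X := field L.encode (L.baseB + L.sel β (j * L.g)) L.t with hX
      have hXlt : X < 2 ^ L.t := field_lt _ _ _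
      have hz : X * L.t + k % L.g < L.words := by
        refine lt_of_lt_of_le ?_ h.hwords₂
        have : (X + 1) * L.t ≤ 2 ^ L.t * L.t := Nat.mul_le_mul_right _ hXlt
        rw [add_mul, one_mul] at this
        omega
      have hzt : (X * L.t + k % L.g) / L.t = X := by
        rw [mul_comm, Nat.mul_add_div ht, Nat.div_eq_of_lt (by omega), add_zero]
      have hzm : (X * L.t + k % L.g) % L.t = k % L.g := by
        rw [mul_comm, Nat.mul_add_mod, Nat.mod_eq_of_lt (by omega)]
      set y := L.sel β k - L.sel β (j * L.g) with hy
      have hyt : y < L.t := by omega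
      -- Up to `y` the window stays inside the bit vector, since `sel β k < N`; the padding in `P`
      -- does not interfere.
      have hbit : ∀ b ≤ y, (X.testBit b = β ↔ L.P β (L.sel β (j * L.g) + b)) := by
        intro b hb
        rw [hX, L.testBit_field_encode (by omega) (by omega)]
        simp only [Layout.P]
        constructor
        · exact Or.inr
        · rintro (h' | h')
          · omega
          · exact h'
      have hcount : Nat.count (fun b => X.testBit b = β) y = k % L.g := by
        have e1 : Nat.count (fun b => X.testBit b = β) y =
            Nat.count (fun b => L.P β (L.sel β (j * L.g) + b)) y := by
          rw [Nat.count_eq_card_filter_range, Nat.count_eq_card_filter_range]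
          congr 1
          apply Finset.filter_congr
          intro b hb
          exact hbit b (Finset.mem_range.1 hb).le
        have e2 := Nat.count_add (L.P β) (L.sel β (j * L.g)) y
        rw [show L.sel β (j * L.g) + y = L.sel β k by omega] at e2
        have e3 := L.rank_sel β k
        have e4 := L.rank_sel β (j * L.g)
        unfold Layout.rank at e3 e4
        rw [e3, e4] at e2
        rw [e1]
        have : j * L.g = L.g * j := mul_comm _ _
        omega
      have hnth : Nat.nth (fun b => X.testBit b = β) (k % L.g) = y := by
        rw [← hcount]
        apply Nat.nth_count
        rw [hbit y le_rfl, show L.sel β (j * L.g) + y = L.sel β k by omega]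
        exact L.P_sel β k
      rw [show L.sel β k = L.sel β (j * L.g) + y by omega]
      have eX : (Ex.bb (.subgroup β (.op .div e (.hd 7))) (.hd 4)).eval L.w L.encode env = X :=
        h.eval_bb eB h.eval_t (by omega) h.htw
      refine Ex.eval_add eB (h.eval_wd (Ex.eval_add (Ex.eval_mul eX h.eval_t (by omega)) (Ex.eval_mod he h.eval_g) (by omega)) (by omega) hz ?_
        (by omega)) (by omega)
      rw [h.seltable, hzt, hzm, hnth]
    · intro hsparse
      have hsp : L.Sparse β L.g (L.g * (L.g + 1)) k := by
        unfold Layout.Sparse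
        rw [← hjdef]
        exact not_lt.1 hsparse
      have hE := L.explicitPos_eq hg hg hsp
      rw [← hjdef] at hE
      rw [show L.sel β k = L.sel β (j * L.g) + (L.sel β k - L.sel β (j * L.g)) by omega]
      have hdiv : L.sel β (j * L.g) / L.g ≤ L.N / L.g := Nat.div_le_div_right (by omega)
      refine Ex.eval_add eB (h.eval_fd (Ex.eval_add (Ex.eval_div eB h.eval_g)
        (Ex.eval_mod he h.eval_g) (by omega)) (by omega) (by omega) ?_ (by omega)) (by omega)
      rw [h.exp₂, hE]
  · intro hsparse
    have hsp : L.Sparse β (L.g * L.u) (L.u * (L.g * L.u + 1)) k := not_lt.1 hsparse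
    have hE := L.explicitPos_eq hgu hu hsp
    rw [← hqdef] at hE
    rw [show L.sel β k = L.sel β (q * (L.g * L.u)) + (L.sel β k - L.sel β (q * (L.g * L.u))) by
      omega]
    have hdiv : L.sel β (q * (L.g * L.u)) / L.u ≤ L.N / L.u := Nat.div_le_div_right (by omega)
    refine Ex.eval_add (eA env he) (h.eval_wd (Ex.eval_add (Ex.eval_div (eA env he) h.eval_u)
      (Ex.eval_mod he h.eval_gu) (by omega)) (by omega) (by omega) ?_ (by omega)) (by omega)
    rw [h.exp₁, hE]

end Layout.Good

end WordRAM

/-! ### Binary trees with prescribed depths: Kraft's inequality -/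

/-- Binary trees whose leaves carry numbers. -/
inductive MergeTree where
  | leaf (j : ℕ)
  | node (l r : MergeTree)

namespace MergeTree

/-- The labels of the leaves. -/
def leaves : MergeTree → Multiset ℕ
  | leaf j => {j}
  | node l r => l.leaves + r.leaves

/-- The number of inner nodes. -/
def size : MergeTree → ℕ
  | leaf _ => 0
  | node l r => l.size + r.size + 1

/-- The depth of the leaf with label `j`. -/
def depth : MergeTree → ℕ → ℕ
  | leaf _, _ => 0
  | node l r, j => (if j ∈ r.leaves then r.depth j else l.depth j) + 1

theorem card_leaves (T : MergeTree) : T.leaves.card = T.size + 1 := by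
  induction T with
  | leaf j => simp [leaves, size]
  | node l r hl hr => simp only [leaves, size, Multiset.card_add, hl, hr]; omega

/-- A forest is merged from the bottom up, each tree being tagged with the depth allowed for its
root. A tree of maximal tag is either joined with another one of the same tag or, if there is none,
moved up one level. Both moves keep the Kraft sum at most 1 and decrease the sum of the tags plus
one. -/
theorem exists_of_forest : ∀ (m : ℕ) (F : Multiset (MergeTree × ℕ)),
    (F.map fun x => x.2 + 1).sum = m → F ≠ 0 → (F.bind fun x => x.1.leaves).Nodup →
    (F.map fun x => (1 / 2 : ℚ) ^ x.2).sum ≤ 1 →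
    ∃ U : MergeTree, U.leaves = F.bind (fun x => x.1.leaves) ∧
      ∀ x ∈ F, ∀ j ∈ x.1.leaves, U.depth j ≤ x.2 + x.1.depth j := by
  classical
  intro m
  induction m using Nat.strong_induction_on with
  | _ m ih =>
  intro F hm hF hnd hsum
  obtain ⟨x, hx, hmax⟩ := F.toFinset.exists_max_image (fun x => x.2)
    (by rwa [Multiset.toFinset_nonempty])
  rw [Multiset.mem_toFinset] at hx
  obtain ⟨F₁, rfl⟩ := Multiset.exists_cons_of_mem hx
  have hmax' : ∀ y ∈ F₁, y.2 ≤ x.2 := fun y hy => hmax y (by simp [hy])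
  obtain ⟨T, e⟩ := x
  simp only at hmax'
  rcases Multiset.empty_or_exists_mem F₁ with rfl | ⟨y, hy⟩
  · exact ⟨T, by simp, by simp⟩
  have hpos : ∀ G : Multiset (MergeTree × ℕ), 0 ≤ (G.map fun x => (1 / 2 : ℚ) ^ x.2).sum := by
    intro G
    apply Multiset.sum_nonneg
    intro q hq
    obtain ⟨z, _, rfl⟩ := Multiset.mem_map.1 hq
    positivity
  -- A tree at depth 0 already has weight 1, and there is a second tree.
  have he : e ≠ 0 := by
    rintro rfl
    obtain ⟨F₂, rfl⟩ := Multiset.exists_cons_of_mem hy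
    simp only [Multiset.map_cons, Multiset.sum_cons, pow_zero] at hsum
    have := hpos F₂
    have : (0 : ℚ) < (1 / 2 : ℚ) ^ y.2 := by positivity
    linarith
  obtain ⟨e, rfl⟩ := Nat.exists_eq_succ_of_ne_zero he
  by_cases hex : ∃ y ∈ F₁, y.2 = e + 1
  · obtain ⟨⟨T', e'⟩, hy', rfl⟩ := hex
    obtain ⟨F₂, rfl⟩ := Multiset.exists_cons_of_mem hy'
    simp only [Multiset.map_cons, Multiset.sum_cons, Multiset.cons_bind] at hm hsum hnd
    obtain ⟨U, hU, hd⟩ := ih (e + 1 + (F₂.map fun x => x.2 + 1).sum) (by omega)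
      ((node T T', e) ::ₘ F₂) (by simp) (by simp)
      (by simpa [Multiset.cons_bind, leaves, add_assoc] using hnd)
      (by
        simp only [Multiset.map_cons, Multiset.sum_cons]
        rw [pow_succ] at hsum
        linarith)
    refine ⟨U, by rw [hU]; simp [Multiset.cons_bind, leaves, add_assoc], ?_⟩
    have hnode := hd (node T T', e) (by simp)
    intro z hz j hj
    rw [Multiset.mem_cons, Multiset.mem_cons] at hz
    rcases hz with rfl | rfl | hz
    · have := hnode j (by simp only [leaves, Multiset.mem_add]; exact Or.inl hj)
      have hj' : j ∉ T'.leaves := by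
        have := (Multiset.nodup_add.1 hnd).2.2
        intro h
        exact (Multiset.disjoint_left.1 this) hj (Multiset.mem_add.2 (Or.inl h))
      simp only [depth, hj', if_false] at this
      simp only
      omega
    · have := hnode j (by simp only [leaves, Multiset.mem_add]; exact Or.inr hj)
      simp only at hj
      simp only [depth, hj, if_true] at this
      simp only
      omega
    · exact hd z (by simp [hz]) j hj
  -- All other tags are at most `e`, so the other weights sum to an integral multiple `A` of 2^(-e).
  -- From A + 1/2 ≤ 2^e follows A + 1 ≤ 2^e, which leaves room for `T` at depth `e`.
  · push Not at hex
    have hlt : ∀ y ∈ F₁, y.2 ≤ e := fun y hy => by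
      have := hmax' y hy
      have := hex y hy
      omega
    simp only [Multiset.map_cons, Multiset.sum_cons, Multiset.cons_bind] at hm hsum hnd
    have hF₁ : (F₁.map fun x => (1 / 2 : ℚ) ^ x.2).sum =
        ((F₁.map fun x => 2 ^ (e - x.2)).sum : ℕ) * (1 / 2 : ℚ) ^ e := by
      rw [Nat.cast_multiset_sum, Multiset.map_map, ← Multiset.sum_map_mul_right]
      congr 1
      apply Multiset.map_congr rfl
      intro y hy
      have := hlt y hy
      simp only [Function.comp, Nat.cast_pow, Nat.cast_ofNat]
      obtain ⟨d, rfl⟩ := Nat.exists_eq_add_of_le this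
      rw [Nat.add_sub_cancel_left, pow_add, mul_left_comm, ← mul_pow]
      norm_num
    set A := (F₁.map fun x => 2 ^ (e - x.2)).sum
    have hA : A + 1 ≤ 2 ^ e := by
      rw [hF₁, pow_succ] at hsum
      have h2 : (1 / 2 : ℚ) ^ e * 2 ^ e = 1 := by rw [← mul_pow]; norm_num
      have h3 : (0 : ℚ) < 2 ^ e := by positivity
      have h4 : ((A : ℚ) + 1 / 2) ≤ 2 ^ e := by
        have := mul_le_mul_of_nonneg_right hsum h3.le
        calc (A : ℚ) + 1 / 2 = (A + 1 / 2) * ((1 / 2 : ℚ) ^ e * 2 ^ e) := by rw [h2, mul_one]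
          _ = ((1 / 2 : ℚ) ^ e * (1 / 2) + A * (1 / 2 : ℚ) ^ e) * 2 ^ e := by ring
          _ ≤ 2 ^ e := by linarith
      have h5 : (A : ℚ) < (2 ^ e : ℕ) := by push_cast; linarith
      exact_mod_cast h5
    obtain ⟨U, hU, hd⟩ := ih (e + 1 + (F₁.map fun x => x.2 + 1).sum) (by omega)
      ((T, e) ::ₘ F₁) (by simp) (by simp) (by simpa [Multiset.cons_bind] using hnd)
      (by
        simp only [Multiset.map_cons, Multiset.sum_cons]
        rw [hF₁]
        have h2 : (1 / 2 : ℚ) ^ e * 2 ^ e = 1 := by rw [← mul_pow]; norm_num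
        have h3 : (0 : ℚ) ≤ (1 / 2 : ℚ) ^ e := by positivity
        have h4 : ((A : ℚ) + 1) ≤ 2 ^ e := by exact_mod_cast hA
        have := mul_le_mul_of_nonneg_left h4 h3
        linarith)
    refine ⟨U, by rw [hU]; simp [Multiset.cons_bind], ?_⟩
    intro z hz j hj
    rw [Multiset.mem_cons] at hz
    rcases hz with rfl | hz
    · have := hd (T, e) (by simp) j hj
      simp only at this ⊢
      omega
    · exact hd z (by simp [hz]) j hj

/-- Kraft's inequality yields a binary tree. -/
theorem exists_depth_le {k : ℕ} (hk : 0 < k) (ℓ : ℕ → ℕ)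
    (h : ∑ j ∈ Finset.range k, (1 / 2 : ℚ) ^ ℓ j ≤ 1) :
    ∃ T : MergeTree, T.leaves = Multiset.range k ∧ ∀ j < k, T.depth j ≤ ℓ j := by
  have hb : ((Multiset.range k).map fun j => (leaf j, ℓ j)).bind (fun x => x.1.leaves) =
      Multiset.range k := by
    rw [Multiset.bind_map]
    exact (Multiset.bind_singleton (Multiset.range k) fun a => a).trans (Multiset.map_id _)
  obtain ⟨T, hT, hd⟩ := exists_of_forest _ ((Multiset.range k).map fun j => (leaf j, ℓ j)) rfl
    (by
      intro h
      rw [Multiset.map_eq_zero] at h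
      have := congrArg Multiset.card h
      simp at this
      omega)
    (by rw [hb]; exact Multiset.nodup_range k)
    (by
      rw [Multiset.map_map]
      exact h)
  refine ⟨T, hT.trans hb, fun j hj => ?_⟩
  have := hd (leaf j, ℓ j) (Multiset.mem_map.2 ⟨j, Multiset.mem_range.2 hj, rfl⟩) j (by simp [leaves])
  simpa [depth] using this

end MergeTree

/-! ### The wavelet tree: bit vectors, node records and pointers -/

namespace MergeTree

/-- The bit vectors of all inner nodes, in preorder: the bit vector of a node tells for each element
of its sequence whether it belongs to the right subtree. -/
def bits : MergeTree → List ℕ → List Bool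
  | leaf _, _ => []
  | node l r, s => s.map (fun x => decide (x ∈ r.leaves)) ++
      (l.bits (s.filter fun x => decide (x ∉ r.leaves)) ++
        r.bits (s.filter fun x => decide (x ∈ r.leaves)))

/-- What is stored for an inner node: the position of its bit vector, the number of ones before it,
pointers to the subtrees, and the parent pointer. -/
structure Rec where
  off : ℕ
  ones : ℕ
  child : Bool → ℕ
  parent : ℕ

/-- The pointer to a tree whose inner nodes are numbered from `base`: even for an inner node and odd
for a leaf. -/
def ptr : MergeTree → ℕ → ℕ
  | leaf j, _ => 2 * j + 1
  | node _ _, base => 2 * base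

/-- The records of the inner nodes, in preorder. -/
def recs : MergeTree → List ℕ → ℕ → ℕ → ℕ → ℕ → List Rec
  | leaf _, _, _, _, _, _ => []
  | node l r, s, base, off, ones, pp =>
    let b := s.map (fun x => decide (x ∈ r.leaves))
    let sl := s.filter fun x => decide (x ∉ r.leaves)
    let sr := s.filter fun x => decide (x ∈ r.leaves)
    ⟨off, ones, fun β => if β then r.ptr (base + 1 + l.size) else l.ptr (base + 1), pp⟩ ::
      (l.recs sl (base + 1) (off + s.length) (ones + b.count true) (2 * (base + 1)) ++
        r.recs sr (base + 1 + l.size) (off + s.length + (l.bits sl).length)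
          (ones + b.count true + (l.bits sl).count true) (2 * (base + 1) + 1))

/-- The parent pointer of leaf `j`. -/
def leafParent : MergeTree → ℕ → ℕ → ℕ → ℕ
  | leaf _, _, pp, _ => pp
  | node l r, base, _, j =>
    if j ∈ r.leaves then r.leafParent (base + 1 + l.size) (2 * (base + 1) + 1) j
    else l.leafParent (base + 1) (2 * (base + 1)) j

/-- The tree over the sequence `s` is stored in the bit vector `B`, the records `R` and the parent
pointers `lp` of the leaves. -/
def Stored (B : List Bool) (R : ℕ → Rec) (lp : ℕ → ℕ) (K : ℕ) :
    MergeTree → List ℕ → ℕ → ℕ → Prop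
  | leaf j, _, p, pp => p = 2 * j + 1 ∧ lp j = pp
  | node l r, s, p, pp => ∃ k < K, p = 2 * k ∧ (R k).parent = pp ∧
      (∃ Q₁ Q₂, B = Q₁ ++ (s.map (fun x => decide (x ∈ r.leaves)) ++ Q₂) ∧ Q₁.length = (R k).off ∧
        Q₁.count true = (R k).ones) ∧
      Stored B R lp K l (s.filter fun x => decide (x ∉ r.leaves)) ((R k).child false) (2 * (k + 1)) ∧
      Stored B R lp K r (s.filter fun x => decide (x ∈ r.leaves)) ((R k).child true)
        (2 * (k + 1) + 1)

theorem length_recs (T : MergeTree) : ∀ s base off ones pp,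
    (T.recs s base off ones pp).length = T.size := by
  induction T with
  | leaf j => intros; rfl
  | node l r hl hr => intro s base off ones pp; simp only [recs, size, List.length_cons,
      List.length_append, hl, hr]

/-- `Stored` is the local form of the global preorder numbering, which is all that the queries need.
The left subtree is numbered right after its parent and the right one after the `l.size` nodes of
the left; `Q₁` collects the bits written so far, and with them the offset and the number of ones. -/
theorem stored_of_recs {B : List Bool} {R : ℕ → Rec} {lp : ℕ → ℕ} {K : ℕ} (T : MergeTree) :
    ∀ (s : List ℕ) (base pp : ℕ) (Q₁ Q₂ : List Bool), T.leaves.Nodup →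
      B = Q₁ ++ (T.bits s ++ Q₂) → base + T.size ≤ K →
      (∀ k (h : k < (T.recs s base Q₁.length (Q₁.count true) pp).length),
        R (base + k) = (T.recs s base Q₁.length (Q₁.count true) pp)[k]) →
      (∀ j ∈ T.leaves, lp j = T.leafParent base pp j) → Stored B R lp K T s (T.ptr base) pp := by
  induction T with
  | leaf j =>
    intro s base pp Q₁ Q₂ _ hB hK hR hlp
    exact ⟨rfl, hlp j (by simp [leaves])⟩
  | node l r hl hr =>
    intro s base pp Q₁ Q₂ hnd hB hK hR hlp
    simp only [leaves, Multiset.nodup_add] at hnd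
    simp only [bits] at hB
    simp only [size] at hK
    have h0 := hR 0 (by simp [recs])
    simp only [recs, add_zero, List.getElem_cons_zero] at h0
    refine ⟨base, by omega, rfl, by rw [h0], ⟨Q₁, _, by rw [hB, List.append_assoc], by rw [h0],
      by rw [h0]⟩, ?_, ?_⟩
    · rw [h0]
      refine hl _ (base + 1) _ (Q₁ ++ s.map (fun x => decide (x ∈ r.leaves)))
        (r.bits (s.filter fun x => decide (x ∈ r.leaves)) ++ Q₂) hnd.1
        (by rw [hB]; simp only [List.append_assoc]) (by omega) ?_ ?_
      · intro k hk
        have hk' := hk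
        rw [length_recs] at hk'
        have := hR (k + 1) (by rw [length_recs]; simp only [size]; omega)
        rw [show base + 1 + k = base + (k + 1) by omega, this]
        simp only [recs, List.getElem_cons_succ]
        rw [List.getElem_append_left (by rw [length_recs]; omega)]
        simp only [List.length_append, List.length_map, List.count_append]
      · intro j hj
        rw [hlp j (by simp [leaves, hj]), leafParent,
          if_neg (fun h => (Multiset.disjoint_left.1 hnd.2.2) hj h)]
    · rw [h0]
      refine hr _ (base + 1 + l.size) _ (Q₁ ++ s.map (fun x => decide (x ∈ r.leaves)) ++
        l.bits (s.filter fun x => decide (x ∉ r.leaves))) Q₂ hnd.2.1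
        (by rw [hB]; simp only [List.append_assoc]) (by omega) ?_ ?_
      · intro k hk
        have hk' := hk
        rw [length_recs] at hk'
        have := hR (l.size + k + 1) (by rw [length_recs]; simp only [size]; omega)
        rw [show base + 1 + l.size + k = base + (l.size + k + 1) by omega, this]
        simp only [recs, List.getElem_cons_succ]
        rw [List.getElem_append_right (by rw [length_recs]; omega)]
        simp only [List.length_append, List.length_map, List.count_append, length_recs,
          Nat.add_sub_cancel_left]
      · intro j hj
        rw [hlp j (by simp [leaves, hj]), leafParent, if_pos hj]

/-- Each element contributes one bit to every inner node on its path. This is how the entropy enters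
the space bound. -/
theorem length_bits (T : MergeTree) : ∀ s : List ℕ, (∀ x ∈ s, x ∈ T.leaves) →
    (T.bits s).length = (s.map T.depth).sum := by
  induction T with
  | leaf j =>
    intro s _
    have : s.map (leaf j).depth = s.map fun _ => 0 := rfl
    rw [this]
    simp [bits]
  | node l r hl hr =>
    intro s hs
    simp only [bits, List.length_append, List.length_map]
    rw [hl, hr]
    · clear hl hr hs
      induction s with
      | nil => simp
      | cons x s ih =>
        by_cases hx : x ∈ r.leaves <;> simp [hx, depth] at ih ⊢ <;> omega
    · intro x hx
      simpa using (List.mem_filter.1 hx).2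
    · intro x hx
      obtain ⟨h1, h2⟩ := List.mem_filter.1 hx
      have := hs x h1
      simp only [leaves, Multiset.mem_add] at this
      exact this.resolve_right (by simpa using h2)

end MergeTree

/-! ### Positions and occurrences after passing to a subsequence -/

theorem List.getElem?_filter_countP {α : Type*} (q : α → Bool) {s : List α} {p : ℕ} {x : α}
    (hp : s[p]? = some x) (hx : q x = true) : (s.filter q)[(s.take p).countP q]? = some x := by
  obtain ⟨h, rfl⟩ := List.getElem?_eq_some_iff.1 hp
  have hs : s.filter q = (s.take p).filter q ++ s[p] :: (s.drop (p + 1)).filter q := by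
    conv_lhs => rw [← List.take_append_drop p s, List.drop_eq_getElem_cons h, List.filter_append]
    rw [List.filter_cons_of_pos hx]
  rw [hs, List.countP_eq_length_filter, List.getElem?_append_right le_rfl]
  simp

theorem List.take_countP_filter {α : Type*} (q : α → Bool) (s : List α) (p : ℕ) :
    (s.filter q).take ((s.take p).countP q) = (s.take p).filter q := by
  conv_lhs => rw [← List.take_append_drop p s, List.filter_append, List.take_append_drop]
  rw [List.countP_eq_length_filter, List.take_left]

theorem List.count_take_filter {q : ℕ → Bool} (s : List ℕ) (p : ℕ) {x : ℕ} (hx : q x = true) :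
    ((s.filter q).take ((s.take p).countP q)).count x = (s.take p).count x := by
  rw [List.take_countP_filter, List.count_filter hx]

theorem Nat.count_getD_eq (B : List Bool) (β : Bool) {x : ℕ} (hx : x ≤ B.length) :
    Nat.count (fun i => B.length ≤ i ∨ B.getD i false = β) x = (B.take x).count β := by
  induction x with
  | zero => simp
  | succ x ih =>
    have h : ¬ B.length ≤ x := by omega
    rw [Nat.count_succ, ih (by omega), List.take_add_one, List.count_append]
    have : B[x]? = some B[x] := List.getElem?_eq_getElem (by omega)
    simp [h, List.getD_eq_getElem?_getD, List.count_singleton, this]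

/-! ### Moving along the edges of the stored tree -/

namespace WordRAM

/-- The layout stores the bit vector `B`, the records `R` of `K` inner nodes and the parent pointers
`lp` of the leaves. -/
structure Layout.Wavelet (L : Layout) (B : List Bool) (R : ℕ → MergeTree.Rec) (lp : ℕ → ℕ)
    (K : ℕ) : Prop where
  good : L.Good
  hN : L.N = B.length
  hB : ∀ i, L.B i = B.getD i false
  hK : K < L.words
  off : ∀ k, L.val 1 k = (R k).off
  ones : ∀ k, L.val 2 k = (R k).ones
  child : ∀ β k, L.val (3 + β.toNat) k = (R k).child β
  parent : ∀ k, L.val 5 k = (R k).parent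
  leafParent : ∀ j, L.val 7 j = lp j
  child_lt : ∀ β, ∀ k < K, (R k).child β < 2 ^ L.w
  parent_lt : ∀ k < K, (R k).parent < 2 ^ L.w

namespace Layout.Wavelet

variable {L : Layout} {B : List Bool} {R : ℕ → MergeTree.Rec} {lp : ℕ → ℕ} {K : ℕ}
  {env : Fin 8 → ℕ}

theorem rank_eq (h : L.Wavelet B R lp K) (β : Bool) {x : ℕ} (hx : x ≤ B.length) :
    L.rank β x = (B.take x).count β := by
  rw [← Nat.count_getD_eq B β hx]
  unfold Layout.rank
  rw [Nat.count_eq_card_filter_range, Nat.count_eq_card_filter_range]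
  congr 1
  apply Finset.filter_congr
  intro i _
  simp only [Layout.P, h.hN, h.hB]

/-- The rank inside the segment of a node is the global rank minus the rank at the segment's start.
So one directory serves all nodes. -/
theorem rank_append (h : L.Wavelet B R lp K) (β : Bool) {Q₁ b Q₂ : List Bool}
    (hB : B = Q₁ ++ (b ++ Q₂)) {p : ℕ} (hp : p ≤ b.length) :
    L.rank β (Q₁.length + p) = Q₁.count β + (b.take p).count β := by
  rw [h.rank_eq β (by rw [hB]; simp; omega), hB, List.take_length_add_append, List.count_append,
    List.take_append_of_le_length hp]

theorem B_append (h : L.Wavelet B R lp K) {Q₁ b Q₂ : List Bool}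
    (hB : B = Q₁ ++ (b ++ Q₂)) {p : ℕ} {β : Bool} (hp : b[p]? = some β) :
    L.B (Q₁.length + p) = β := by
  obtain ⟨hlt, rfl⟩ := List.getElem?_eq_some_iff.1 hp
  rw [h.hB, hB, List.getD_eq_getElem?_getD, List.getElem?_append_right (by omega),
    Nat.add_sub_cancel_left, List.getElem?_append_left hlt, List.getElem?_eq_getElem hlt]
  rfl

end Layout.Wavelet

/-- The number of the inner node to which register `2` points. -/
def nodeDown : Ex := .op .div (.v 2) (.c 2)

/-- The position in the bit vector that belongs to the current position in the current node. -/
def posDown : Ex := .op .add (.wd 1 nodeDown) (.v 1)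

/-- The number of ones before the current position in the current node. -/
def rankDown : Ex := .op .sub (.rank posDown) (.wd 2 nodeDown)

/-- One step from an inner node to one of its children. -/
def stepDown : Prog :=
  .seq (assign 4 (.ite (.bb posDown (.c 1)) rankDown (.op .sub (.v 1) rankDown)))
    (.seq (assign 2 (.ite (.bb posDown (.c 1)) (.wd 4 nodeDown) (.wd 3 nodeDown)))
      (.seq (assign 1 (.v 4)) (assign 3 (.op .sub (.c 1) (.op .mod (.v 2) (.c 2))))))

/-- The number of the inner node to which the parent pointer in register `2` points. -/
def nodeUp : Ex := .op .sub (.op .div (.v 2) (.c 2)) (.c 1)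

/-- One step from a node to its parent. -/
def stepUp : Prog :=
  .seq (assign 1 (.ite (.op .mod (.v 2) (.c 2))
      (.op .sub (.sel true (.op .add (.wd 2 nodeUp) (.v 1))) (.wd 1 nodeUp))
      (.op .sub (.sel false (.op .add (.op .sub (.wd 1 nodeUp) (.wd 2 nodeUp)) (.v 1)))
        (.wd 1 nodeUp))))
    (assign 2 (.wd 5 nodeUp))

/-- An upper bound for the number of steps of `stepDown` and `stepUp`. -/
def stepBound : ℕ :=
  (Ex.size (.ite (.bb posDown (.c 1)) rankDown (.op .sub (.v 1) rankDown)) + 1) +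
    ((Ex.size (.ite (.bb posDown (.c 1)) (.wd 4 nodeDown) (.wd 3 nodeDown)) + 1) +
      ((Ex.size (.v 4) + 1) + (Ex.size (.op .sub (.c 1) (.op .mod (.v 2) (.c 2))) + 1))) +
  ((Ex.size (.ite (.op .mod (.v 2) (.c 2))
      (.op .sub (.sel true (.op .add (.wd 2 nodeUp) (.v 1))) (.wd 1 nodeUp))
      (.op .sub (.sel false (.op .add (.op .sub (.wd 1 nodeUp) (.wd 2 nodeUp)) (.v 1)))
        (.wd 1 nodeUp))) + 1) +
    (Ex.size (.wd 5 nodeUp) + 1))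

namespace Layout.Wavelet

variable {L : Layout} {B : List Bool} {R : ℕ → MergeTree.Rec} {lp : ℕ → ℕ} {K : ℕ}
  {env : Fin 8 → ℕ}

theorem runs_stepDown (h : L.Wavelet B R lp K) {k p : ℕ} {β : Bool} {Q₁ b Q₂ : List Bool}
    (hk : k < K) (hB : B = Q₁ ++ (b ++ Q₂)) (hoff : Q₁.length = (R k).off)
    (hones : Q₁.count true = (R k).ones) (hp : b[p]? = some β) (h1 : env 1 = p)
    (h2 : env 2 = 2 * k) :
    ∃ env', Runs L.w L.encode stepDown stepBound env env' ∧ env' 1 = (b.take p).count β ∧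
      env' 2 = (R k).child β ∧ env' 3 = 1 - (R k).child β % 2 := by
  have G := h.good
  have hs := G.hsize
  have hw := G.hw
  have hKw := h.hK
  obtain ⟨hpb, -⟩ := List.getElem?_eq_some_iff.1 hp
  have hlen : Q₁.length + (b.length + Q₂.length) = L.N := by rw [h.hN, hB]; simp
  have hcnt : Q₁.count true ≤ Q₁.length := List.count_le_length
  have c1 : ∀ env, (Ex.c 1).eval L.w L.encode env = 1 := fun env => G.eval_c (by norm_num)
  have c2 : ∀ env, (Ex.c 2).eval L.w L.encode env = 2 := fun env => G.eval_c (by norm_num)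
  have key : ∀ env : Fin 8 → ℕ, env 1 = p → env 2 = 2 * k →
      nodeDown.eval L.w L.encode env = k ∧
      posDown.eval L.w L.encode env = Q₁.length + p ∧
      (Ex.bb posDown (.c 1)).eval L.w L.encode env = (if β = true then 1 else 0) ∧
      rankDown.eval L.w L.encode env = (b.take p).count true := by
    intro env h1 h2
    have v1 : (Ex.v 1).eval L.w L.encode env = p := by rw [Ex.eval_v] <;> omega
    have v2 : (Ex.v 2).eval L.w L.encode env = 2 * k := by rw [Ex.eval_v] <;> omega
    have e1 : nodeDown.eval L.w L.encode env = k := by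
      unfold nodeDown
      rw [Ex.eval_div v2 (c2 env)]
      omega
    have e2 : posDown.eval L.w L.encode env = Q₁.length + p :=
      Ex.eval_add (G.eval_wd e1 (by norm_num) (by omega) (by rw [h.off, hoff]) (by omega)) v1
        (by omega)
    refine ⟨e1, e2, ?_, ?_⟩
    · rw [G.eval_bb e2 (c1 env) (by omega) (by omega)]
      apply Nat.eq_of_testBit_eq
      intro i
      by_cases hi : i < 1
      · obtain rfl : i = 0 := by omega
        rw [L.testBit_field_encode hi (by omega), add_zero, h.B_append hB hp]
        cases β <;> simp
      · rw [testBit_field]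
        have : Nat.testBit 1 i = false :=
          Nat.testBit_lt_two_pow (Nat.one_lt_two_pow (by omega))
        cases β <;> simp [hi, this]
    · have := h.rank_append true hB hpb.le
      have e3 := Ex.eval_sub (G.eval_rank e2 (by omega)) (G.eval_wd e1 (by norm_num) (by omega)
        ((h.ones k).trans hones.symm) (by omega)) (by omega)
      rw [this, Nat.add_sub_cancel_left] at e3
      exact e3
  have hcount : (b.take p).count true + (b.take p).count false = p := by
    rw [List.count_true_add_count_false, List.length_take]
    omega
  obtain ⟨e1, e2, e3, e4⟩ := key env h1 h2
  have v1 : (Ex.v 1).eval L.w L.encode env = p := by rw [Ex.eval_v] <;> omega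
  have ep : (Ex.ite (.bb posDown (.c 1)) rankDown (.op .sub (.v 1) rankDown)).eval L.w L.encode env =
      (b.take p).count β := by
    refine Ex.eval_ite e3 ?_ ?_
    · rintro rfl
      exact e4
    · intro hβ
      obtain rfl : β = false := by simpa using hβ
      rw [Ex.eval_sub v1 e4 (by omega)]
      omega
  -- The new position waits in register 4, because the choice of the child still has to read the bit
  -- at the old position.
  set env₁ := Function.update env 4 ((b.take p).count β) with henv₁
  have h1' : env₁ 1 = p := by rw [henv₁, Function.update_of_ne (by decide), h1]
  have h2' : env₁ 2 = 2 * k := by rw [henv₁, Function.update_of_ne (by decide), h2]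
  obtain ⟨f1, f2, f3, f4⟩ := key env₁ h1' h2'
  have ec : (Ex.ite (.bb posDown (.c 1)) (.wd 4 nodeDown) (.wd 3 nodeDown)).eval L.w L.encode env₁ =
      (R k).child β := by
    refine Ex.eval_ite f3 ?_ ?_
    · rintro rfl
      exact G.eval_wd f1 (by norm_num) (by omega) (h.child true k) (h.child_lt _ _ hk)
    · intro hβ
      obtain rfl : β = false := by simpa using hβ
      exact G.eval_wd f1 (by norm_num) (by omega) (h.child false k) (h.child_lt _ _ hk)
  set env₂ := Function.update env₁ 2 ((R k).child β) with henv₂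
  have hle : (b.take p).count β ≤ p := by cases β <;> omega
  have h4 : env₂ 4 = (b.take p).count β := by
    rw [henv₂, Function.update_of_ne (by decide), henv₁, Function.update_self]
  have ev4 : (Ex.v 4).eval L.w L.encode env₂ = (b.take p).count β := by
    rw [Ex.eval_v] <;> omega
  set env₃ := Function.update env₂ 1 ((b.take p).count β) with henv₃
  have h23 : env₃ 2 = (R k).child β := by
    rw [henv₃, Function.update_of_ne (by decide), henv₂, Function.update_self]
  have ev2 : (Ex.v 2).eval L.w L.encode env₃ = (R k).child β := by
    rw [Ex.eval_v, h23]
    rw [h23]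
    exact h.child_lt _ _ hk
  have e5 : (Ex.op .sub (.c 1) (.op .mod (.v 2) (.c 2))).eval L.w L.encode env₃ =
      1 - (R k).child β % 2 :=
    Ex.eval_sub (c1 _) (Ex.eval_mod ev2 (c2 _)) (by omega)
  refine ⟨_, (Runs.seq (Runs.assign 4 _ env) (Runs.seq (Runs.assign 2 _ _)
    (Runs.seq (Runs.assign 1 _ _) (Runs.assign 3 _ _)))).mono (Nat.le_add_right _ _), ?_, ?_, ?_⟩
  · rw [ep, ← henv₁, ec, ← henv₂, ev4, ← henv₃, Function.update_of_ne (by decide), henv₃,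
      Function.update_self]
  · rw [ep, ← henv₁, ec, ← henv₂, ev4, ← henv₃, Function.update_of_ne (by decide), h23]
  · rw [ep, ← henv₁, ec, ← henv₂, ev4, ← henv₃, Function.update_self, e5]

theorem runs_stepUp (h : L.Wavelet B R lp K) {k p : ℕ} {β : Bool} {Q₁ b Q₂ : List Bool}
    (hk : k < K) (hB : B = Q₁ ++ (b ++ Q₂)) (hoff : Q₁.length = (R k).off)
    (hones : Q₁.count true = (R k).ones) (hp : b[p]? = some β) (h1 : env 1 = (b.take p).count β)
    (h2 : env 2 = 2 * (k + 1) + β.toNat) :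
    ∃ env', Runs L.w L.encode stepUp stepBound env env' ∧ env' 1 = p ∧
      env' 2 = (R k).parent := by
  have G := h.good
  have hs := G.hsize
  have hw := G.hw
  have hKw := h.hK
  obtain ⟨hpb, -⟩ := List.getElem?_eq_some_iff.1 hp
  have hlen : Q₁.length + (b.length + Q₂.length) = L.N := by rw [h.hN, hB]; simp
  have hcnt : Q₁.count true + Q₁.count false = Q₁.length := List.count_true_add_count_false _
  have c1 : ∀ env, (Ex.c 1).eval L.w L.encode env = 1 := fun env => G.eval_c (by norm_num)
  have c2 : ∀ env, (Ex.c 2).eval L.w L.encode env = 2 := fun env => G.eval_c (by norm_num)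
  have hβ := Good.toNat_le β
  have hcount : (b.take p).count true + (b.take p).count false = p := by
    rw [List.count_true_add_count_false, List.length_take]
    omega
  have hle : (b.take p).count β ≤ p := by cases β <;> omega
  have hnode : ∀ env : Fin 8 → ℕ, env 2 = 2 * (k + 1) + β.toNat →
      nodeUp.eval L.w L.encode env = k := by
    intro env h2
    have v2 : (Ex.v 2).eval L.w L.encode env = 2 * (k + 1) + β.toNat := by rw [Ex.eval_v] <;> omega
    unfold nodeUp
    rw [Ex.eval_sub (Ex.eval_div v2 (c2 _)) (c1 _) (by omega)]
    omega
  have e1 := hnode env h2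
  have v1 : (Ex.v 1).eval L.w L.encode env = (b.take p).count β := by
    rw [Ex.eval_v] <;> omega
  have v2 : (Ex.v 2).eval L.w L.encode env = 2 * (k + 1) + β.toNat := by rw [Ex.eval_v] <;> omega
  have eo : (Ex.wd 1 nodeUp).eval L.w L.encode env = Q₁.length :=
    G.eval_wd e1 (by norm_num) (by omega) ((h.off k).trans hoff.symm) (by omega)
  have en : (Ex.wd 2 nodeUp).eval L.w L.encode env = Q₁.count true :=
    G.eval_wd e1 (by norm_num) (by omega) ((h.ones k).trans hones.symm) (by omega)
  -- Select inverts rank at a position that holds the bit `β` itself.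
  have hsel : L.sel β (Q₁.count β + (b.take p).count β) = Q₁.length + p := by
    rw [← h.rank_append β hB hpb.le]
    exact L.sel_rank (Or.inr (h.B_append hB hp))
  have ep : (Ex.ite (.op .mod (.v 2) (.c 2))
      (.op .sub (.sel true (.op .add (.wd 2 nodeUp) (.v 1))) (.wd 1 nodeUp))
      (.op .sub (.sel false (.op .add (.op .sub (.wd 1 nodeUp) (.wd 2 nodeUp)) (.v 1)))
        (.wd 1 nodeUp))).eval L.w L.encode env = p := by
    refine Ex.eval_ite (P := β = true) ?_ ?_ ?_
    · rw [Ex.eval_mod v2 (c2 _)]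
      cases β <;> simp
    · rintro rfl
      rw [Ex.eval_sub (G.eval_sel (Ex.eval_add en v1 (by omega)) (by omega)) eo (by omega), hsel]
      omega
    · intro hβ'
      obtain rfl : β = false := by simpa using hβ'
      -- The zeros before the segment are its offset minus the ones before it, so they need not be
      -- stored.
      have e0 : (Ex.op .sub (.wd 1 nodeUp) (.wd 2 nodeUp)).eval L.w L.encode env =
          Q₁.count false := by
        rw [Ex.eval_sub eo en (by omega)]
        omega
      rw [Ex.eval_sub (G.eval_sel (Ex.eval_add e0 v1 (by omega)) (by omega)) eo (by omega), hsel]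
      omega
  set env₁ := Function.update env 1 p with henv₁
  have h2' : env₁ 2 = 2 * (k + 1) + β.toNat := by
    rw [henv₁, Function.update_of_ne (by decide), h2]
  have eq : (Ex.wd 5 nodeUp).eval L.w L.encode env₁ = (R k).parent :=
    G.eval_wd (hnode env₁ h2') (by norm_num) (by omega) (h.parent k) (h.parent_lt k hk)
  refine ⟨_, (Runs.seq (Runs.assign 1 _ env) (Runs.assign 2 _ _)).mono (Nat.le_add_left _ _),
    ?_, ?_⟩
  · rw [ep, ← henv₁, Function.update_of_ne (by decide), henv₁, Function.update_self]
  · rw [ep, ← henv₁, Function.update_self, eq]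

theorem _root_.MergeTree.getElem?_bits {s : List ℕ} {p x : ℕ} (hp : s[p]? = some x)
    (A : Multiset ℕ) :
    (s.map fun y => decide (y ∈ A))[p]? = some (decide (x ∈ A)) := by
  rw [List.getElem?_map, hp]
  rfl

theorem _root_.MergeTree.count_take_bits (s : List ℕ) (p : ℕ) (A : Multiset ℕ) (β : Bool) :
    ((s.map fun y => decide (y ∈ A)).take p).count β =
      (s.take p).countP (fun y => decide (y ∈ A) == β) := by
  rw [← List.map_take, List.count_eq_countP, List.countP_map]
  rfl

/-- The elements of the prefix that go to the same child as `x` are counted by a rank, and their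
number is the position of `x` in the child. The sequence at a leaf is constant, so the last position
counts all earlier occurrences of `x`. The odd pointer of a leaf ends the loop. -/
theorem runs_down (h : L.Wavelet B R lp K) (T : MergeTree) :
    ∀ (s : List ℕ) (ptr pp p x : ℕ) (env : Fin 8 → ℕ), T.Stored B R lp K s ptr pp →
      (∀ y ∈ s, y ∈ T.leaves) → s[p]? = some x → env 1 = p → env 2 = ptr → env 3 = 1 - ptr % 2 →
      ∃ env', Runs L.w L.encode (.while 3 stepDown) (T.depth x * (stepBound + 1) + 1) env env' ∧
        env' 1 = (s.take p).count x ∧ env' 2 = 2 * x + 1 := by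
  induction T with
  | leaf j =>
    intro s ptr pp p x env hT hs hp h1 h2 h3
    obtain ⟨rfl, -⟩ := hT
    have hall : ∀ y ∈ s, y = j := fun y hy => by simpa [MergeTree.leaves] using hs y hy
    obtain ⟨hlt, rfl⟩ := List.getElem?_eq_some_iff.1 hp
    have hx : s[p] = j := hall _ (List.getElem_mem hlt)
    refine ⟨env, (Runs.while_false (r := 3) (by rw [h3]; omega)).mono (by omega), ?_, by rw [h2, hx]⟩
    rw [List.count_eq_length.2 (fun y hy => by rw [hx, hall y (List.mem_of_mem_take hy)]),
      List.length_take, h1]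
    omega
  | node l r hl hr =>
    intro s ptr pp p x env hT hs hp h1 h2 h3
    obtain ⟨k, hk, rfl, -, ⟨Q₁, Q₂, hB, hoff, hones⟩, hTl, hTr⟩ := hT
    obtain ⟨env₁, hrun, g1, g2, g3⟩ := h.runs_stepDown hk hB hoff hones
      (MergeTree.getElem?_bits hp r.leaves) h1 h2
    rw [MergeTree.count_take_bits] at g1
    by_cases hx : x ∈ r.leaves
    · simp only [hx, decide_true, beq_true] at g1 g2 g3
      obtain ⟨env₂, hrun₂, f1, f2⟩ := hr _ _ _ _ x env₁ hTr
        (fun y hy => by simpa using (List.mem_filter.1 hy).2)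
        (List.getElem?_filter_countP _ hp (by simpa using hx)) g1 g2 g3
      refine ⟨env₂, (Runs.while_true (r := 3) (by rw [h3]; omega) hrun hrun₂).mono ?_, ?_, f2⟩
      · simp only [MergeTree.depth, hx, if_true, add_mul, one_mul]
        omega
      · rw [f1, List.count_take_filter _ _ (by simpa using hx)]
    · simp only [hx, decide_false, beq_false, ← decide_not] at g1 g2 g3
      obtain ⟨env₂, hrun₂, f1, f2⟩ := hl _ _ _ _ x env₁ hTl
        (fun y hy => by
          obtain ⟨h1, h2⟩ := List.mem_filter.1 hy
          have := hs y h1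
          simp only [MergeTree.leaves, Multiset.mem_add] at this
          exact this.resolve_right (by simpa using h2))
        (List.getElem?_filter_countP _ hp (by simpa using hx)) g1 g2 g3
      refine ⟨env₂, (Runs.while_true (r := 3) (by rw [h3]; omega) hrun hrun₂).mono ?_, ?_, f2⟩
      · simp only [MergeTree.depth, hx, if_false, add_mul, one_mul]
        omega
      · rw [f1, List.count_take_filter _ _ (by simpa using hx)]

/-- The induction starts at the root but the loop starts at a leaf. Hence the remaining run of the
loop, once the root of `T` has been reached, enters as a hypothesis with a budget of `n` rounds, and
each level of the induction prepends one step to it. -/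
theorem runs_up (h : L.Wavelet B R lp K) (T : MergeTree) (Z : (Fin 8 → ℕ) → Prop) (c : ℕ) :
    ∀ (s : List ℕ) (ptr pp p x : ℕ) (env : Fin 8 → ℕ), T.Stored B R lp K s ptr pp →
      (∀ y ∈ s, y ∈ T.leaves) → s[p]? = some x → env 1 = (s.take p).count x → env 2 = lp x →
      ∀ n, (∀ env' : Fin 8 → ℕ, env' 1 = p → env' 2 = pp →
        ∃ env'', Runs L.w L.encode (.while 2 stepUp) (n * (stepBound + 1) + c) env' env'' ∧
          Z env'') →
      ∃ env'', Runs L.w L.encode (.while 2 stepUp) ((T.depth x + n) * (stepBound + 1) + c) env env'' ∧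
        Z env'' := by
  induction T with
  | leaf j =>
    intro s ptr pp p x env hT hs hp h1 h2 n hn
    obtain ⟨-, rfl⟩ := hT
    have hall : ∀ y ∈ s, y = j := fun y hy => by simpa [MergeTree.leaves] using hs y hy
    obtain ⟨hlt, rfl⟩ := List.getElem?_eq_some_iff.1 hp
    have hx : s[p] = j := hall _ (List.getElem_mem hlt)
    rw [hx] at h2
    obtain ⟨env'', hr, hz⟩ := hn env (by
      rw [h1, List.count_eq_length.2 (fun y hy => by rw [hx, hall y (List.mem_of_mem_take hy)]),
        List.length_take]
      omega) h2
    exact ⟨env'', hr.mono (by simp [MergeTree.depth]), hz⟩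
  | node l r hl hr =>
    intro s ptr pp p x env hT hs hp h1 h2 n hn
    obtain ⟨k, hk, rfl, rfl, ⟨Q₁, Q₂, hB, hoff, hones⟩, hTl, hTr⟩ := hT
    have hstep : ∀ env' : Fin 8 → ℕ,
        env' 1 = (s.take p).countP (fun y => decide (y ∈ r.leaves) == decide (x ∈ r.leaves)) →
        env' 2 = 2 * (k + 1) + (decide (x ∈ r.leaves)).toNat →
        ∃ env'', Runs L.w L.encode (.while 2 stepUp) ((n + 1) * (stepBound + 1) + c) env' env'' ∧
          Z env'' := by
      intro env' e1 e2
      rw [← MergeTree.count_take_bits] at e1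
      obtain ⟨env₁, hrun, g1, g2⟩ := h.runs_stepUp hk hB hoff hones
        (MergeTree.getElem?_bits hp r.leaves) e1 e2
      obtain ⟨env₂, hrun₂, hz⟩ := hn env₁ g1 g2
      refine ⟨env₂, (Runs.while_true (r := 2) (by rw [e2]; omega) hrun hrun₂).mono ?_, hz⟩
      rw [add_mul n, one_mul]
      omega
    by_cases hx : x ∈ r.leaves
    · simp only [hx, decide_true, beq_true, Bool.toNat_true] at hstep
      obtain ⟨env'', hrun, hz⟩ := hr _ _ _ _ x env hTr
        (fun y hy => by simpa using (List.mem_filter.1 hy).2)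
        (List.getElem?_filter_countP _ hp (by simpa using hx))
        (by rw [h1, List.count_take_filter _ _ (by simpa using hx)]) h2 (n + 1) hstep
      refine ⟨env'', hrun.mono (le_of_eq ?_), hz⟩
      simp only [MergeTree.depth, hx, if_true]
      ring
    · simp only [hx, decide_false, beq_false, ← decide_not, Bool.toNat_false, add_zero] at hstep
      obtain ⟨env'', hrun, hz⟩ := hl _ _ _ _ x env hTl
        (fun y hy => by
          obtain ⟨h1, h2⟩ := List.mem_filter.1 hy
          have := hs y h1
          simp only [MergeTree.leaves, Multiset.mem_add] at this
          exact this.resolve_right (by simpa using h2))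
        (List.getElem?_filter_countP _ hp (by simpa using hx))
        (by rw [h1, List.count_take_filter _ _ (by simpa using hx)]) h2 (n + 1) hstep
      refine ⟨env'', hrun.mono (le_of_eq ?_), hz⟩
      simp only [MergeTree.depth, hx, if_false]
      ring

end Layout.Wavelet

end WordRAM

/-! ### Bisection for the run, and the two query programs -/

namespace WordRAM

/-- One step of the binary search for the run of a position. -/
def searchStep : Prog :=
  .seq (assign 7 (.op .div (.op .add (.v 5) (.v 6)) (.c 2)))
    (.seq (assign 4 (.op .lt (.v 1) (.wd 6 (.v 7))))
      (.seq (assign 5 (.ite (.v 4) (.v 5) (.v 7)))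
        (.seq (assign 6 (.ite (.v 4) (.v 7) (.v 6)))
          (assign 3 (.op .lt (.op .add (.v 5) (.c 1)) (.v 6))))))

/-- An upper bound for the number of steps of `searchStep`. -/
def searchBound : ℕ :=
  (Ex.size (.op .div (.op .add (.v 5) (.v 6)) (.c 2)) + 1) +
    ((Ex.size (.op .lt (.v 1) (.wd 6 (.v 7))) + 1) +
      ((Ex.size (.ite (.v 4) (.v 5) (.v 7)) + 1) +
        ((Ex.size (.ite (.v 4) (.v 7) (.v 6)) + 1) +
          (Ex.size (.op .lt (.op .add (.v 5) (.c 1)) (.v 6)) + 1))))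

/-- The program that computes `π(i)`: find the run of position `i` and the offset in the run, and
climb to the root of the tree. -/
def applyProg : Prog :=
  .seq (assign 1 (.op .sub (.v 0) (.c 1)))
    (.seq (assign 5 (.wd 8 (.op .div (.v 1) (.hd 11))))
      (.seq (assign 6 (.wd 9 (.op .div (.v 1) (.hd 11))))
        (.seq (assign 3 (.op .lt (.op .add (.v 5) (.c 1)) (.v 6)))
          (.seq (.while 3 searchStep)
            (.seq (assign 2 (.wd 7 (.v 5)))
              (.seq (assign 1 (.op .sub (.v 1) (.wd 6 (.v 5))))
                (.seq (.while 2 stepUp) (assign 0 (.op .add (.v 1) (.c 1))))))))))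

/-- The program that computes `π⁻¹(i)`: descend from the root of the tree to a leaf. -/
def inverseProg : Prog :=
  .seq (assign 1 (.op .sub (.v 0) (.c 1)))
    (.seq (assign 2 (.hd 10))
      (.seq (assign 3 (.op .sub (.c 1) (.op .mod (.v 2) (.c 2))))
        (.seq (.while 3 stepDown)
          (assign 0 (.op .add (.op .add (.wd 6 (.op .div (.v 2) (.c 2))) (.v 1)) (.c 1))))))

/-- The invariant is that `j` lies in the half-open interval from `lo` to `hi`. By monotonicity of
the run starts, comparing `i` with `st mid` decides between `j < mid` and `mid ≤ j`, and each half
of an interval of length at most 2^(m+1) has length at most 2^m. -/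
theorem Layout.Good.runs_search {L : Layout} (G : L.Good) {st : ℕ → ℕ} (hst : ∀ j, L.val 6 j = st j)
    (hmono : Monotone st) {i j : ℕ} (hi : i < 2 ^ L.w) (hj : st j ≤ i) (hj' : i < st (j + 1)) :
    ∀ (m lo hi : ℕ) (env : Fin 8 → ℕ), env 1 = i → env 5 = lo → env 6 = hi →
      env 3 = (if lo + 1 < hi then 1 else 0) → lo ≤ j → j < hi → hi ≤ L.words →
      (∀ q < hi, st q < 2 ^ L.w) → hi - lo ≤ 2 ^ m →
      ∃ env', Runs L.w L.encode (.while 3 searchStep) (m * (searchBound + 1) + 1) env env' ∧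
        env' 1 = i ∧ env' 5 = j := by
  intro m
  induction m with
  | zero =>
    intro lo hi env h1 h5 h6 h3 hlo hhi hwords hq hm
    rw [pow_zero] at hm
    rw [if_neg (by omega)] at h3
    exact ⟨env, (Runs.while_false (r := 3) h3).mono (by omega), h1, by omega⟩
  | succ m ih =>
    intro lo hi' env h1 h5 h6 h3 hlo hhi hwords hq hm
    by_cases hlt : lo + 1 < hi'
    swap
    · rw [if_neg hlt] at h3
      exact ⟨env, (Runs.while_false (r := 3) h3).mono (by omega), h1, by omega⟩
    have hs := G.hsize
    have hw := G.hw
    have c1 : ∀ env, (Ex.c 1).eval L.w L.encode env = 1 := fun env => G.eval_c (by norm_num)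
    have c2 : ∀ env, (Ex.c 2).eval L.w L.encode env = 2 := fun env => G.eval_c (by norm_num)
    have hv : ∀ (env : Fin 8 → ℕ) (r : Fin 8) (x : ℕ), env r = x → x < 2 ^ L.w →
        (Ex.v r).eval L.w L.encode env = x := by
      intro env r x h hx
      rw [Ex.eval_v (by rwa [h]), h]
    set mid := (lo + hi') / 2 with hmid
    have e7 : (Ex.op .div (.op .add (.v 5) (.v 6)) (.c 2)).eval L.w L.encode env = mid :=
      Ex.eval_div (Ex.eval_add (hv env 5 _ h5 (by omega)) (hv env 6 _ h6 (by omega)) (by omega))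
        (c2 _)
    set env₁ := Function.update env 7 mid with henv₁
    have e4 : (Ex.op .lt (.v 1) (.wd 6 (.v 7))).eval L.w L.encode env₁ =
        if i < st mid then 1 else 0 :=
      Ex.eval_lt_op (by omega) (hv _ 1 _ (by simp [henv₁, h1]) hi)
        (G.eval_wd (hv _ 7 _ (by simp [henv₁]) (by omega)) (by norm_num) (by omega) (hst _)
          (hq _ (by omega)))
    have hdec : i < st mid ↔ j < mid := by
      constructor
      · intro h
        by_contra! h'
        have := hmono h'
        omega
      · intro h
        exact hj'.trans_le (hmono h)
    rw [if_congr hdec rfl rfl] at e4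
    set env₂ := Function.update env₁ 4 (if j < mid then 1 else 0) with henv₂
    have v4 : ∀ env : Fin 8 → ℕ, env 4 = (if j < mid then 1 else 0) →
        (Ex.v 4).eval L.w L.encode env = if j < mid then 1 else 0 := fun env h =>
      hv _ 4 _ h (by split_ifs <;> omega)
    have e5 : (Ex.ite (.v 4) (.v 5) (.v 7)).eval L.w L.encode env₂ = if j < mid then lo else mid := by
      refine Ex.eval_ite (v4 _ (by simp [henv₂])) (fun h => ?_) (fun h => ?_)
      · rw [if_pos h]
        exact hv _ 5 _ (by simp [henv₂, henv₁, h5]) (by omega)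
      · rw [if_neg h]
        exact hv _ 7 _ (by simp [henv₂, henv₁]) (by omega)
    set lo' := if j < mid then lo else mid with hlo'
    set env₃ := Function.update env₂ 5 lo' with henv₃
    have e6 : (Ex.ite (.v 4) (.v 7) (.v 6)).eval L.w L.encode env₃ = if j < mid then mid else hi' := by
      refine Ex.eval_ite (v4 _ (by simp [henv₃, henv₂])) (fun h => ?_) (fun h => ?_)
      · rw [if_pos h]
        exact hv _ 7 _ (by simp [henv₃, henv₂, henv₁]) (by omega)
      · rw [if_neg h]
        exact hv _ 6 _ (by simp [henv₃, henv₂, henv₁, h6]) (by omega)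
    set hi₂ := if j < mid then mid else hi' with hhi₂
    set env₄ := Function.update env₃ 6 hi₂ with henv₄
    have hb : lo' ≤ j ∧ j < hi₂ ∧ hi₂ ≤ hi' ∧ hi₂ - lo' ≤ 2 ^ m := by
      rw [pow_succ] at hm
      rw [hlo', hhi₂]
      split_ifs <;> omega
    have e3 : (Ex.op .lt (.op .add (.v 5) (.c 1)) (.v 6)).eval L.w L.encode env₄ =
        if lo' + 1 < hi₂ then 1 else 0 :=
      Ex.eval_lt_op (by omega) (Ex.eval_add (hv _ 5 _ (by simp [henv₄, henv₃]) (by omega)) (c1 _)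
        (by omega)) (hv _ 6 _ (by simp [henv₄]) (by omega))
    set env₅ := Function.update env₄ 3 (if lo' + 1 < hi₂ then 1 else 0) with henv₅
    obtain ⟨env', hrun, r1, r5⟩ := ih lo' hi₂ env₅
      (by simp [henv₅, henv₄, henv₃, henv₂, henv₁, h1]) (by simp [henv₅, henv₄, henv₃])
      (by simp [henv₅, henv₄]) (by simp [henv₅]) hb.1 hb.2.1 (by omega)
      (fun q hq' => hq q (by omega)) hb.2.2.2
    have hbody := Runs.seq (Runs.assign (w := L.w) (D := L.encode) 7
      (.op .div (.op .add (.v 5) (.v 6)) (.c 2)) env) (Runs.seq (Runs.assign 4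
      (.op .lt (.v 1) (.wd 6 (.v 7))) _) (Runs.seq (Runs.assign 5
      (.ite (.v 4) (.v 5) (.v 7)) _) (Runs.seq (Runs.assign 6 (.ite (.v 4) (.v 7) (.v 6)) _)
      (Runs.assign 3 (.op .lt (.op .add (.v 5) (.c 1)) (.v 6)) _))))
    rw [e7, ← henv₁, e4, ← henv₂, e5, ← henv₃, e6, ← henv₄, e3, ← henv₅] at hbody
    refine ⟨env', (Runs.while_true (r := 3) (by rw [h3, if_pos hlt]; norm_num) hbody hrun).mono ?_,
      r1, r5⟩
    rw [add_mul m, one_mul]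
    unfold searchBound
    omega

/-- A bound for the number of steps of `applyProg` and `inverseProg` outside of their loops and for
one round of a loop. -/
def queryBound : ℕ :=
  searchBound + stepBound + 10 +
  (Ex.size (.op .sub (.v 0) (.c 1)) + Ex.size (.wd 8 (.op .div (.v 1) (.hd 11))) +
    Ex.size (.wd 9 (.op .div (.v 1) (.hd 11))) +
    Ex.size (.op .lt (.op .add (.v 5) (.c 1)) (.v 6)) + Ex.size (.wd 7 (.v 5)) +
    Ex.size (.op .sub (.v 1) (.wd 6 (.v 5))) + Ex.size (.op .add (.v 1) (.c 1)) +
    Ex.size (.hd 10) + Ex.size (.op .sub (.c 1) (.op .mod (.v 2) (.c 2))) +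
    Ex.size (.op .add (.op .add (.wd 6 (.op .div (.v 2) (.c 2))) (.v 1)) (.c 1)))

namespace Layout.Wavelet

variable {L : Layout} {B : List Bool} {R : ℕ → MergeTree.Rec} {lp : ℕ → ℕ} {K : ℕ}
  {T : MergeTree} {s : List ℕ} {ptr : ℕ} {st : ℕ → ℕ}

theorem computes_inverse (h : L.Wavelet B R lp K) (hT : T.Stored B R lp K s ptr 0)
    (hroot : L.val 0 10 = ptr) (hptr : ptr < 2 ^ L.w) (hs : ∀ y ∈ s, y ∈ T.leaves)
    (hst : ∀ j, L.val 6 j = st j) {p x : ℕ} (hp : s[p]? = some x) (hpw : p + 1 < 2 ^ L.w)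
    (hx : x < L.words) (hy : st x + (s.take p).count x + 1 < 2 ^ L.w) :
    ∃ t ≤ queryBound * (1 + T.depth x), Computes L.w L.encode inverseProg (p + 1)
      (st x + (s.take p).count x + 1) t := by
  have G := h.good
  have hsz := G.hsize
  have hw := G.hw
  have c1 : ∀ env, (Ex.c 1).eval L.w L.encode env = 1 := fun env => G.eval_c (by norm_num)
  have c2 : ∀ env, (Ex.c 2).eval L.w L.encode env = 2 := fun env => G.eval_c (by norm_num)
  have hv : ∀ (env : Fin 8 → ℕ) (r : Fin 8) (x : ℕ), env r = x → x < 2 ^ L.w →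
      (Ex.v r).eval L.w L.encode env = x := by
    intro env r x h hx
    rw [Ex.eval_v (by rwa [h]), h]
  set env₀ : Fin 8 → ℕ := Function.update (fun _ => 0) 0 (p + 1) with henv₀
  have e1 : (Ex.op .sub (.v 0) (.c 1)).eval L.w L.encode env₀ = p :=
    Ex.eval_sub (hv _ 0 _ (by simp [henv₀]) hpw) (c1 _) (by omega)
  set env₁ := Function.update env₀ 1 p with henv₁
  have e2 : (Ex.hd 10).eval L.w L.encode env₁ = ptr := G.eval_hd (by norm_num) hroot hptr
  set env₂ := Function.update env₁ 2 ptr with henv₂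
  have e3 : (Ex.op .sub (.c 1) (.op .mod (.v 2) (.c 2))).eval L.w L.encode env₂ = 1 - ptr % 2 :=
    Ex.eval_sub (c1 _) (Ex.eval_mod (hv _ 2 _ (by simp [henv₂]) hptr) (c2 _)) (by omega)
  set env₃ := Function.update env₂ 3 (1 - ptr % 2) with henv₃
  obtain ⟨env₄, hrun, f1, f2⟩ := h.runs_down T s ptr 0 p x env₃ hT hs hp
    (by simp [henv₃, henv₂, henv₁]) (by simp [henv₃, henv₂]) (by simp [henv₃])
  have e0 : (Ex.op .add (.op .add (.wd 6 (.op .div (.v 2) (.c 2))) (.v 1)) (.c 1)).eval L.w L.encode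
      env₄ = st x + (s.take p).count x + 1 :=
    Ex.eval_add (Ex.eval_add (G.eval_wd (j := x) (by
      rw [Ex.eval_div (hv _ 2 _ f2 (by omega)) (c2 _)]; omega) (by norm_num) hx (hst x) (by omega))
      (hv _ 1 _ f1 (by omega)) (by omega)) (c1 _) hy
  have hall := Runs.seq (Runs.assign (w := L.w) (D := L.encode) 1 (.op .sub (.v 0) (.c 1)) env₀)
    (Runs.seq (Runs.assign 2 (.hd 10) _) (Runs.seq
      (Runs.assign 3 (.op .sub (.c 1) (.op .mod (.v 2) (.c 2))) _)
      (by rw [e1, ← henv₁, e2, ← henv₂, e3, ← henv₃]; exact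
        Runs.seq hrun (Runs.assign 0
          (.op .add (.op .add (.wd 6 (.op .div (.v 2) (.c 2))) (.v 1)) (.c 1)) _))))
  obtain ⟨t, ht, hc⟩ := hall.computes
  rw [Function.update_self, e0] at hc
  refine ⟨t, ht.trans ?_, hc⟩
  have : T.depth x * (stepBound + 1) ≤ T.depth x * queryBound :=
    Nat.mul_le_mul_left _ (by unfold queryBound; omega)
  rw [show queryBound * (1 + T.depth x) = queryBound + T.depth x * queryBound by ring]
  refine le_trans ?_ (Nat.add_le_add_left this _)
  unfold queryBound
  omega

theorem computes_apply (h : L.Wavelet B R lp K) (hT : T.Stored B R lp K s ptr 0)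
    (hs : ∀ y ∈ s, y ∈ T.leaves) (hst : ∀ j, L.val 6 j = st j) (hmono : Monotone st)
    {i d lo hi p x m : ℕ} (hd : L.val 0 11 = d) (hdw : d < 2 ^ L.w) (hid : i / d < L.words)
    (hlo : L.val 8 (i / d) = lo) (hhi : L.val 9 (i / d) = hi) (hxlo : lo ≤ x) (hxhi : x < hi)
    (hwords : hi ≤ L.words) (hstw : ∀ q < hi, st q < 2 ^ L.w) (hm : hi - lo ≤ 2 ^ m)
    (hp : s[p]? = some x) (hix : i = st x + (s.take p).count x) (hix' : i < st (x + 1))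
    (hiw : i + 1 < 2 ^ L.w) (hpw : p + 1 < 2 ^ L.w) (hlp : lp x < 2 ^ L.w) :
    ∃ t ≤ queryBound * (1 + T.depth x + m), Computes L.w L.encode applyProg (i + 1) (p + 1) t := by
  have G := h.good
  have hsz := G.hsize
  have hw := G.hw
  have c1 : ∀ env, (Ex.c 1).eval L.w L.encode env = 1 := fun env => G.eval_c (by norm_num)
  have hv : ∀ (env : Fin 8 → ℕ) (r : Fin 8) (x : ℕ), env r = x → x < 2 ^ L.w →
      (Ex.v r).eval L.w L.encode env = x := by
    intro env r x h hx
    rw [Ex.eval_v (by rwa [h]), h]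
  set env₀ : Fin 8 → ℕ := Function.update (fun _ => 0) 0 (i + 1) with henv₀
  have e1 : (Ex.op .sub (.v 0) (.c 1)).eval L.w L.encode env₀ = i :=
    Ex.eval_sub (hv _ 0 _ (by simp [henv₀]) hiw) (c1 _) (by omega)
  have ed : ∀ env, (Ex.hd 11).eval L.w L.encode env = d := fun env =>
    G.eval_hd (by norm_num) hd hdw
  set env₁ := Function.update env₀ 1 i with henv₁
  have e5 : (Ex.wd 8 (.op .div (.v 1) (.hd 11))).eval L.w L.encode env₁ = lo :=
    G.eval_wd (Ex.eval_div (hv _ 1 _ (by simp [henv₁]) (by omega)) (ed _)) (by norm_num) hid hlo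
      (by omega)
  set env₂ := Function.update env₁ 5 lo with henv₂
  have e6 : (Ex.wd 9 (.op .div (.v 1) (.hd 11))).eval L.w L.encode env₂ = hi :=
    G.eval_wd (Ex.eval_div (hv _ 1 _ (by simp [henv₂, henv₁]) (by omega)) (ed _)) (by norm_num) hid
      hhi (by omega)
  set env₃ := Function.update env₂ 6 hi with henv₃
  have e3 : (Ex.op .lt (.op .add (.v 5) (.c 1)) (.v 6)).eval L.w L.encode env₃ =
      if lo + 1 < hi then 1 else 0 :=
    Ex.eval_lt_op (by omega) (Ex.eval_add (hv _ 5 _ (by simp [henv₃, henv₂]) (by omega)) (c1 _)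
      (by omega)) (hv _ 6 _ (by simp [henv₃]) (by omega))
  set env₄ := Function.update env₃ 3 (if lo + 1 < hi then 1 else 0) with henv₄
  obtain ⟨env₅, hrun, f1, f5⟩ := G.runs_search hst hmono (i := i) (j := x) (by omega) (by omega) hix'
    m lo hi env₄ (by simp [henv₄, henv₃, henv₂, henv₁]) (by simp [henv₄, henv₃, henv₂])
    (by simp [henv₄, henv₃]) (by simp [henv₄]) hxlo hxhi hwords hstw hm
  have hstx := hstw x hxhi
  have e2 : (Ex.wd 7 (.v 5)).eval L.w L.encode env₅ = lp x :=
    G.eval_wd (hv _ 5 _ f5 (by omega)) (by norm_num) (by omega) (h.leafParent x) hlp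
  set env₆ := Function.update env₅ 2 (lp x) with henv₆
  have e1' : (Ex.op .sub (.v 1) (.wd 6 (.v 5))).eval L.w L.encode env₆ = (s.take p).count x := by
    rw [Ex.eval_sub (hv _ 1 i (by simp [henv₆, f1]) (by omega))
      (G.eval_wd (hv _ 5 x (by simp [henv₆, f5]) (by omega)) (by norm_num) (by omega) (hst x) hstx)
      (by omega)]
    omega
  set env₇ := Function.update env₆ 1 ((s.take p).count x) with henv₇
  -- The root has parent pointer 0, so the continuation after the root is just the final test of the
  -- loop: no rounds and one step.
  obtain ⟨env₈, hrun', f8⟩ := h.runs_up T (fun env => env 1 = p) 1 s ptr 0 p x env₇ hT hs hp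
    (by simp [henv₇]) (by simp [henv₇, henv₆]) 0 (fun env' g1 g2 =>
      ⟨env', (Runs.while_false (r := 2) g2).mono (by omega), g1⟩)
  have e0 : (Ex.op .add (.v 1) (.c 1)).eval L.w L.encode env₈ = p + 1 :=
    Ex.eval_add (hv _ 1 _ f8 (by omega)) (c1 _) hpw
  have hall := Runs.seq (Runs.assign (w := L.w) (D := L.encode) 1 (.op .sub (.v 0) (.c 1)) env₀)
    (Runs.seq (Runs.assign 5 (.wd 8 (.op .div (.v 1) (.hd 11))) _)
      (Runs.seq (Runs.assign 6 (.wd 9 (.op .div (.v 1) (.hd 11))) _)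
        (Runs.seq (Runs.assign 3 (.op .lt (.op .add (.v 5) (.c 1)) (.v 6)) _)
          (by
            rw [e1, ← henv₁, e5, ← henv₂, e6, ← henv₃, e3, ← henv₄]
            exact Runs.seq hrun (Runs.seq (Runs.assign 2 (.wd 7 (.v 5)) _)
              (Runs.seq (Runs.assign 1 (.op .sub (.v 1) (.wd 6 (.v 5))) _) (by
                rw [e2, ← henv₆, e1', ← henv₇]
                exact Runs.seq hrun' (Runs.assign 0 (.op .add (.v 1) (.c 1)) _))))))))
  obtain ⟨t, ht, hc⟩ := hall.computes
  rw [Function.update_self, e0] at hc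
  refine ⟨t, ht.trans ?_, hc⟩
  have h1 : T.depth x * (stepBound + 1) ≤ T.depth x * queryBound :=
    Nat.mul_le_mul_left _ (by unfold queryBound; omega)
  have h2 : m * (searchBound + 1) ≤ m * queryBound :=
    Nat.mul_le_mul_left _ (by unfold queryBound; omega)
  rw [show queryBound * (1 + T.depth x + m) =
    queryBound + T.depth x * queryBound + m * queryBound by ring, add_zero]
  refine le_trans ?_ (Nat.add_le_add (Nat.add_le_add_left h1 _) h2)
  unfold queryBound
  omega

end Layout.Wavelet

end WordRAM

/-! ### Runs of a permutation, their entropy and the shape of the tree -/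

section runs
variable {n : ℕ} (π : Equiv.Perm (Fin n))

/-- The runs of a permutation as a composition. -/
def runs : Composition n where
  blocks := runLengths π
  blocks_pos := by
    intro i hi
    obtain ⟨l, hl, rfl⟩ := List.mem_map.1 hi
    exact List.length_pos_iff.2 (List.ne_nil_of_mem_splitBy hl)
  blocks_sum := by
    unfold runLengths
    rw [← List.length_flatten, List.flatten_splitBy, List.length_ofFn]

/-- The sequence that lists for each value the run in which it occurs. -/
def runSeq : List ℕ := List.ofFn fun v => ((runs π).index (π.symm v) : ℕ)

theorem length_runs : (runs π).length = numRuns π := rfl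

theorem numRuns_pos (hn : 1 ≤ n) : 0 < numRuns π := by
  rw [← length_runs]
  exact (runs π).length_pos_iff.2 hn

theorem numRuns_le : numRuns π ≤ n := (runs π).length_le

theorem lt_sizeUpTo_succ (i : Fin n) : (i : ℕ) < (runs π).sizeUpTo ((runs π).index i + 1) :=
  (runs π).lt_sizeUpTo_index_succ i

/-- The block of `splitBy` with number `j` is the slice of the one-line notation between two
consecutive partial sums of the lengths, and a chain for `<` is pairwise increasing. -/
theorem lt_of_index_eq {i i' : Fin n} (h : i < i') (hr : (runs π).index i = (runs π).index i') :
    π i < π i' := by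
  set G := (List.ofFn π).splitBy (fun a b => decide (a < b)) with hG
  set j := (runs π).index i with hj
  have hjG : (j : ℕ) < G.length := by
    have e : (runs π).length = G.length :=
      (runs π).blocks_length.symm.trans (List.length_map List.length)
    exact j.2.trans_eq e
  have hblock := List.drop_take_succ_flatten_eq_getElem G j hjG
  have hflat : G.flatten = List.ofFn π := List.flatten_splitBy _ _
  rw [hflat] at hblock
  have hsz : ∀ q, ((G.map List.length).take q).sum = (runs π).sizeUpTo q := fun _ => rfl
  rw [hsz, hsz] at hblock
  have hchain : (G[(j : ℕ)]).Pairwise (· < ·) := by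
    have : (G[(j : ℕ)]).IsChain fun x y => decide (x < y) = true :=
      List.isChain_of_mem_splitBy (List.getElem_mem hjG)
    simp only [decide_eq_true_eq] at this
    exact this.pairwise
  rw [← hblock] at hchain
  have h1 := (runs π).sizeUpTo_index_le i
  have h2 := lt_sizeUpTo_succ π i'
  rw [← hr] at h2
  rw [← hj] at h1
  have h2' : (i' : ℕ) < (runs π).sizeUpTo (j + 1) := h2
  have h3 : (i : ℕ) < i' := h
  have hlen : (((List.ofFn π).take ((runs π).sizeUpTo (j + 1))).drop
      ((runs π).sizeUpTo j)).length = (runs π).sizeUpTo (j + 1) - (runs π).sizeUpTo j := by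
    simp only [List.length_drop, List.length_take, List.length_ofFn]
    have := (runs π).sizeUpTo_le (j + 1)
    omega
  have := List.pairwise_iff_getElem.1 hchain (i - (runs π).sizeUpTo j) (i' - (runs π).sizeUpTo j)
    (by omega) (by omega) (by omega)
  simp only [List.getElem_drop, List.getElem_take, List.getElem_ofFn] at this
  have e1 : (runs π).sizeUpTo j + (i - (runs π).sizeUpTo j) = i := by omega
  have e2 : (runs π).sizeUpTo j + (i' - (runs π).sizeUpTo j) = i' := by omega
  simpa only [e1, e2] using this

theorem index_eq_of_mem {i : Fin n} {j : Fin (runs π).length} (h1 : (runs π).sizeUpTo j ≤ i)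
    (h2 : (i : ℕ) < (runs π).sizeUpTo (j + 1)) : (runs π).index i = j := by
  have h3 := (runs π).sizeUpTo_index_le i
  have h4 := lt_sizeUpTo_succ π i
  rcases lt_trichotomy ((runs π).index i) j with h | h | h
  · have := (runs π).monotone_sizeUpTo (show ((runs π).index i : ℕ) + 1 ≤ j from h)
    omega
  · exact h
  · have := (runs π).monotone_sizeUpTo (show (j : ℕ) + 1 ≤ (runs π).index i from h)
    omega

theorem index_mono : Monotone (runs π).index := by
  intro i i' h
  by_contra! hlt
  have h3 := (runs π).sizeUpTo_index_le i
  have h4 := lt_sizeUpTo_succ π i'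
  have := (runs π).monotone_sizeUpTo (show ((runs π).index i' : ℕ) + 1 ≤ (runs π).index i from hlt)
  have h : (i : ℕ) ≤ i' := h
  omega

theorem getElem?_runSeq (v : Fin n) :
    (runSeq π)[(v : ℕ)]? = some ((runs π).index (π.symm v) : ℕ) := by
  unfold runSeq
  rw [List.getElem?_eq_getElem (by simp)]
  simp

theorem List.count_take_eq_card (s : List ℕ) (x p : ℕ) :
    (s.take p).count x = ((Finset.range p).filter fun q => s[q]? = some x).card := by
  induction p with
  | zero => simp
  | succ p ih =>
    rw [List.take_add_one, List.count_append, ih, Finset.range_add_one, Finset.filter_insert]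
    rcases h : s[p]? with _ | y
    · simp
    · by_cases hy : y = x
      · simp [hy]
      · simp [hy]

theorem count_take_runSeq (i : Fin n) :
    ((runSeq π).take (π i)).count ((runs π).index i : ℕ) = i - (runs π).sizeUpTo ((runs π).index i) := by
  rw [List.count_take_eq_card, ← Nat.card_Ico]
  symm
  have hi := lt_sizeUpTo_succ π i
  -- The permutation itself maps the earlier positions of the run bijectively onto the smaller
  -- values listed with that run; the default 0 is never reached.
  apply Finset.card_nbij' (fun q => if h : q < n then (π ⟨q, h⟩ : ℕ) else 0)
    (fun v => if h : v < n then (π.symm ⟨v, h⟩ : ℕ) else 0)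
  · intro q hq
    rw [Finset.mem_coe, Finset.mem_Ico] at hq
    have hqn : q < n := hq.2.trans i.2
    simp only [hqn, dif_pos, Finset.coe_filter, Finset.mem_range, Set.mem_ofPred_eq]
    have hidx : (runs π).index ⟨q, hqn⟩ = (runs π).index i :=
      index_eq_of_mem π hq.1 (hq.2.trans hi)
    refine ⟨lt_of_index_eq π (i := ⟨q, hqn⟩) (i' := i) hq.2 hidx, ?_⟩
    rw [getElem?_runSeq, Equiv.symm_apply_apply, hidx]
  · intro v hv
    simp only [Finset.coe_filter, Finset.mem_range, Set.mem_ofPred_eq] at hv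
    have hvn : v < n := hv.1.trans (π i).2
    have h2 := hv.2
    rw [getElem?_runSeq π ⟨v, hvn⟩, Option.some_inj] at h2
    have h3 : (runs π).index (π.symm ⟨v, hvn⟩) = (runs π).index i := Fin.ext h2
    simp only [hvn, dif_pos, Finset.coe_Ico, Set.mem_Ico]
    constructor
    · rw [← h3]
      exact (runs π).sizeUpTo_index_le _
    · by_contra! hle
      rcases hle.lt_or_eq with hlt | heq
      · have := lt_of_index_eq π (i := i) (i' := π.symm ⟨v, hvn⟩) hlt h3.symm
        rw [Equiv.apply_symm_apply] at this
        have : (π i : ℕ) < v := this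
        omega
      · have : i = π.symm ⟨v, hvn⟩ := Fin.ext heq
        rw [this, Equiv.apply_symm_apply] at hv
        simp at hv
  · intro q hq
    rw [Finset.mem_coe, Finset.mem_Ico] at hq
    have hqn : q < n := hq.2.trans i.2
    simp [hqn]
  · intro v hv
    simp only [Finset.coe_filter, Finset.mem_range, Set.mem_ofPred_eq] at hv
    have hvn : v < n := hv.1.trans (π i).2
    simp [hvn]

theorem sum_index (f : Fin (runs π).length → ℝ) :
    ∑ i : Fin n, f ((runs π).index i) = ∑ j, (runs π).blocksFun j * f j := by
  rw [← (runs π).sum_sum_apply_embedding]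
  simp [Composition.index_embedding]

/-- Summed over positions instead of runs, each run contributes equal terms as often as it is long.
In this form the entropy can be compared with a sum of leaf depths. -/
theorem entropy_runLengths :
    entropy (runLengths π) * n =
      ∑ i : Fin n, Real.logb 2 (n / (runs π).blocksFun ((runs π).index i)) := by
  rcases Nat.eq_zero_or_pos n with rfl | hn
  · simp
  have hn' : (n : ℝ) ≠ 0 := by positivity
  rw [sum_index π fun j => Real.logb 2 (n / (runs π).blocksFun j)]
  have hs : (runLengths π).sum = n := (runs π).blocks_sum
  have hb : runLengths π = List.ofFn (runs π).blocksFun := (runs π).ofFn_blocksFun.symm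
  unfold entropy
  rw [hs, hb, List.map_ofFn, List.sum_ofFn, Finset.sum_mul]
  apply Finset.sum_congr rfl
  intro j _
  simp only [Function.comp]
  field_simp

theorem blocksFun_pos (j : Fin (runs π).length) : (0 : ℝ) < (runs π).blocksFun j := by
  have := (runs π).one_le_blocksFun j
  positivity

theorem logb_blocksFun_nonneg (j : Fin (runs π).length) :
    0 ≤ Real.logb 2 (n / (runs π).blocksFun j) := by
  apply Real.logb_nonneg (by norm_num)
  rw [le_div_iff₀ (blocksFun_pos π j), one_mul]
  exact_mod_cast (runs π).blocksFun_le j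

theorem entropy_nonneg (hn : 1 ≤ n) : 0 ≤ entropy (runLengths π) := by
  have h : 0 ≤ entropy (runLengths π) * n := by
    rw [entropy_runLengths]
    exact Finset.sum_nonneg fun i _ => logb_blocksFun_nonneg π _
  exact nonneg_of_mul_nonneg_left h (by positivity)

theorem half_pow_ceil_le {x : ℝ} (hx : 1 ≤ x) : (1 / 2 : ℝ) ^ ⌈Real.logb 2 x⌉₊ ≤ 1 / x := by
  rw [one_div_pow]
  apply one_div_le_one_div_of_le (by positivity)
  calc x = (2 : ℝ) ^ Real.logb 2 x := (Real.rpow_logb (by norm_num) (by norm_num) (by positivity)).symm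
    _ ≤ (2 : ℝ) ^ (⌈Real.logb 2 x⌉₊ : ℝ) :=
      Real.rpow_le_rpow_of_exponent_le (by norm_num) (Nat.le_ceil _)
    _ = 2 ^ ⌈Real.logb 2 x⌉₊ := Real.rpow_natCast _ _

theorem exists_mergeTree (hn : 1 ≤ n) : ∃ T : MergeTree, T.leaves = Multiset.range (numRuns π) ∧
    ∀ j : Fin (runs π).length, (T.depth j : ℝ) ≤ Real.logb 2 (numRuns π) + 2 ∧
      (T.depth j : ℝ) ≤ Real.logb 2 (n / (runs π).blocksFun j) + 2 := by
  have hρ := numRuns_pos π hn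
  have hρ1 : (1 : ℝ) ≤ numRuns π := by exact_mod_cast hρ
  set a : ℕ → ℕ := fun j => if h : j < (runs π).length then
    ⌈Real.logb 2 (n / (runs π).blocksFun ⟨j, h⟩)⌉₊ else 0 with ha
  set b := ⌈Real.logb 2 (numRuns π)⌉₊ with hb
  obtain ⟨T, hT, hd⟩ := MergeTree.exists_depth_le hρ (fun j => min (a j) b + 1) (by
    have key : ∑ j ∈ Finset.range (numRuns π), (1 / 2 : ℝ) ^ (min (a j) b + 1) ≤ 1 := by
      rw [Finset.sum_range]
      -- The power of the minimum is one of the two powers and hence at most their sum; the extra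
      -- level pays for the factor 1/2.
      have h1 : ∀ j : Fin (numRuns π), (1 / 2 : ℝ) ^ (min (a j) b + 1) ≤
          (1 / 2) * ((runs π).blocksFun j / n + 1 / numRuns π) := by
        intro j
        have hj : (j : ℕ) < (runs π).length := j.2
        have ea : (1 / 2 : ℝ) ^ a j ≤ (runs π).blocksFun j / n := by
          simp only [ha, hj, dif_pos]
          refine (half_pow_ceil_le ?_).trans (one_div_div _ _).le
          rw [le_div_iff₀ (blocksFun_pos π _), one_mul]
          exact_mod_cast (runs π).blocksFun_le _
        have eb : (1 / 2 : ℝ) ^ b ≤ 1 / numRuns π := half_pow_ceil_le hρ1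
        have e3 : (0 : ℝ) ≤ (runs π).blocksFun j / n := by positivity
        have e4 : (0 : ℝ) ≤ 1 / numRuns π := by positivity
        rw [pow_succ, mul_comm]
        apply mul_le_mul_of_nonneg_left _ (by norm_num)
        rcases min_choice (a j) b with h | h <;> rw [h] <;> linarith
      refine (Finset.sum_le_sum fun j _ => h1 j).trans ?_
      rw [← Finset.mul_sum, Finset.sum_add_distrib, ← Finset.sum_div]
      have h2 : ∑ j : Fin (numRuns π), ((runs π).blocksFun j : ℝ) = n :=
        (Nat.cast_sum _ _).symm.trans (congrArg Nat.cast (runs π).sum_blocksFun)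
      rw [h2, Finset.sum_const, Finset.card_univ, Fintype.card_fin, nsmul_eq_mul,
        mul_one_div_cancel (by positivity), div_self (by positivity)]
      norm_num
    have := key
    rw [← Rat.cast_le (K := ℝ)]
    push_cast
    exact this)
  refine ⟨T, hT, fun j => ?_⟩
  have h1 : (T.depth j : ℝ) ≤ (min (a j) b + 1 : ℕ) := by exact_mod_cast hd j j.2
  have h2 : ((min (a j) b : ℕ) : ℝ) ≤ a j := by exact_mod_cast min_le_left _ _
  have h3 : ((min (a j) b : ℕ) : ℝ) ≤ b := by exact_mod_cast min_le_right _ _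
  have h4 : (b : ℝ) < Real.logb 2 (numRuns π) + 1 :=
    Nat.ceil_lt_add_one (Real.logb_nonneg (by norm_num) hρ1)
  have h5 : (a j : ℝ) < Real.logb 2 (n / (runs π).blocksFun j) + 1 := by
    have hj : (j : ℕ) < (runs π).length := j.2
    simp only [ha, hj, dif_pos]
    exact Nat.ceil_lt_add_one (logb_blocksFun_nonneg π _)
  rw [Nat.cast_add, Nat.cast_one] at h1
  constructor <;> linarith

/-- The run of a position; positions beyond the end belong to the last run. -/
def runAt (x : ℕ) : ℕ := if h : x < n then (runs π).index ⟨x, h⟩ else numRuns π - 1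

theorem runAt_eq (i : Fin n) : runAt π i = (runs π).index i := by simp [runAt]

theorem runAt_lt (hn : 1 ≤ n) (x : ℕ) : runAt π x < numRuns π := by
  unfold runAt
  split_ifs with h
  · exact Fin.is_lt _
  · have := numRuns_pos π hn
    omega

theorem runAt_mono : Monotone (runAt π) := by
  intro x y hxy
  unfold runAt
  split_ifs with h1 h2 h2
  · exact index_mono π hxy
  · have : ((runs π).index ⟨x, h1⟩ : ℕ) < numRuns π := ((runs π).index ⟨x, h1⟩).2
    omega
  · omega
  · exact le_rfl

end runs

/-- Each of the two shifted sums differs from the unshifted one by at most `d` boundary terms, each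
at most `c`. -/
theorem sum_sub_le_of_monotone {R : ℕ → ℕ} (hR : Monotone R) {c : ℕ} (hc : ∀ x, R x ≤ c) (n d : ℕ) :
    ∑ i ∈ Finset.range n, (R (i + d) - R (i - d)) ≤ 2 * d * c := by
  have h1 : ∑ i ∈ Finset.range n, R (i + d) ≤ ∑ i ∈ Finset.range n, R i + d * c := by
    have e := Finset.sum_range_add R d n
    rw [add_comm d n, Finset.sum_range_add R n d] at e
    have : ∑ x ∈ Finset.range d, R (n + x) ≤ d * c := by
      simpa using Finset.sum_le_card_nsmul (Finset.range d) _ c fun x _ => hc (n + x)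
    simp only [add_comm d] at e
    omega
  have h2 : ∑ i ∈ Finset.range n, R i ≤ ∑ i ∈ Finset.range n, R (i - d) + d * c := by
    have e := Finset.sum_range_add (fun i => R (i - d)) d n
    rw [add_comm d n, Finset.sum_range_add (fun i => R (i - d)) n d] at e
    have : ∑ x ∈ Finset.range d, R (n + x - d) ≤ d * c := by
      simpa using Finset.sum_le_card_nsmul (Finset.range d) _ c fun x _ => hc (n + x - d)
    simp only [Nat.add_sub_cancel_left] at e
    omega
  have h3 : ∑ i ∈ Finset.range n, (R (i + d) - R (i - d)) + ∑ i ∈ Finset.range n, R (i - d) =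
      ∑ i ∈ Finset.range n, R (i + d) := by
    rw [← Finset.sum_add_distrib]
    exact Finset.sum_congr rfl fun i _ => Nat.sub_add_cancel (hR (by omega))
  have : 2 * d * c = d * c + d * c := by ring
  omega

/-! ### Sizes of the sampling parameters -/

/-- The number of binary digits of a positive number. -/
def bitLen (n : ℕ) : ℕ := Nat.log 2 n + 1

theorem bitLen_pos (n : ℕ) : 0 < bitLen n := Nat.succ_pos _

theorem lt_two_pow_bitLen (n : ℕ) : n < 2 ^ bitLen n := Nat.lt_pow_succ_log_self (by norm_num) n

theorem two_pow_bitLen_le {n : ℕ} (hn : 1 ≤ n) : 2 ^ bitLen n ≤ 2 * n := by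
  rw [bitLen, pow_succ, mul_comm]
  exact Nat.mul_le_mul_left _ (Nat.pow_log_le_self 2 (by omega))

theorem bitLen_le {n : ℕ} (hn : 1 ≤ n) : bitLen n ≤ n := Nat.log_lt_self 2 (by omega)

/-- The number of bits handled by one table lookup, for the parameter `k`. -/
def chunk (k : ℕ) : ℕ := k ^ 2 * (k ^ 2 + 1)

/-- With `k` the number of digits of l, the factor 4 makes a window at most l/2 bits long, so that
only O(√n) windows are tabulated. -/
theorem chunk_mul_four_le {k : ℕ} (hk : 20 ≤ k) : 4 * chunk k ≤ 2 ^ k := by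
  induction k, hk using Nat.le_induction with
  | base => norm_num [chunk]
  | succ k hk ih =>
    have h : chunk (k + 1) ≤ 2 * chunk k := by
      obtain ⟨d, rfl⟩ := Nat.exists_eq_add_of_le hk
      unfold chunk
      ring_nf
      nlinarith [Nat.zero_le (d ^ 2), Nat.zero_le (d ^ 3), Nat.zero_le (d ^ 4)]
    rw [pow_succ]
    omega

/-- The constant has to cover small `k`: the quotient is largest at k = 6, where it is 1332/64. It
makes a window fit into a word for every n. -/
theorem chunk_le_mul_two_pow (k : ℕ) : chunk k ≤ 21 * 2 ^ k := by
  rcases Nat.lt_or_ge k 20 with hk | hk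
  · interval_cases k <;> norm_num [chunk]
  · have := chunk_mul_four_le hk
    omega

theorem chunk_bitLen_le {l : ℕ} (hl : 1 ≤ l) : chunk (bitLen l) ≤ 42 * l := by
  have h1 := chunk_le_mul_two_pow (bitLen l)
  have h2 := two_pow_bitLen_le hl
  omega

/-! ### The concrete data structure and its word length -/

namespace WordRAM

/-- The parameters and the bit vector of the data structure for `n` elements and `ρ` runs; the arrays
are still empty. -/
def baseLayout (n ρ : ℕ) (B : List Bool) : Layout where
  w := wordLength 200 n
  f := 8 * bitLen (bitLen n)
  g := bitLen (bitLen n) ^ 2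
  u := bitLen n ^ 2
  words := 34 + ρ + B.length / bitLen n ^ 2 + bitLen (bitLen n) ^ 2 * bitLen n ^ 2 +
    2 ^ chunk (bitLen (bitLen n)) * chunk (bitLen (bitLen n))
  fields := B.length / bitLen (bitLen n) ^ 2 + bitLen (bitLen n) ^ 2 + 2
  N := B.length
  val := fun _ _ => 0
  fval := fun _ _ => 0
  B := fun i => B.getD i false

/-- The data that is stored in addition to the bit vector and its directories. -/
structure Content where
  nodes : ℕ → MergeTree.Rec
  root : ℕ
  start : ℕ → ℕ
  leafParent : ℕ → ℕ
  width : ℕ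
  lo : ℕ → ℕ
  hi : ℕ → ℕ

/-- The parameters in the header. -/
def header (L : Layout) (X : Content) : ℕ → ℕ
  | 0 => L.w
  | 1 => L.f
  | 2 => L.baseF
  | 3 => L.baseB
  | 4 => L.t
  | 5 => L.t * L.u
  | 6 => L.g * L.u
  | 7 => L.g
  | 8 => L.u
  | 9 => L.u * (L.g * L.u + 1)
  | 10 => X.root
  | 11 => X.width
  | _ => 0

/-- The arrays of words. -/
noncomputable def wordArrays (L : Layout) (X : Content) : ℕ → ℕ → ℕ
  | 0 => header L X
  | 1 => fun k => (X.nodes k).off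
  | 2 => fun k => (X.nodes k).ones
  | 3 => fun k => (X.nodes k).child false
  | 4 => fun k => (X.nodes k).child true
  | 5 => fun k => (X.nodes k).parent
  | 6 => X.start
  | 7 => X.leafParent
  | 8 => X.lo
  | 9 => X.hi
  | 10 => fun j => L.rank true (j * (L.t * L.u))
  | 11 => fun j => L.sel false (j * (L.g * L.u))
  | 12 => fun j => L.sel true (j * (L.g * L.u))
  | 13 => L.explicitPos false (L.g * L.u) L.u
  | 14 => L.explicitPos true (L.g * L.u) L.u
  | 15 => fun x => Nat.count (fun i => x.testBit i = true) L.t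
  | 16 => fun x => Nat.nth (fun i => (x / L.t).testBit i = false) (x % L.t)
  | 17 => fun x => Nat.nth (fun i => (x / L.t).testBit i = true) (x % L.t)
  | _ => fun _ => 0

/-- The arrays of fields. -/
noncomputable def fieldArrays (L : Layout) : ℕ → ℕ → ℕ
  | 0 => fun j => L.rank true (j * L.t) - L.rank true (j / L.u * (L.t * L.u))
  | 1 => fun j => L.sel false (j * L.g) - L.sel false (j / L.u * (L.g * L.u))
  | 2 => fun j => L.sel true (j * L.g) - L.sel true (j / L.u * (L.g * L.u))
  | 3 => L.explicitPos false L.g L.g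
  | 4 => L.explicitPos true L.g L.g
  | _ => fun _ => 0

/-- The layout with all arrays. -/
noncomputable def fullLayout (n ρ : ℕ) (B : List Bool) (X : Content) : Layout :=
  { baseLayout n ρ B with
    val := wordArrays (baseLayout n ρ B) X
    fval := fieldArrays (baseLayout n ρ B) }

theorem two_pow_mul_self_le (t : ℕ) : 2 ^ t * t ≤ 2 ^ (2 * t) := by
  rw [two_mul, pow_add]
  exact Nat.mul_le_mul_left _ Nat.lt_two_pow_self.le

section
variable {n ρ : ℕ} {B : List Bool} {X : Content}

/-- All sizes are measured in powers of x = 2^l. The table of at most 2^(2t) entries with t ≤ 42 l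
gives x^84, and six more factors absorb the other terms. -/
theorem size_bounds (hn : 1 ≤ n) (hρ : ρ ≤ n) (hB : B.length ≤ n * (bitLen n + 2)) :
    (baseLayout n ρ B).words ≤ 2 ^ (90 * bitLen n) ∧
    (baseLayout n ρ B).fields ≤ 2 ^ (90 * bitLen n) ∧
    (baseLayout n ρ B).N ≤ 2 ^ (90 * bitLen n) ∧
    (baseLayout n ρ B).g * (baseLayout n ρ B).u ≤ 2 ^ (90 * bitLen n) ∧
    (baseLayout n ρ B).w ≤ 2 ^ (90 * bitLen n) ∧
    (baseLayout n ρ B).f ≤ 2 ^ (90 * bitLen n) := by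
  have hl := bitLen_pos n
  have hk : bitLen (bitLen n) ≤ bitLen n := bitLen_le hl
  have hnl := lt_two_pow_bitLen n
  have hc := chunk_bitLen_le hl
  simp only [baseLayout, wordLength]
  rw [show Nat.log 2 n + 1 = bitLen n from rfl]
  set l := bitLen n
  set k := bitLen l
  have hl2 : l < 2 ^ l := Nat.lt_two_pow_self
  have hx : 2 ≤ 2 ^ l := by
    calc 2 = 2 ^ 1 := rfl
      _ ≤ 2 ^ l := Nat.pow_le_pow_right (by norm_num) hl
  have hp : ∀ a : ℕ, 2 ^ (a * l) = (2 ^ l) ^ a := fun a => by rw [mul_comm, pow_mul]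
  have hmono : ∀ a b : ℕ, a ≤ b → (2 ^ l) ^ a ≤ (2 ^ l) ^ b := fun a b h =>
    Nat.pow_le_pow_right (by positivity) h
  have hchunk : 2 ^ chunk k * chunk k ≤ (2 ^ l) ^ 84 := by
    refine (two_pow_mul_self_le _).trans ?_
    rw [← hp]
    exact Nat.pow_le_pow_right (by norm_num) (by omega)
  rw [hp]
  set x := 2 ^ l
  have hB' : B.length ≤ x ^ 4 := by
    calc B.length ≤ n * (l + 2) := hB
      _ ≤ x * (x * x) := Nat.mul_le_mul hnl.le (by nlinarith)
      _ = x ^ 3 := by ring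
      _ ≤ x ^ 4 := hmono _ _ (by norm_num)
  have hgu : k ^ 2 * l ^ 2 ≤ x ^ 4 := by
    calc k ^ 2 * l ^ 2 ≤ x ^ 2 * x ^ 2 :=
          Nat.mul_le_mul (Nat.pow_le_pow_left (by omega) _) (Nat.pow_le_pow_left hl2.le _)
      _ = x ^ 4 := by ring
  have h84 : x ^ 4 ≤ x ^ 84 := hmono _ _ (by norm_num)
  have h90 : x ^ 84 * 64 ≤ x ^ 90 := by
    rw [show x ^ 90 = x ^ 84 * x ^ 6 by ring]
    exact Nat.mul_le_mul_left _ (by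
      calc 64 = 2 ^ 6 := by norm_num
        _ ≤ x ^ 6 := Nat.pow_le_pow_left hx _)
  have h1 : x ≤ x ^ 84 := by
    calc x = x ^ 1 := (pow_one x).symm
      _ ≤ x ^ 84 := hmono _ _ (by norm_num)
  have hd1 := Nat.div_le_self B.length (l ^ 2)
  have hd2 := Nat.div_le_self B.length (k ^ 2)
  have hk2 : k ^ 2 ≤ x ^ 4 := by
    calc k ^ 2 ≤ x ^ 2 := Nat.pow_le_pow_left (by omega) _
      _ ≤ x ^ 4 := hmono _ _ (by norm_num)
  have h2 : 16 ≤ x ^ 4 := by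
    calc 16 = 2 ^ 4 := by norm_num
      _ ≤ x ^ 4 := Nat.pow_le_pow_left hx _
  have h5 : 200 * l ≤ x ^ 90 := by
    calc 200 * l ≤ x ^ 8 * x := Nat.mul_le_mul (by
          calc 200 ≤ 2 ^ 8 := by norm_num
            _ ≤ x ^ 8 := Nat.pow_le_pow_left hx _) hl2.le
      _ = x ^ 9 := by ring
      _ ≤ x ^ 90 := hmono _ _ (by norm_num)
  refine ⟨?_, ?_, ?_, ?_, h5, ?_⟩ <;> omega

/-- An address is dominated by a product of two quantities of at most 2^(90 l); the remaining 2^(20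
l) of the word range covers the constants. -/
theorem size_lt (hn : 1 ≤ n) (hρ : ρ ≤ n) (hB : B.length ≤ n * (bitLen n + 2)) :
    (baseLayout n ρ B).baseB + 2 * (baseLayout n ρ B).N + 20 * (baseLayout n ρ B).words +
      8 * (baseLayout n ρ B).fields + (baseLayout n ρ B).g * (baseLayout n ρ B).u + 20 <
      2 ^ (baseLayout n ρ B).w := by
  obtain ⟨h1, h2, h3, h4, h5, h6⟩ := size_bounds hn hρ hB
  have hw : (baseLayout n ρ B).w = 200 * bitLen n := rfl
  rw [Layout.baseB, Layout.baseF]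
  have hl := bitLen_pos n
  have hX : 2 ^ (200 * bitLen n) = 2 ^ (90 * bitLen n) * 2 ^ (90 * bitLen n) *
      2 ^ (20 * bitLen n) := by
    rw [← pow_add, ← pow_add]
    congr 1
    ring
  have hY : 2 ^ 20 ≤ 2 ^ (20 * bitLen n) := Nat.pow_le_pow_right (by norm_num) (by omega)
  have hX1 : 1 ≤ 2 ^ (90 * bitLen n) := Nat.one_le_two_pow
  rw [hw] at h5
  rw [hw, hX]
  set Y := 2 ^ (20 * bitLen n)
  set x := 2 ^ (90 * bitLen n)
  have e1 : 20 * (baseLayout n ρ B).words * (200 * bitLen n) ≤ 20 * (x * x) := by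
    rw [mul_assoc]
    exact Nat.mul_le_mul_left _ (Nat.mul_le_mul h1 h5)
  have e2 : 8 * (baseLayout n ρ B).fields * (baseLayout n ρ B).f ≤ 8 * (x * x) := by
    rw [mul_assoc]
    exact Nat.mul_le_mul_left _ (Nat.mul_le_mul h2 h6)
  have e3 : x ≤ x * x := Nat.le_mul_of_pos_left _ hX1
  have e4 : x * x * 2 ^ 20 ≤ x * x * Y := Nat.mul_le_mul_left _ hY
  omega

theorem good_fullLayout (hn : 1 ≤ n) (hρ : ρ ≤ n) (hB : B.length ≤ n * (bitLen n + 2)) :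
    (fullLayout n ρ B X).Good := by
  have hl := bitLen_pos n
  have hk := bitLen_pos (bitLen n)
  have hkl : bitLen (bitLen n) ≤ bitLen n := bitLen_le hl
  have hc := chunk_bitLen_le hl
  have hlk := lt_two_pow_bitLen (bitLen n)
  have hf : 2 * bitLen n ^ 6 ≤ 2 ^ (8 * bitLen (bitLen n)) := by
    calc 2 * bitLen n ^ 6 ≤ 2 ^ bitLen (bitLen n) * (2 ^ bitLen (bitLen n)) ^ 6 := by
          apply Nat.mul_le_mul _ (Nat.pow_le_pow_left hlk.le _)
          calc 2 = 2 ^ 1 := rfl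
            _ ≤ _ := Nat.pow_le_pow_right (by norm_num) hk
      _ = 2 ^ (7 * bitLen (bitLen n)) := by rw [← pow_mul, ← pow_add]; congr 1; ring
      _ ≤ _ := Nat.pow_le_pow_right (by norm_num) (by omega)
  have hf' : bitLen (bitLen n) ^ 2 * bitLen n ^ 2 + 1 ≤ 2 * bitLen n ^ 4 := by
    have h1 : bitLen (bitLen n) ^ 2 * bitLen n ^ 2 ≤ bitLen n ^ 2 * bitLen n ^ 2 :=
      Nat.mul_le_mul_right _ (Nat.pow_le_pow_left hkl _)
    have h2 : 1 ≤ bitLen n ^ 4 := Nat.one_le_pow _ _ hl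
    have h3 : bitLen n ^ 2 * bitLen n ^ 2 = bitLen n ^ 4 := by ring
    omega
  have hfA : bitLen n ^ 2 * (bitLen (bitLen n) ^ 2 * bitLen n ^ 2 + 1) ≤
      2 ^ (8 * bitLen (bitLen n)) := by
    refine (Nat.mul_le_mul_left _ hf').trans (le_trans (le_of_eq ?_) hf)
    ring
  have hfB : bitLen (bitLen n) ^ 2 * (bitLen (bitLen n) ^ 2 + 1) * bitLen n ^ 2 ≤
      2 ^ (8 * bitLen (bitLen n)) := by
    have h1 : bitLen (bitLen n) ^ 2 ≤ bitLen n ^ 2 := Nat.pow_le_pow_left hkl _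
    have h2 : 1 ≤ bitLen n ^ 2 := Nat.one_le_pow _ _ hl
    refine le_trans (Nat.mul_le_mul_right _ (Nat.mul_le_mul h1 (show _ ≤ 2 * bitLen n ^ 2 by
      omega))) (le_trans (le_of_eq ?_) hf)
    ring
  exact
    { hg := Nat.pow_pos hk
      hu := Nat.pow_pos hl
      hw := by
        change 200 ≤ 200 * bitLen n
        omega
      hfw := by
        change 8 * bitLen (bitLen n) < 200 * bitLen n
        omega
      htw := by
        change chunk (bitLen (bitLen n)) < 200 * bitLen n
        omega
      hf₁ := hfA
      hf₂ := hfB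
      hwords := by
        have h : ∀ r a b c : ℕ, 32 ≤ 34 + r + a + b + c := by omega
        exact h _ _ _ _
      hwords₁ := by
        have h : ∀ r a b c : ℕ, a + b + 1 < 34 + r + a + b + c := by omega
        exact h _ _ _ _
      hwords₂ := by
        exact Nat.le_add_left _ _
      hfields := by
        exact Nat.lt_succ_self _
      hsize := size_lt hn hρ hB
      h₀ := rfl
      h₁ := rfl
      h₂ := rfl
      h₃ := rfl
      h₄ := rfl
      h₅ := rfl
      h₆ := rfl
      h₇ := rfl
      h₈ := rfl
      h₉ := rfl
      -- Rank and select depend only on the bit vector and its length, which the empty layout shares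
      -- with the full one; so the directories computed from the former are right for the latter.
      rank₁ := fun _ => rfl
      rank₂ := fun _ => rfl
      sel₁ := fun β _ => by cases β <;> rfl
      exp₁ := fun β _ => by cases β <;> rfl
      sel₂ := fun β _ => by cases β <;> rfl
      exp₂ := fun β _ => by cases β <;> rfl
      table := fun _ => rfl
      seltable := fun β _ => by cases β <;> rfl }

theorem wavelet_fullLayout (hn : 1 ≤ n) (hρ : ρ ≤ n) (hB : B.length ≤ n * (bitLen n + 2))
    {K : ℕ} (hK : K ≤ ρ)
    (hchild : ∀ β, ∀ k < K, (X.nodes k).child β < 2 ^ wordLength 200 n)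
    (hparent : ∀ k < K, (X.nodes k).parent < 2 ^ wordLength 200 n) :
    (fullLayout n ρ B X).Wavelet B X.nodes X.leafParent K where
  good := good_fullLayout hn hρ hB
  hN := rfl
  hB := fun _ => rfl
  hK := by
    have h : ∀ a b c : ℕ, K < 34 + ρ + a + b + c := by omega
    exact h _ _ _
  off := fun _ => rfl
  ones := fun _ => rfl
  child := fun β _ => by cases β <;> rfl
  parent := fun _ => rfl
  leafParent := fun _ => rfl
  child_lt := hchild
  parent_lt := hparent

end

end WordRAM

/-! ### Bounds on the stored pointers -/

namespace MergeTree

theorem ptr_le {ρ : ℕ} (T : MergeTree) (h : ∀ j ∈ T.leaves, j < ρ) (base : ℕ) :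
    T.ptr base ≤ 2 * (base + ρ) := by
  cases T with
  | leaf j =>
    have := h j (by simp [leaves])
    simp only [ptr]
    omega
  | node l r =>
    simp only [ptr]
    omega

theorem recs_le {ρ M : ℕ} (T : MergeTree) : ∀ (s : List ℕ) (base off ones pp : ℕ),
    (∀ j ∈ T.leaves, j < ρ) → pp ≤ M → 2 * (base + T.size + ρ) + 2 ≤ M →
    ∀ q ∈ T.recs s base off ones pp, q.parent ≤ M ∧ ∀ β, q.child β ≤ M := by
  induction T with
  | leaf j => intro s base off ones pp _ _ _ q hq; simp [recs] at hq
  | node l r hl hr =>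
    intro s base off ones pp hρ hpp hM q hq
    simp only [leaves, Multiset.mem_add] at hρ
    simp only [size] at hM
    simp only [recs, List.mem_cons, List.mem_append] at hq
    have h1 := l.ptr_le (fun j hj => hρ j (Or.inl hj)) (base + 1)
    have h2 := r.ptr_le (fun j hj => hρ j (Or.inr hj)) (base + 1 + l.size)
    rcases hq with rfl | hq | hq
    · refine ⟨hpp, fun β => ?_⟩
      cases β
      · simp only [Bool.false_eq_true, if_false]
        omega
      · simp only [if_true]
        omega
    · exact hl _ _ _ _ _ (fun j hj => hρ j (Or.inl hj)) (by omega) (by omega) q hq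
    · exact hr _ _ _ _ _ (fun j hj => hρ j (Or.inr hj)) (by omega) (by omega) q hq

theorem leafParent_le {M : ℕ} (T : MergeTree) (j : ℕ) : ∀ (base pp : ℕ), pp ≤ M →
    2 * (base + T.size) + 1 ≤ M → T.leafParent base pp j ≤ M := by
  induction T with
  | leaf i => intro base pp hpp _; exact hpp
  | node l r hl hr =>
    intro base pp hpp hM
    simp only [size] at hM
    simp only [leafParent]
    split_ifs
    · exact hr _ _ (by omega) (by omega)
    · exact hl _ _ (by omega) (by omega)

end MergeTree

/-! ### Space: the redundancy tends to zero -/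

/-- The number of bits of the data structure for `n` elements and `ρ` runs with a bit vector of `N`
bits. -/
def dataSize (n ρ N : ℕ) : ℕ :=
  20 * (34 + ρ + N / bitLen n ^ 2 + bitLen (bitLen n) ^ 2 * bitLen n ^ 2 +
    2 ^ chunk (bitLen (bitLen n)) * chunk (bitLen (bitLen n))) * (200 * bitLen n) +
  8 * (N / bitLen (bitLen n) ^ 2 + bitLen (bitLen n) ^ 2 + 2) * (8 * bitLen (bitLen n)) + N

/-- The part of the redundancy that depends neither on the runs nor on the bit vector. -/
noncomputable def fixedCost (n : ℕ) : ℝ :=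
  4000 * bitLen n * (34 + bitLen (bitLen n) ^ 2 * bitLen n ^ 2 +
    2 ^ chunk (bitLen (bitLen n)) * chunk (bitLen (bitLen n))) +
  64 * bitLen (bitLen n) * (bitLen (bitLen n) ^ 2 + 2)

/-- The relative redundancy. -/
noncomputable def redundancy (n : ℕ) : ℝ :=
  4000 / bitLen n + 64 / bitLen (bitLen n) + fixedCost n / n + if n = 1 then 4000 else 0

theorem bitLen_le_logb {n : ℕ} (hn : 2 ≤ n) : (bitLen n : ℝ) ≤ 2 * Real.logb 2 n := by
  have h1 : (Nat.log 2 n : ℝ) ≤ Real.logb 2 n := by exact_mod_cast Real.natLog_le_logb n 2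
  have h2 : 1 ≤ Real.logb 2 n := by
    rw [Real.le_logb_iff_rpow_le (by norm_num) (by positivity), Real.rpow_one]
    exact_mod_cast hn
  unfold bitLen
  push_cast
  linarith

theorem dataSize_le {n ρ N : ℕ} {h : ℝ} (hn : 1 ≤ n) (hρ : ρ ≤ n) (hh : 0 ≤ h)
    (hN : (N : ℝ) ≤ n * (2 + h)) :
    (dataSize n ρ N : ℝ) ≤ n * (2 + h) * (1 + redundancy n) + 8000 * (ρ * Real.logb 2 n) := by
  have hl : (0 : ℝ) < bitLen n := by exact_mod_cast bitLen_pos n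
  have hk : (0 : ℝ) < bitLen (bitLen n) := by exact_mod_cast bitLen_pos _
  have hn' : (1 : ℝ) ≤ n := by exact_mod_cast hn
  have hρ' : (0 : ℝ) ≤ ρ := by positivity
  have h1 : ((N / bitLen n ^ 2 : ℕ) : ℝ) ≤ N / (bitLen n : ℝ) ^ 2 := by
    exact_mod_cast Nat.cast_div_le
  have h2 : ((N / bitLen (bitLen n) ^ 2 : ℕ) : ℝ) ≤ N / (bitLen (bitLen n) : ℝ) ^ 2 := by
    exact_mod_cast Nat.cast_div_le
  have hfix : 0 ≤ fixedCost n := by unfold fixedCost; positivity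
  have e1 : (dataSize n ρ N : ℝ) ≤ N + N * (4000 / bitLen n) + N * (64 / bitLen (bitLen n)) +
      fixedCost n + 4000 * (ρ * bitLen n) := by
    have a1 := mul_le_mul_of_nonneg_left h1 (show (0 : ℝ) ≤ 4000 * bitLen n by positivity)
    have a2 := mul_le_mul_of_nonneg_left h2 (show (0 : ℝ) ≤ 64 * bitLen (bitLen n) by positivity)
    have b1 : 4000 * (bitLen n : ℝ) * (N / (bitLen n : ℝ) ^ 2) = N * (4000 / bitLen n) := by
      field_simp
    have b2 : 64 * (bitLen (bitLen n) : ℝ) * (N / (bitLen (bitLen n) : ℝ) ^ 2) =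
        N * (64 / bitLen (bitLen n)) := by
      field_simp
    rw [b1] at a1
    rw [b2] at a2
    unfold dataSize fixedCost
    simp only [Nat.cast_add, Nat.cast_mul, Nat.cast_pow, Nat.cast_ofNat]
    linarith
  have e2 : 4000 * ((ρ : ℝ) * bitLen n) ≤ 8000 * (ρ * Real.logb 2 n) +
      n * (2 + h) * (if n = 1 then 4000 else 0) := by
    rcases Nat.lt_or_ge n 2 with hlt | hge
    -- For n = 1 the term with lg n vanishes, and the cost is charged to the extra summand of
    -- `redundancy`.
    · obtain rfl : n = 1 := by omega
      have : (ρ : ℝ) ≤ 1 := by exact_mod_cast hρ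
      have hb : (bitLen 1 : ℝ) = 1 := by simp [bitLen]
      rw [hb]
      simp
      nlinarith
    · have := mul_le_mul_of_nonneg_left (bitLen_le_logb hge) hρ'
      rw [if_neg (by omega)]
      linarith
  have e3 : fixedCost n ≤ n * (2 + h) * (fixedCost n / n) := by
    have : (n : ℝ) * (2 + h) * (fixedCost n / n) = fixedCost n * (2 + h) := by field_simp
    rw [this]
    nlinarith
  have e4 := mul_le_mul_of_nonneg_right hN (show (0 : ℝ) ≤ 4000 / bitLen n by positivity)
  have e5 := mul_le_mul_of_nonneg_right hN (show (0 : ℝ) ≤ 64 / bitLen (bitLen n) by positivity)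
  unfold redundancy
  linarith

theorem tendsto_bitLen : Tendsto bitLen atTop atTop := by
  apply tendsto_atTop_mono (f := fun n => Nat.log 2 n) fun n => Nat.le_succ _
  apply tendsto_atTop.2
  intro b
  filter_upwards [eventually_ge_atTop (2 ^ b)] with n hn
  exact Nat.le_log_of_pow_le (by norm_num) hn

theorem eventually_fixedCost_le : ∀ᶠ n in atTop, fixedCost n / n ≤
    300000 * ((bitLen n : ℝ) ^ 5 * (3 / 4 : ℝ) ^ bitLen n) := by
  filter_upwards [eventually_ge_atTop 1, (tendsto_bitLen.comp tendsto_bitLen).eventually_ge_atTop 20]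
    with n hn hk
  have hk : 20 ≤ bitLen (bitLen n) := hk
  have hl := bitLen_pos n
  have hc : 2 * chunk (bitLen (bitLen n)) ≤ bitLen n := by
    have h1 := chunk_mul_four_le hk
    have h2 := two_pow_bitLen_le hl
    omega
  have hkl : bitLen (bitLen n) ≤ bitLen n := bitLen_le hl
  have hn2 := two_pow_bitLen_le hn
  unfold fixedCost
  set l := bitLen n
  set k := bitLen l
  set t := chunk k
  have hl1 : (1 : ℝ) ≤ l := by exact_mod_cast hl
  have hkl' : (k : ℝ) ≤ l := by exact_mod_cast hkl
  have htl : (t : ℝ) ≤ l := by exact_mod_cast (by omega : t ≤ l)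
  have h32 : (1 : ℝ) ≤ (3 / 2 : ℝ) ^ l := one_le_pow₀ (by norm_num)
  -- From 2t ≤ l and 2 ≤ (3/2)^2. The table is thus smaller than n, which is at least 2^l / 2, by an
  -- exponential factor in l that beats all powers of l.
  have ht : (2 : ℝ) ^ t ≤ (3 / 2 : ℝ) ^ l := by
    calc (2 : ℝ) ^ t ≤ ((3 / 2 : ℝ) ^ 2) ^ t := pow_le_pow_left₀ (by norm_num) (by norm_num) _
      _ = (3 / 2 : ℝ) ^ (2 * t) := by rw [← pow_mul]
      _ ≤ (3 / 2 : ℝ) ^ l := pow_le_pow_right₀ (by norm_num) hc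
  have hn2' : (2 : ℝ) ^ l ≤ 2 * n := by exact_mod_cast hn2
  have hn0 : (0 : ℝ) < n := by positivity
  have hp : ∀ a b : ℕ, a ≤ b → (l : ℝ) ^ a ≤ (l : ℝ) ^ b := fun a b h => pow_le_pow_right₀ hl1 h
  have h5 : ∀ a : ℕ, a ≤ 5 → (l : ℝ) ^ a ≤ (l : ℝ) ^ 5 * (3 / 2 : ℝ) ^ l := fun a ha =>
    (hp a 5 ha).trans (le_mul_of_one_le_right (by positivity) h32)
  have b1 : (l : ℝ) * ((k : ℝ) ^ 2 * (l : ℝ) ^ 2) ≤ (l : ℝ) ^ 5 * (3 / 2 : ℝ) ^ l := by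
    calc (l : ℝ) * ((k : ℝ) ^ 2 * (l : ℝ) ^ 2) ≤ l * ((l : ℝ) ^ 2 * (l : ℝ) ^ 2) := by gcongr
      _ = (l : ℝ) ^ 5 := by ring
      _ ≤ _ := h5 5 le_rfl
  have b2 : (l : ℝ) * (2 ^ t * t) ≤ (l : ℝ) ^ 5 * (3 / 2 : ℝ) ^ l := by
    calc (l : ℝ) * (2 ^ t * t) ≤ l * ((3 / 2 : ℝ) ^ l * l) := by gcongr
      _ = (l : ℝ) ^ 2 * (3 / 2 : ℝ) ^ l := by ring
      _ ≤ _ := by gcongr; norm_num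
  have b3 : (k : ℝ) * ((k : ℝ) ^ 2 + 2) ≤ 3 * ((l : ℝ) ^ 5 * (3 / 2 : ℝ) ^ l) := by
    calc (k : ℝ) * ((k : ℝ) ^ 2 + 2) ≤ l * ((l : ℝ) ^ 2 + 2) := by gcongr
      _ = (l : ℝ) ^ 3 + 2 * (l : ℝ) ^ 1 := by ring
      _ ≤ _ := by linarith [h5 3 (by norm_num), h5 1 (by norm_num)]
  have b4 := h5 1 (by norm_num)
  rw [pow_one] at b4
  rw [div_le_iff₀ hn0]
  have e : (l : ℝ) ^ 5 * (3 / 2 : ℝ) ^ l = (l : ℝ) ^ 5 * (3 / 4 : ℝ) ^ l * 2 ^ l := by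
    rw [mul_assoc, ← mul_pow]
    norm_num
  have e' : (l : ℝ) ^ 5 * (3 / 2 : ℝ) ^ l ≤ (l : ℝ) ^ 5 * (3 / 4 : ℝ) ^ l * (2 * n) := by
    rw [e]
    gcongr
  have hpos : 0 ≤ (l : ℝ) ^ 5 * (3 / 2 : ℝ) ^ l := by positivity
  linarith

theorem tendsto_redundancy : Tendsto redundancy atTop (𝓝 0) := by
  have hl : Tendsto (fun n => (bitLen n : ℝ)) atTop atTop :=
    tendsto_natCast_atTop_atTop.comp tendsto_bitLen
  have hk : Tendsto (fun n => (bitLen (bitLen n) : ℝ)) atTop atTop := hl.comp tendsto_bitLen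
  have h1 := hl.const_div_atTop 4000
  have h2 := hk.const_div_atTop 64
  have h3 : Tendsto (fun n => fixedCost n / n) atTop (𝓝 0) := by
    have h4 : Tendsto (fun n => 300000 * ((bitLen n : ℝ) ^ 5 * (3 / 4 : ℝ) ^ bitLen n)) atTop
        (𝓝 0) := by
      have := ((tendsto_pow_const_mul_const_pow_of_abs_lt_one 5 (r := (3 / 4 : ℝ))
        (by norm_num [abs_of_pos])).comp tendsto_bitLen).const_mul 300000
      simpa using this
    refine tendsto_of_tendsto_of_tendsto_of_le_of_le' tendsto_const_nhds h4 ?_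
      eventually_fixedCost_le
    exact Eventually.of_forall fun n => by unfold fixedCost; positivity
  have h4 : Tendsto (fun n : ℕ => if n = 1 then (4000 : ℝ) else 0) atTop (𝓝 0) := by
    apply tendsto_const_nhds.congr'
    filter_upwards [eventually_ge_atTop 2] with n hn
    rw [if_neg (by omega)]
  have h := ((h1.add h2).add h3).add h4
  simp only [add_zero] at h
  exact h

/-! ### Assembly: encoding one permutation and averaging the query times -/

namespace WordRAM

theorem mem_runSeq {n : ℕ} {π : Equiv.Perm (Fin n)} {x : ℕ} (h : x ∈ runSeq π) : x < numRuns π := by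
  obtain ⟨v, rfl⟩ := List.mem_ofFn.1 h
  exact ((runs π).index _).2

/-- The data structure for a permutation whose runs are the leaves of the tree `T`. -/
theorem exists_data {n : ℕ} (hn : 1 ≤ n) (π : Equiv.Perm (Fin n)) (T : MergeTree)
    (hT : T.leaves = Multiset.range (numRuns π)) (hd : ∀ i, T.depth ((runs π).index i) ≤ bitLen n + 2) :
    ∃ D : List Bool,
      D.length = dataSize n (numRuns π) (∑ i, T.depth ((runs π).index i)) ∧
      (∀ i : Fin n, ∃ t ≤ queryBound * (1 + T.depth ((runs π).index i) +
          Nat.clog 2 (runAt π ((i / (n / numRuns π + 1) + 1) * (n / numRuns π + 1)) + 1 -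
            runAt π (i / (n / numRuns π + 1) * (n / numRuns π + 1)))),
        Computes (wordLength 200 n) D applyProg ((i : ℕ) + 1) ((π i : ℕ) + 1) t) ∧
      ∀ i : Fin n, ∃ t ≤ queryBound * (1 + T.depth ((runs π).index (π.symm i))),
        Computes (wordLength 200 n) D inverseProg ((i : ℕ) + 1) ((π.symm i : ℕ) + 1) t := by
  set ρ := numRuns π with hρ
  set s := runSeq π with hs
  set B := T.bits s with hB
  set d := n / ρ + 1 with hd'
  have hρ0 : 0 < ρ := numRuns_pos π hn
  have hρn : ρ ≤ n := numRuns_le π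
  have hleaf : ∀ j, j ∈ T.leaves ↔ j < ρ := fun j => by rw [hT, Multiset.mem_range]
  have hmem : ∀ y ∈ s, y ∈ T.leaves := fun y hy => (hleaf y).2 (mem_runSeq hy)
  have hsize : T.size + 1 = ρ := by
    rw [← T.card_leaves, hT, Multiset.card_range]
  have hlen : B.length = ∑ i, T.depth ((runs π).index i) := by
    rw [hB, T.length_bits s hmem, hs, runSeq, List.map_ofFn, List.sum_ofFn]
    exact Equiv.sum_comp π.symm fun i => T.depth ((runs π).index i)
  have hBn : B.length ≤ n * (bitLen n + 2) := by
    rw [hlen]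
    simpa using Finset.sum_le_card_nsmul Finset.univ (fun i => T.depth ((runs π).index i)) _
      fun i _ => hd i
  set R : ℕ → MergeTree.Rec := fun k => (T.recs s 0 0 0 0)[k]?.getD ⟨0, 0, fun _ => 0, 0⟩ with hR
  set X : Content :=
    { nodes := R
      root := T.ptr 0
      start := (runs π).sizeUpTo
      leafParent := T.leafParent 0 0
      width := d
      lo := fun b => runAt π (b * d)
      hi := fun b => runAt π ((b + 1) * d) + 1 } with hX
  -- Pointers, run starts and positions are all at most 8n.
  have hbig : ∀ x ≤ 8 * n, x < 2 ^ wordLength 200 n := by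
    intro x hx
    have h1 := lt_two_pow_bitLen n
    have h2 := bitLen_pos n
    have h3 : 2 ^ (3 + bitLen n) ≤ 2 ^ wordLength 200 n := by
      apply Nat.pow_le_pow_right (by norm_num)
      change 3 + bitLen n ≤ 200 * bitLen n
      omega
    rw [pow_add] at h3
    omega
  have hrecs : ∀ k < T.size, (R k).parent < 2 ^ wordLength 200 n ∧
      ∀ β, (R k).child β < 2 ^ wordLength 200 n := by
    intro k hk
    have hk' : k < (T.recs s 0 0 0 0).length := by rwa [T.length_recs]
    have := T.recs_le (M := 8 * n) s 0 0 0 0 (fun j hj => (hleaf j).1 hj) (Nat.zero_le _) (by omega)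
      _ (List.getElem_mem hk')
    have e : R k = (T.recs s 0 0 0 0)[k] := by
      simp only [hR, List.getElem?_eq_getElem hk', Option.getD_some]
    rw [e]
    exact ⟨hbig _ this.1, fun β => hbig _ (this.2 β)⟩
  set L := fullLayout n ρ B X with hL
  have hw : L.w = wordLength 200 n := rfl
  have W : L.Wavelet B R (T.leafParent 0 0) T.size :=
    wavelet_fullLayout hn hρn hBn (by omega) (fun β k hk => (hrecs k hk).2 β)
      (fun k hk => (hrecs k hk).1)
  have hwords : ρ ≤ L.words := by
    have h : ∀ a b c : ℕ, ρ ≤ 34 + ρ + a + b + c := by omega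
    exact h _ _ _
  have hst : T.Stored B R (T.leafParent 0 0) T.size s (T.ptr 0) 0 := by
    refine T.stored_of_recs s 0 0 [] [] (by rw [hT]; exact Multiset.nodup_range _) (by simp [hB])
      (by omega) ?_ (fun _ _ => rfl)
    intro k hk
    simp only [List.length_nil, List.count_nil] at hk ⊢
    simp only [hR, Nat.zero_add, List.getElem?_eq_getElem hk, Option.getD_some]
  have hptr : T.ptr 0 < 2 ^ L.w := hbig _ (by
    have := T.ptr_le (fun j hj => (hleaf j).1 hj) 0
    omega)
  refine ⟨L.encode, ?_, fun i => ?_, fun v => ?_⟩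
  · rw [L.length_encode, ← hlen]
    rfl
  · have hi := i.2
    have h1 := (runs π).sizeUpTo_index_le i
    have h2 := count_take_runSeq π i
    rw [← hs] at h2
    -- The width `d` exceeds n/ρ, so every position falls into one of the first ρ buckets and the
    -- bucket arrays are no longer than the others.
    have hid : (i : ℕ) / d < ρ := by
      rw [Nat.div_lt_iff_lt_mul (Nat.succ_pos _)]
      exact hi.trans (Nat.lt_mul_div_succ n hρ0)
    have hnd := Nat.div_le_self n ρ
    exact W.computes_apply hst hmem (st := (runs π).sizeUpTo) (fun _ => rfl)
      (runs π).monotone_sizeUpTo (x := (runs π).index i) (d := d) rfl (hbig _ (by omega))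
      (by omega) rfl rfl
      (by rw [← runAt_eq π i]; exact runAt_mono π (Nat.div_mul_le_self _ _))
      (by
        rw [← runAt_eq π i]
        refine Nat.lt_succ_of_le (runAt_mono π ?_)
        rw [mul_comm]
        exact (Nat.lt_mul_div_succ _ (Nat.succ_pos _)).le)
      (le_trans (runAt_lt π hn _) hwords)
      (fun q _ => hbig _ (by have := (runs π).sizeUpTo_le q; omega))
      (Nat.le_pow_clog (by norm_num) _)
      (by rw [hs, getElem?_runSeq, Equiv.symm_apply_apply]) (by omega) (lt_sizeUpTo_succ π i)
      (hbig _ (by omega)) (hbig _ (by have := (π i).2; omega))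
      (hbig _ (T.leafParent_le _ _ _ (Nat.zero_le _) (by omega)))
  · have hv := v.2
    have hv' := (π.symm v).2
    have h1 := (runs π).sizeUpTo_index_le (π.symm v)
    have h2 := count_take_runSeq π (π.symm v)
    rw [Equiv.apply_symm_apply, ← hs] at h2
    have h3 : (runs π).sizeUpTo ((runs π).index (π.symm v)) +
        (s.take v).count ((runs π).index (π.symm v) : ℕ) = π.symm v := by omega
    have := W.computes_inverse hst (st := (runs π).sizeUpTo) rfl hptr hmem (fun _ => rfl)
      (p := v) (x := (runs π).index (π.symm v)) (getElem?_runSeq π v) (hbig _ (by omega))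
      (lt_of_lt_of_le ((runs π).index (π.symm v)).2 hwords) (by rw [h3]; exact hbig _ (by omega))
    rw [h3] at this
    exact this

/-- The runs searched for position i lie between those of i - d and i + d, and q + 1 candidates need
at most q rounds. The sum of these differences telescopes to at most 2dρ, which is at most 4n
because dρ ≤ n + ρ. -/
theorem sum_search_le {n : ℕ} (hn : 1 ≤ n) (π : Equiv.Perm (Fin n)) :
    ∑ i : Fin n, Nat.clog 2 (runAt π ((i / (n / numRuns π + 1) + 1) * (n / numRuns π + 1)) + 1 -
      runAt π (i / (n / numRuns π + 1) * (n / numRuns π + 1))) ≤ 4 * n := by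
  have hρn := numRuns_le π
  set ρ := numRuns π with hρ
  set d := n / ρ + 1
  have h1 : ∀ i : Fin n, Nat.clog 2 (runAt π ((i / d + 1) * d) + 1 - runAt π (i / d * d)) ≤
      runAt π (i + d) - runAt π (i - d) := by
    intro i
    have hdm := Nat.div_add_mod (i : ℕ) d
    have hm := Nat.mod_lt (i : ℕ) (show 0 < d from Nat.succ_pos _)
    rw [mul_comm] at hdm
    have e1 : runAt π ((i / d + 1) * d) ≤ runAt π (i + d) := runAt_mono π (by
      rw [add_mul, one_mul]
      omega)
    have e2 : runAt π (i - d) ≤ runAt π (i / d * d) := runAt_mono π (by omega)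
    apply Nat.clog_le_of_le_pow
    have := Nat.lt_two_pow_self (n := runAt π (i + d) - runAt π (i - d))
    omega
  refine (Finset.sum_le_sum fun i _ => h1 i).trans ?_
  rw [Fin.sum_univ_eq_sum_range (fun i => runAt π (i + d) - runAt π (i - d)) n]
  refine (sum_sub_le_of_monotone (runAt_mono π) (fun x => (runAt_lt π hn x).le) n d).trans ?_
  have h2 : n / ρ * ρ ≤ n := Nat.div_mul_le_self _ _
  calc 2 * d * numRuns π = 2 * (n / ρ * ρ + ρ) := by
        simp only [d, ← hρ]
        ring
    _ ≤ 4 * n := by omega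

end WordRAM

open WordRAM in
/-- The encoding of one permutation. -/
theorem exists_encoding {n : ℕ} (hn : 1 ≤ n) (π : Equiv.Perm (Fin n)) :
    ∃ D : List Bool,
      (D.length : ℝ) ≤ n * (2 + entropy (runLengths π)) * (1 + redundancy n) +
        8000 * (numRuns π * Real.logb 2 n) ∧
      ∃ T T' : Fin n → ℕ,
        (∀ i : Fin n, Computes (wordLength 200 n) D applyProg ((i : ℕ) + 1) ((π i : ℕ) + 1) (T i)) ∧
        (∀ i : Fin n, Computes (wordLength 200 n) D inverseProg ((i : ℕ) + 1) ((π.symm i : ℕ) + 1) (T' i)) ∧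
        (∀ i, (T i : ℝ) ≤ 7 * queryBound * (1 + Real.logb 2 (numRuns π))) ∧
        (∀ i, (T' i : ℝ) ≤ 7 * queryBound * (1 + Real.logb 2 (numRuns π))) ∧
        (∑ i, (T i : ℝ)) / n ≤ 7 * queryBound * (1 + entropy (runLengths π)) ∧
        (∑ i, (T' i : ℝ)) / n ≤ 7 * queryBound * (1 + entropy (runLengths π)) := by
  obtain ⟨M, hM, hdepth⟩ := exists_mergeTree π hn
  have hn0 : (0 : ℝ) < n := by exact_mod_cast hn
  have hρn := numRuns_le π
  have hρ := numRuns_pos π hn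
  have hρ1 : (1 : ℝ) ≤ numRuns π := by exact_mod_cast hρ
  have hlg : 0 ≤ Real.logb 2 (numRuns π) := Real.logb_nonneg (by norm_num) hρ1
  have hH := entropy_nonneg π hn
  have hdn : ∀ i, M.depth ((runs π).index i) ≤ bitLen n + 2 := by
    intro i
    have h1 := (hdepth ((runs π).index i)).1
    have h2 : Real.logb 2 (numRuns π) ≤ bitLen n := by
      rw [Real.logb_le_iff_le_rpow (by norm_num) (by positivity), Real.rpow_natCast]
      exact_mod_cast hρn.trans (lt_two_pow_bitLen n).le
    have : (M.depth ((runs π).index i) : ℝ) ≤ (bitLen n + 2 : ℕ) := by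
      push_cast
      linarith
    exact_mod_cast this
  have hsum : (∑ i, (M.depth ((runs π).index i) : ℝ)) ≤ n * (2 + entropy (runLengths π)) := by
    calc (∑ i, (M.depth ((runs π).index i) : ℝ)) ≤
          ∑ i : Fin n, (Real.logb 2 (n / (runs π).blocksFun ((runs π).index i)) + 2) :=
        Finset.sum_le_sum fun i _ => (hdepth _).2
      _ = n * (2 + entropy (runLengths π)) := by
        rw [Finset.sum_add_distrib, ← entropy_runLengths]
        simp
        ring
  obtain ⟨D, hD, hA, hI⟩ := exists_data hn π M hM hdn
  choose T hT hTc using hA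
  choose T' hT' hTc' using hI
  set Q : ℝ := (queryBound : ℝ)
  have hQ : 0 ≤ Q := Nat.cast_nonneg _
  set m : Fin n → ℕ := fun i =>
    Nat.clog 2 (runAt π ((i / (n / numRuns π + 1) + 1) * (n / numRuns π + 1)) + 1 -
      runAt π (i / (n / numRuns π + 1) * (n / numRuns π + 1))) with hm
  have hmρ : ∀ i, (m i : ℝ) ≤ Real.logb 2 (numRuns π) + 1 := by
    intro i
    have h1 : m i ≤ Nat.clog 2 (numRuns π) := Nat.clog_mono_right 2 (by
      have := runAt_lt π hn ((i / (n / numRuns π + 1) + 1) * (n / numRuns π + 1))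
      omega)
    have h2 : Nat.clog 2 (numRuns π) ≤ Nat.log 2 (numRuns π) + 1 :=
      Nat.clog_le_of_le_pow (Nat.lt_pow_succ_log_self (by norm_num) _).le
    have h3 : (Nat.log 2 (numRuns π) : ℝ) ≤ Real.logb 2 (numRuns π) := by
      exact_mod_cast Real.natLog_le_logb (numRuns π) 2
    have h4 : (m i : ℝ) ≤ (Nat.log 2 (numRuns π) + 1 : ℕ) := by exact_mod_cast h1.trans h2
    push_cast at h4
    linarith
  have hTle : ∀ i, (T i : ℝ) ≤ Q * (1 + M.depth ((runs π).index i) + m i) := fun i => by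
    have h : (T i : ℝ) ≤ ((queryBound * (1 + M.depth ((runs π).index i) + m i) : ℕ) : ℝ) :=
      Nat.cast_le.2 (hT i)
    rwa [Nat.cast_mul, Nat.cast_add, Nat.cast_add, Nat.cast_one] at h
  have hTle' : ∀ i, (T' i : ℝ) ≤ Q * (1 + M.depth ((runs π).index (π.symm i))) := fun i => by
    have h : (T' i : ℝ) ≤ ((queryBound * (1 + M.depth ((runs π).index (π.symm i))) : ℕ) : ℝ) :=
      Nat.cast_le.2 (hT' i)
    rwa [Nat.cast_mul, Nat.cast_add, Nat.cast_one] at h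
  have hmsum : ∑ i, (m i : ℝ) ≤ 4 * n := by exact_mod_cast sum_search_le hn π
  refine ⟨D, ?_, T, T', hTc, hTc', fun i => ?_, fun i => ?_, ?_, ?_⟩
  · rw [hD]
    exact dataSize_le hn hρn hH (by exact_mod_cast hsum)
  · refine (hTle i).trans ?_
    rw [mul_comm 7 Q, mul_assoc]
    apply mul_le_mul_of_nonneg_left _ hQ
    have := (hdepth ((runs π).index i)).1
    have := hmρ i
    linarith
  · refine (hTle' i).trans ?_
    rw [mul_comm 7 Q, mul_assoc]
    apply mul_le_mul_of_nonneg_left _ hQ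
    have := (hdepth ((runs π).index (π.symm i))).1
    linarith
  -- On average: 1 for the overhead, 2 + H for the depth and 4 for the search. This is where the
  -- constant 7 comes from.
  · rw [div_le_iff₀ hn0]
    refine (Finset.sum_le_sum fun i _ => hTle i).trans ?_
    rw [← Finset.mul_sum, Finset.sum_add_distrib, Finset.sum_add_distrib, mul_comm 7 Q, mul_assoc,
      mul_assoc]
    apply mul_le_mul_of_nonneg_left _ hQ
    simp only [Finset.sum_const, Finset.card_univ, Fintype.card_fin, nsmul_eq_mul, mul_one]
    have : 0 ≤ entropy (runLengths π) * n := by positivity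
    linarith
  · rw [div_le_iff₀ hn0]
    refine (Finset.sum_le_sum fun i _ => hTle' i).trans ?_
    -- A uniformly random value has a uniformly random position, so the average depth is the same as
    -- for π.
    rw [← Finset.mul_sum, Finset.sum_add_distrib, mul_comm 7 Q, mul_assoc, mul_assoc,
      Equiv.sum_comp π.symm fun i => (M.depth ((runs π).index i) : ℝ)]
    apply mul_le_mul_of_nonneg_left _ hQ
    simp only [Finset.sum_const, Finset.card_univ, Fintype.card_fin, nsmul_eq_mul, mul_one]
    have : 0 ≤ entropy (runLengths π) * n := by positivity
    linarith

theorem mainTheorem1 :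
    ∃ (enc : (n : ℕ) → Equiv.Perm (Fin n) → List Bool) (apply inverse : WordRAM.Prog)
      (c : ℕ) (ε : ℕ → ℝ) (C : ℝ),
      0 < c ∧ Tendsto ε atTop (𝓝 0) ∧
      ∀ (n : ℕ) (π : Equiv.Perm (Fin n)), 1 ≤ n →
        ((enc n π).length : ℝ) ≤
            n * (2 + entropy (runLengths π)) * (1 + ε n) + C * (numRuns π * Real.logb 2 n) ∧
        ∃ T T' : Fin n → ℕ,
          (∀ i : Fin n, WordRAM.Computes (WordRAM.wordLength c n) (enc n π) apply
              ((i : ℕ) + 1) ((π i : ℕ) + 1) (T i)) ∧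
          (∀ i : Fin n, WordRAM.Computes (WordRAM.wordLength c n) (enc n π) inverse
              ((i : ℕ) + 1) ((π.symm i : ℕ) + 1) (T' i)) ∧
          (∀ i : Fin n, (T i : ℝ) ≤ C * (1 + Real.logb 2 (numRuns π))) ∧
          (∀ i : Fin n, (T' i : ℝ) ≤ C * (1 + Real.logb 2 (numRuns π))) ∧
          (∑ i : Fin n, (T i : ℝ)) / n ≤ C * (1 + entropy (runLengths π)) ∧
          (∑ i : Fin n, (T' i : ℝ)) / n ≤ C * (1 + entropy (runLengths π)) := by
  -- The encoding is chosen separately for each permutation, while programs and constants are fixed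
  -- beforehand; n = 0 gets the empty string.
  have key : ∀ (n : ℕ) (π : Equiv.Perm (Fin n)), ∃ D : List Bool, 1 ≤ n → _ := fun n π =>
    if hn : 1 ≤ n then (exists_encoding hn π).imp fun _ h _ => h else ⟨[], fun h => absurd h hn⟩
  choose enc henc using key
  refine ⟨enc, WordRAM.applyProg, WordRAM.inverseProg, 200, redundancy,
    8000 + 7 * WordRAM.queryBound, by norm_num, tendsto_redundancy, fun n π hn => ?_⟩
  obtain ⟨hlen, T, T', h1, h2, h3, h4, h5, h6⟩ := henc n π hn
  have hlg : 0 ≤ Real.logb 2 (numRuns π) :=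
    Real.logb_nonneg (by norm_num) (by exact_mod_cast numRuns_pos π hn)
  have hlgn : 0 ≤ Real.logb 2 n := Real.logb_nonneg (by norm_num) (by exact_mod_cast hn)
  have hH := entropy_nonneg π hn
  have hQ : (0 : ℝ) ≤ 7 * WordRAM.queryBound := by positivity
  have hC : ∀ x : ℝ, 0 ≤ x → 7 * (WordRAM.queryBound : ℝ) * (1 + x) ≤
      (8000 + 7 * WordRAM.queryBound) * (1 + x) := fun x hx =>
    mul_le_mul_of_nonneg_right (by linarith) (by linarith)
  refine ⟨hlen.trans ?_, T, T', h1, h2, fun i => (h3 i).trans (hC _ hlg),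
    fun i => (h4 i).trans (hC _ hlg), h5.trans (hC _ hH), h6.trans (hC _ hH)⟩
  have : 0 ≤ (numRuns π : ℝ) * Real.logb 2 n := by positivity
  have := mul_nonneg hQ this
  linarith
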